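/- **Notation.** Let $n\ge 2$, $m\ge 0$ be integers, and let $S^m$ be the space of complex symmetric tensors $u=(u_{i_1\dots i_m})$ of rank $m$ on $\mathbb R^n$ (components in the standard basis; repeated indices are summed). Let $\mathcal S(\mathbb R^n;S^m)$ be the symmetric tensor fields with components in the Schwartz space, $\sigma$ the symmetrization in all indices, and $\delta$ the Kronecker tensor. On smooth symmetric tensor fields put $$(du)_{i_1\dots i_{s+1}}=\sigma\,\partial_{i_{s+1}}u_{i_1\dots i_s},\qquad (\mathrm{div}\,u)_{i_1\dots i_{s}}=\partial_{j}u_{i_1\dots i_sj},\qquad i\,u=\sigma(\delta\otimes u),$$ $$(j\,u)_{i_1\dots i_s}=u_{i_1\dots i_s pp},\qquad (j_xu)_{i_1\dots i_s}(x)=x_p\,u_{i_1\dots i_sp}(x).$$ For $0\le k\le m$, the momentum ray transform of $f\in\mathcal S(\mathbb R^n;S^m)$ is $$I_m^kf(x,\xi)=\int_{\mathbb R}t^k f_{i_1\dots i_m}(x+t\xi)\,\xi_{i_1}\cdots\xi_{i_m}\,dt\qquad(|\xi|=1,\ \langle x,\xi\rangle=0).$$ Its formal adjoint with respect to the $L^2$-products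 on $\mathbb R^n$ and on $T\mathbb S^{n-1}=\{(x,\xi):|\xi|=1,\langle x,\xi\rangle=0\}$ (Lebesgue measure $dx$ on $\xi^\perp$, surface measure $d\xi$ on $\mathbb S^{n-1}$) is $$\big((I_m^k)^*\varphi\big)_{i_1\dots i_m}(x)=\int_{\mathbb S^{n-1}}\langle x,\xi\rangle^k\,\xi_{i_1}\cdots\xi_{i_m}\,\varphi(x-\langle x,\xi\rangle\xi,\xi)\,d\xi ,$$ and $N_m^k=(I_m^k)^*I_m^k$ is the normal operator, which maps $\mathcal S(\mathbb R^n;S^m)$ to $C^\infty(\mathbb R^n;S^m)$. Let $\widehat u(y)=(2\pi)^{-n/2}\int e^{-\mathrm i\langle y,x\rangle}u(x)\,dx$, extended to tempered distributions, and let $(-\Delta)^{1/2}u=\mathcal F^{-1}(|y|\,\widehat u)$, componentwise, for tempered $u$ such that $\widehat u$ is a function with $|y|\,\widehat u(y)$ integrable. Finally $(-1)!!=0!!=1$ and $l!!=l\,(l-2)!!$ for $l\ge1$. **Theorem.** Let $m\ge0$ and $n\ge2$ be integers. For $0\le k\le m$ define $$D_{m,n}^k=c_{m,n}^k\sum_{p=k}^m(n+2m-2p-3)!!\sum_{q=0}^{\min(p,m-p,p-k)}\frac{(-1)^q}{2^q\,q!\,(m-p-q)!\,(p-k-q)!}\;d^{\,p-q}\,i^q\,j^q\,j_x^{\,p-k-q}\,\mathrm{div}^k,$$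 $$c_{m,n}^k=\frac{(-1)^k}{(k!)^2}\;\frac{2^{m-2}\,\Gamma\big(\tfrac{2m+n-1}{2}\big)}{\pi^{(n+1)/2}\,(n+2m-3)!!}.$$ Then $D_{m,n}^k:C^\infty(\mathbb R^n;S^m)\to C^\infty(\mathbb R^n;S^m)$ is a linear differential operator of order $m+k$, and every $f\in\mathcal S(\mathbb R^n;S^m)$ is recovered from $(N_m^0f,\dots,N_m^mf)$ by $$f(x)=(-\Delta)^{1/2}\sum_{k=0}^m D_{m,n}^k\big(N_m^kf\big)(x)\qquad(x\in\mathbb R^n);$$ in particular $(-\Delta)^{1/2}$ of the sum on the right-hand side is well defined in the above sense. -/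

import Mathlib

open MeasureTheory
open scoped SchwartzMap ContDiff Nat ComplexConjugate

noncomputable section

namespace MomentumRay

/-! ### Tensor algebra -/

/-- The Euclidean space `ℝⁿ`. -/
abbrev Rn (n : ℕ) : Type := EuclideanSpace ℝ (Fin n)

/-- The standard basis vector `e_j`. -/
def basisVec {n : ℕ} (j : Fin n) : Rn n := EuclideanSpace.single j 1

/-- Complex tensors of rank `m` on `ℝⁿ`, given by their components `u_{i₁…i_m}`. -/
abbrev Tensor (n m : ℕ) : Type := (Fin m → Fin n) → ℂ

/-- The space `S^m` of symmetric tensors of rank `m`. -/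
def SymTensor (n m : ℕ) : Submodule ℂ (Tensor n m) where
  carrier := {u | ∀ (π : Equiv.Perm (Fin m)) (I : Fin m → Fin n), u (I ∘ π) = u I}
  add_mem' := by
    intro u v hu hv π I
    simp [hu π I, hv π I]
  zero_mem' := by
    intro π I
    rfl
  smul_mem' := by
    intro c u hu π I
    simp [hu π I]

/-- The symmetrization `σ` in all indices. -/
def symmetrize {n m : ℕ} (u : Tensor n m) : Tensor n m := fun I =>
  ((m ! : ℕ) : ℂ)⁻¹ * ∑ π : Equiv.Perm (Fin m), u (I ∘ π)

/-- The tensor product `u ⊗ v`. -/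
def tensorProd {n a b : ℕ} (u : Tensor n a) (v : Tensor n b) : Tensor n (a + b) := fun I =>
  u (I ∘ Fin.castAdd b) * v (I ∘ Fin.natAdd a)

/-- The operator `i_u` of symmetric multiplication by `u`. The symmetric product is commutative;
the factor `u` is put in the last indices, so that the rank reads `s + a`. -/
def symMul {n a s : ℕ} (u : Tensor n a) (v : Tensor n s) : Tensor n (s + a) :=
  symmetrize (tensorProd v u)

/-- The operator `j_u` of contraction with `u` in the last indices. -/
def contract {n a s : ℕ} (u : Tensor n a) (v : Tensor n (s + a)) : Tensor n s := fun I =>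
  ∑ J : Fin a → Fin n, v (Fin.append I J) * u J

/-- The Kronecker tensor `δ`. -/
def kronecker (n : ℕ) : Tensor n 2 := fun I => if I 0 = I 1 then 1 else 0

/-- A vector of `ℝⁿ` as a tensor of rank one. -/
def vecTensor {n : ℕ} (x : Rn n) : Tensor n 1 := fun I => (x (I 0) : ℂ)

/-- The component `ξ_{i₁} ⋯ ξ_{i_m}` of the power `ξ^m`. -/
def vecPow {n m : ℕ} (ξ : Rn n) : Tensor n m := fun I => ∏ a, (ξ (I a) : ℂ)

/-! ### Operators on tensor fields -/

/-- Tensor fields of rank `m` on `ℝⁿ`. -/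
abbrev Field (n m : ℕ) : Type := Rn n → Tensor n m

/-- Smooth symmetric tensor fields, i.e. the space `C^∞(ℝⁿ; S^m)`. -/
def IsSmoothSym {n m : ℕ} (g : Field n m) : Prop :=
  ContDiff ℝ ∞ g ∧ ∀ x, g x ∈ SymTensor n m

/-- The partial derivative `∂_j g_I`. -/
def pderiv {n m : ℕ} (j : Fin n) (g : Field n m) : Field n m := fun x I =>
  fderiv ℝ (fun y => g y I) x (basisVec j)

/-- The inner derivative `(dg)_{i₁…i_{m+1}} = σ(i₁…i_{m+1}) ∂g_{i₁…i_m}/∂x^{i_{m+1}}`. -/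
def innerDeriv {n m : ℕ} (g : Field n m) : Field n (m + 1) := fun x =>
  symmetrize (fun I => pderiv (I (Fin.last m)) g x (Fin.init I))

/-- The divergence `(div g)_{i₁…i_m} = ∑_j ∂g_{i₁…i_m j}/∂x^j`. -/
def divergence {n m : ℕ} (g : Field n (m + 1)) : Field n m := fun x I =>
  ∑ j, pderiv j g x (Fin.snoc I j)

/-- The operator `i = i_δ`. -/
def opI {n m : ℕ} (g : Field n m) : Field n (m + 2) := fun x => symMul (kronecker n) (g x)

/-- The operator `j = j_δ`. -/
def opJ {n m : ℕ} (g : Field n (m + 2)) : Field n m := fun x => contract (kronecker n) (g x)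

/-- The operator `j_x` of contraction with the position vector. -/
def opJx {n m : ℕ} (g : Field n (m + 1)) : Field n m := fun x => contract (vecTensor x) (g x)

/-- `d^r`. -/
def innerDerivPow {n m : ℕ} : (r : ℕ) → Field n m → Field n (m + r)
  | 0, g => g
  | r + 1, g => innerDeriv (innerDerivPow r g)

/-- `i^r`. -/
def opIPow {n m : ℕ} : (r : ℕ) → Field n m → Field n (m + 2 * r)
  | 0, g => g
  | r + 1, g => opI (opIPow r g)

/-- `div^r`. -/
def divergencePow {n m : ℕ} : (r : ℕ) → Field n (m + r) → Field n m
  | 0, g => g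
  | r + 1, g => divergencePow r (divergence g)

/-- `j^r`. -/
def opJPow {n m : ℕ} : (r : ℕ) → Field n (m + 2 * r) → Field n m
  | 0, g => g
  | r + 1, g => opJPow r (opJ g)

/-- `j_x^r`. -/
def opJxPow {n m : ℕ} : (r : ℕ) → Field n (m + r) → Field n m
  | 0, g => g
  | r + 1, g => opJxPow r (opJx g)

/-- Transport of a tensor field along an equality of ranks `a = b`. It is used only for ranks that
are equal; the value `0` for different ranks is never met. -/
def castRank {n a : ℕ} (b : ℕ) (g : Field n a) : Field n b := fun x I =>
  if h : a = b then g x (I ∘ Fin.cast h) else 0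

/-! ### Ray transforms and normal operators -/

/-- The momentum ray transform `I_m^k f(x, ξ) = ∫ t^k ⟨f(x + tξ), ξ^m⟩ dt`. -/
def rayTransform {n m : ℕ} (k : ℕ) (f : Field n m) (x ξ : Rn n) : ℂ :=
  ∫ t : ℝ, (t : ℂ) ^ k * ∑ I : Fin m → Fin n, f (x + t • ξ) I * vecPow ξ I

/-- The operator `(I_m^k)^*`:
`((I_m^k)^* χ)_{i₁…i_m}(x) = ∫_{S^{n-1}} ⟨x,ξ⟩^k ξ_{i₁} ⋯ ξ_{i_m} χ(x - ⟨x,ξ⟩ξ, ξ) dξ`. -/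
def rayAdjoint {n : ℕ} (m k : ℕ) (χ : Rn n → Rn n → ℂ) : Field n m := fun x I =>
  ∫ ξ : Metric.sphere (0 : Rn n) 1,
    ((inner ℝ x (ξ : Rn n) : ℝ) : ℂ) ^ k * vecPow (ξ : Rn n) I *
      χ (x - (inner ℝ x (ξ : Rn n) : ℝ) • (ξ : Rn n)) ξ
    ∂(volume : Measure (Rn n)).toSphere

/-- The `L²`-product of tensor fields on `ℝⁿ`. -/
def l2Field {n m : ℕ} (f g : Field n m) : ℂ :=
  ∫ x, ∑ I : Fin m → Fin n, f x I * conj (g x I)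

/-- The `L²`-product on `TS^{n-1} = {(x, ξ) : |ξ| = 1, ⟨x, ξ⟩ = 0}`; the inner integral is
over the hyperplane `ξ^⊥` with its Lebesgue measure as a Euclidean space. -/
def l2TangentSphere {n : ℕ} (χ ψ : Rn n → Rn n → ℂ) : ℂ :=
  ∫ ξ : Metric.sphere (0 : Rn n) 1,
    (∫ x : (Submodule.span ℝ {(ξ : Rn n)})ᗮ, χ x ξ * conj (ψ x ξ))
    ∂(volume : Measure (Rn n)).toSphere

/-- A symmetric Schwartz tensor field as a tensor field. -/
def toField {n m : ℕ} (f : 𝓢(Rn n, SymTensor n m)) : Field n m := fun x => (f x : Tensor n m)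

/-- `rayAdjoint m k` is the formal adjoint of `I_m^k` with respect to the two `L²`-products. The
Schwartz functions on `TS^{n-1}` are the restrictions of Schwartz functions on `ℝⁿ × ℝⁿ`. -/
def IsFormalAdjoint (n m k : ℕ) : Prop :=
  ∀ (f : 𝓢(Rn n, SymTensor n m)) (χ : 𝓢(Rn n × Rn n, ℂ)),
    l2TangentSphere (rayTransform k (toField f)) (fun x ξ => χ (x, ξ)) =
      l2Field (toField f) (rayAdjoint m k (fun x ξ => χ (x, ξ)))

/-- The normal operator `N_m^k = (I_m^k)^* I_m^k`. -/
def normalOp {n m : ℕ} (k : ℕ) (f : Field n m) : Field n m :=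
  rayAdjoint m k (rayTransform k f)

/-! ### The differential operators `D_{m,n}^k` -/

/-- The coefficient `c_{m,n}^k`. The truncated difference in `(n + 2m - 3)‼` accounts for the
convention `(-1)!! = 1`. -/
def coeffC (m n k : ℕ) : ℝ :=
  (-1) ^ k / (k ! : ℝ) ^ 2 *
    ((2 : ℝ) ^ ((m : ℤ) - 2) * Real.Gamma ((2 * (m : ℝ) + n - 1) / 2) /
      (Real.pi ^ (((n : ℝ) + 1) / 2) * ((n + 2 * m - 3)‼ : ℕ)))

/-- The operator `d^{p-q} i^q j^q j_x^{p-k-q} div^k` on fields of rank `m`, where `k + q ≤ p` and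
`p + q ≤ m`. The ranks are `m`, `m - k`, `m - p + q`, `m - p - q`, `m - p + q`, `m`. -/
def termD {n m : ℕ} (k p q : ℕ) (g : Field n m) : Field n m :=
  castRank m
    (innerDerivPow (p - q) (opIPow q (opJPow q (opJxPow (p - k - q) (divergencePow k
      (castRank ((m - p - q) + 2 * q + (p - k - q) + k) g))))))

/-- The operator `D_{m,n}^k`, for `k ≤ m` and `2 ≤ n`. For `p ≤ m` the number `n + 2m - 2p - 3` is at
least `-1`, and the truncated difference accounts for the convention `(-1)!! = 1`. -/
def opD (m n k : ℕ) (g : Field n m) : Field n m := fun x I =>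
  (coeffC m n k : ℂ) * ∑ p ∈ Finset.Icc k m, (((n + 2 * m - 2 * p - 3)‼ : ℕ) : ℂ) *
    ∑ q ∈ Finset.range (min p (min (m - p) (p - k)) + 1),
      (-1 : ℂ) ^ q / (2 ^ q * (q ! : ℂ) * ((m - p - q)! : ℂ) * ((p - k - q)! : ℂ)) *
        termD k p q g x I

/-- `P` agrees on smooth symmetric tensor fields with a linear differential operator
`∑_{s ≤ r} ∑_{|α| = s} ∑_J c_{α,J,I}(x) ∂_α g_J(x)` of order at most `r` with smooth coefficients,
and takes smooth symmetric tensor fields to such fields. -/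
def IsDiffOpOfOrderLE {n a b : ℕ} (P : Field n a → Field n b) (r : ℕ) : Prop :=
  (∀ g, IsSmoothSym g → IsSmoothSym (P g)) ∧
  ∃ c : (s : ℕ) → (Fin s → Fin n) → (Fin a → Fin n) → (Fin b → Fin n) → Rn n → ℂ,
    (∀ s α J I, ContDiff ℝ ∞ (c s α J I)) ∧
    ∀ g, IsSmoothSym g → ∀ x I,
      P g x I = ∑ s ∈ Finset.range (r + 1), ∑ α : Fin s → Fin n, ∑ J : Fin a → Fin n,
        c s α J I x * iteratedFDeriv ℝ s (fun y => g y J) x (fun l => basisVec (α l))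

/-- `P` is a linear differential operator of order `r`, and not of smaller order. -/
def IsDiffOpOfOrder {n a b : ℕ} (P : Field n a → Field n b) (r : ℕ) : Prop :=
  IsDiffOpOfOrderLE P r ∧ ∀ r' < r, ¬ IsDiffOpOfOrderLE P r'

/-! ### The operator `(-Δ)^{1/2}` -/

/-- The Fourier transform `(2π)^{-n/2} ∫ e^{-i⟨y,x⟩} χ(x) dx`. -/
def fourierT {n : ℕ} (χ : Rn n → ℂ) (y : Rn n) : ℂ :=
  (((2 * Real.pi) ^ (-(n : ℝ) / 2) : ℝ) : ℂ) *
    ∫ x, Complex.exp (-Complex.I * ((inner ℝ y x : ℝ) : ℂ)) * χ x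

/-- The inverse Fourier transform `(2π)^{-n/2} ∫ e^{i⟨x,y⟩} h(y) dy`. -/
def fourierTInv {n : ℕ} (h : Rn n → ℂ) (x : Rn n) : ℂ :=
  (((2 * Real.pi) ^ (-(n : ℝ) / 2) : ℝ) : ℂ) *
    ∫ y, Complex.exp (Complex.I * ((inner ℝ x y : ℝ) : ℂ)) * h y

/-- Functions `u` with `∫ |u(x)| (1 + |x|)^{-N} dx < ∞` for some `N`; such a function is the
tempered distribution `χ ↦ ∫ u χ`. -/
def IsTempered {n : ℕ} (u : Rn n → ℂ) : Prop :=
  ∃ N : ℕ, Integrable (fun x => (((1 + ‖x‖) ^ N)⁻¹ : ℝ) • u x)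

/-- The Fourier transform of the tempered distribution `u` is the function `h`. -/
def HasFourier {n : ℕ} (u h : Rn n → ℂ) : Prop :=
  IsTempered u ∧ IsTempered h ∧ ∀ χ : 𝓢(Rn n, ℂ), ∫ x, u x * fourierT χ x = ∫ y, h y * χ y

/-- `(-Δ)^{1/2} u` is defined and equals `v` at every point: the Fourier transform of the tempered
distribution `u` is a function `h` (unique almost everywhere) such that `|y| h(y)` is integrable,
and `v` is the inverse Fourier transform of `|y| h(y)`. -/
def HasSqrtNegLaplacian {n : ℕ} (u v : Rn n → ℂ) : Prop :=
  ∃ h : Rn n → ℂ, HasFourier u h ∧ Integrable (fun y => (‖y‖ : ℂ) * h y) ∧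
    ∀ x, v x = fourierTInv (fun y => (‖y‖ : ℂ) * h y) x

end MomentumRay

end

open MomentumRay
open scoped SchwartzMap

/-!
A symmetric tensor `u` is determined by the polynomial `u(η) = ∑_I u_I η_I`. On these polynomials
`d` is the directional derivative `D_η` and `i` is multiplication by `|η|²`, while the images of
`N_m^k f` under `div`, `j_x` and `j` are integrals of `⟨f(x + tξ), ξ^m⟩` over all rays, with
explicit weights `⟨x,ξ⟩^a (t + ⟨x,ξ⟩)^b ⟨ξ,η⟩^c`. By the binomial expansion of
`(⟨x,ξ⟩ - (t + ⟨x,ξ⟩))^a = (-t)^a`, the sum over `k` of the reconstruction formula moves the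
derivatives `D_η` onto `f`.

Polar coordinates `z = tξ` over full lines and the Gamma integral then turn each remaining term into
a superposition over `λ` of moments of the Gaussian `G = e^{-λ|z|²}`. The sum over `q` produces the
Hermite-type polynomials `K_r` with `K_r G = (-D_η)^r G / r!`, and integration by parts collapses
the sum to a multiple of `∑_J η_J ∫∫ λ^{(n-3)/2} e^{-λ|z|²} f_J(z + x) dz dλ`. Hence
`∑_k D_{m,n}^k N_m^k f` is the Riesz potential whose Fourier transform is `|y|^{-1}` times that
of `f`.

That the order of `D_{m,n}^k` is exactly `m + k` is seen on the fields
`(x_i - 1)^{m+k} e_i ⊗ ⋯ ⊗ e_i`. The duality between `I_m^k` and its adjoint is Fubini's theorem for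
the splittings `ℝ × ξ^⊥ ≅ ℝⁿ`.
-/

noncomputable section

namespace MomentumRay

/-! ### Symmetric tensors as polynomials -/

section Tensor

variable {n m a b : ℕ}

lemma vecPow_append (ξ : Rn n) (I : Fin a → Fin n) (J : Fin b → Fin n) :
    vecPow ξ (Fin.append I J) = vecPow ξ I * vecPow ξ J := by
  simp [vecPow, Fin.prod_univ_add]

lemma vecPow_snoc (ξ : Rn n) (I : Fin m → Fin n) (j : Fin n) :
    vecPow ξ (Fin.snoc I j : Fin (m + 1) → Fin n) = vecPow ξ I * (ξ j : ℂ) := by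
  simp [vecPow, Fin.prod_univ_castSucc]

lemma vecPow_mem (ξ : Rn n) : (vecPow ξ : Tensor n m) ∈ SymTensor n m := fun π I =>
  Equiv.prod_comp π (fun a => (ξ (I a) : ℂ))

lemma vecPow_smul (t : ℝ) (ξ : Rn n) (I : Fin m → Fin n) :
    vecPow (t • ξ) I = (t : ℂ) ^ m * vecPow ξ I := by
  simp [vecPow, Finset.prod_mul_distrib]

lemma norm_vecPow_le (ξ : Rn n) (I : Fin m → Fin n) : ‖vecPow ξ I‖ ≤ ‖ξ‖ ^ m := by
  calc ‖vecPow ξ I‖ = ∏ a, ‖(ξ (I a) : ℂ)‖ := norm_prod _ _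
    _ ≤ ∏ _a : Fin m, ‖ξ‖ := by
        refine Finset.prod_le_prod (fun _ _ => norm_nonneg _) fun a _ => ?_
        rw [Complex.norm_real]
        exact PiLp.norm_apply_le ξ (I a)
    _ = ‖ξ‖ ^ m := by simp

@[fun_prop]
lemma continuous_vecPow (I : Fin m → Fin n) : Continuous (fun ξ : Rn n => vecPow ξ I) := by
  unfold vecPow
  fun_prop

lemma symmetrize_mem (u : Tensor n m) : symmetrize u ∈ SymTensor n m := by
  intro π I
  unfold symmetrize
  congr 1
  exact Equiv.sum_comp (Equiv.mulLeft π) (fun ρ : Equiv.Perm (Fin m) => u (I ∘ ρ))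

/-- The homogeneous polynomial function `u(η) = ∑_I u_I η_I` of a tensor `u`. -/
def tensorEval (u : Tensor n m) (η : Rn n) : ℂ := ∑ I, u I * vecPow η I

lemma tensorEval_smul (c : ℂ) (u : Tensor n m) (η : Rn n) :
    tensorEval (c • u) η = c * tensorEval u η := by
  simp [tensorEval, Finset.mul_sum, mul_assoc]

lemma tensorEval_sum {ι : Type*} (s : Finset ι) (u : ι → Tensor n m) (η : Rn n) :
    tensorEval (∑ i ∈ s, u i) η = ∑ i ∈ s, tensorEval (u i) η := by
  simp only [tensorEval, Finset.sum_apply, Finset.sum_mul]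
  exact Finset.sum_comm

lemma tensorEval_sub (u v : Tensor n m) (η : Rn n) :
    tensorEval (u - v) η = tensorEval u η - tensorEval v η := by
  simp [tensorEval, sub_mul]

lemma tensorEval_symmetrize (u : Tensor n m) (η : Rn n) :
    tensorEval (symmetrize u) η = tensorEval u η := by
  have tensorEval_comp_perm (π : Equiv.Perm (Fin m)) :
      ∑ I : Fin m → Fin n, u (I ∘ π) * vecPow η I = tensorEval u η := by
    unfold tensorEval
    rw [← (Equiv.arrowCongr π.symm (Equiv.refl (Fin n))).sum_comp fun I => u I * vecPow η I]
    exact Finset.sum_congr rfl fun I _ => congrArg (u (I ∘ π) * ·) (vecPow_mem η π I).symm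
  have hm : ((m ! : ℕ) : ℂ) ≠ 0 := by exact_mod_cast m.factorial_ne_zero
  calc tensorEval (symmetrize u) η
      = ((m ! : ℕ) : ℂ)⁻¹ * ∑ π : Equiv.Perm (Fin m), ∑ I, u (I ∘ π) * vecPow η I := by
        simp only [tensorEval, symmetrize, mul_assoc, Finset.sum_mul, ← Finset.mul_sum]
        rw [Finset.sum_comm]
    _ = ((m ! : ℕ) : ℂ)⁻¹ * ((m ! : ℕ) * tensorEval u η) := by
        simp [tensorEval_comp_perm, Fintype.card_perm]
    _ = tensorEval u η := inv_mul_cancel_left₀ hm _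

lemma tensorEval_tensorProd (u : Tensor n a) (v : Tensor n b) (η : Rn n) :
    tensorEval (tensorProd u v) η = tensorEval u η * tensorEval v η := by
  unfold tensorEval
  rw [Finset.sum_mul_sum, ← Finset.sum_product', ← (Fin.appendEquiv a b).sum_comp]
  refine Finset.sum_congr rfl fun ⟨I, J⟩ _ => ?_
  have left_append : Fin.append I J ∘ Fin.castAdd b = I := by ext; simp
  have right_append : Fin.append I J ∘ Fin.natAdd a = J := by ext; simp
  change tensorProd u v (Fin.append I J) * vecPow η (Fin.append I J) = _
  rw [vecPow_append, tensorProd, left_append, right_append]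
  ring

lemma tensorEval_kronecker (η : Rn n) : tensorEval (kronecker n) η = ((‖η‖ ^ 2 : ℝ) : ℂ) := by
  rw [tensorEval, ← (finTwoArrowEquiv (Fin n)).symm.sum_comp, Fintype.sum_prod_type]
  simp [kronecker, vecPow, EuclideanSpace.norm_sq_eq, ← pow_two]

lemma tensorEval_vecTensor (x η : Rn n) :
    tensorEval (vecTensor x) η = ((inner ℝ x η : ℝ) : ℂ) := by
  rw [tensorEval, ← (Equiv.funUnique (Fin 1) (Fin n)).symm.sum_comp]
  simp [vecTensor, vecPow, PiLp.inner_apply, mul_comm]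

lemma tensorEval_vecPow (ξ η : Rn n) :
    tensorEval (vecPow ξ : Tensor n m) η = ((inner ℝ ξ η : ℝ) : ℂ) ^ m := by
  simp only [tensorEval, vecPow, ← Finset.prod_mul_distrib]
  rw [← Fintype.piFinset_univ, Finset.sum_prod_piFinset (Finset.univ : Finset (Fin n))
    (fun (_ : Fin m) (j : Fin n) => (ξ j : ℂ) * (η j : ℂ))]
  simp [PiLp.inner_apply, mul_comm]

lemma contract_smul (u : Tensor n b) (c : ℂ) (v : Tensor n (a + b)) :
    contract u (c • v) = c • contract u v := by
  ext I
  simp [contract, Finset.mul_sum, mul_assoc]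

lemma contract_vecPow (u : Tensor n b) (ξ : Rn n) :
    contract u (vecPow ξ : Tensor n (a + b)) = tensorEval u ξ • vecPow ξ := by
  ext I
  simp only [contract, vecPow_append, tensorEval, Pi.smul_apply, smul_eq_mul, Finset.sum_mul]
  exact Finset.sum_congr rfl fun J _ => by ring

lemma exists_perm_comp_eq {α β : Type*} [Fintype α] [DecidableEq β] {f g : α → β}
    (h : ∀ y, Fintype.card {x // f x = y} = Fintype.card {x // g x = y}) :
    ∃ π : Equiv.Perm α, g ∘ π = f := by
  let e (y : β) : {x // f x = y} ≃ {x // g x = y} := Fintype.equivOfCardEq (h y)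
  refine ⟨(Equiv.sigmaFiberEquiv f).symm.trans ((Equiv.sigmaCongrRight e).trans
    (Equiv.sigmaFiberEquiv g)), ?_⟩
  ext x
  exact (e (f x) ⟨x, rfl⟩).2

/-- The exponent of the monomial `η_I`, i.e. the number of occurrences of each index in `I`. -/
def multiIndex (I : Fin m → Fin n) : Fin n →₀ ℕ := ∑ a, Finsupp.single (I a) 1

lemma multiIndex_apply (I : Fin m → Fin n) (j : Fin n) :
    multiIndex I j = Fintype.card {a // I a = j} := by
  simp [multiIndex, Finsupp.single_apply, Fintype.card_subtype, Finset.sum_boole]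

lemma eq_of_multiIndex_eq {u : Tensor n m} (hu : u ∈ SymTensor n m) {I J : Fin m → Fin n}
    (h : multiIndex I = multiIndex J) : u I = u J := by
  obtain ⟨π, rfl⟩ := exists_perm_comp_eq (f := I) (g := J) fun j => by
    rw [← multiIndex_apply, ← multiIndex_apply, h]
  exact hu π J

/-- The polynomial of a tensor `u` as a formal polynomial. -/
def tensorPoly (u : Tensor n m) : MvPolynomial (Fin n) ℂ :=
  ∑ I, MvPolynomial.monomial (multiIndex I) (u I)

lemma eval_tensorPoly (u : Tensor n m) (η : Rn n) :
    MvPolynomial.eval (fun j => (η j : ℂ)) (tensorPoly u) = tensorEval u η := by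
  have prod_multiIndex (I : Fin m → Fin n) :
      ((multiIndex I).prod fun j e => (η j : ℂ) ^ e) = vecPow η I := by
    rw [multiIndex, ← Finsupp.prod_finsetSum_index (by simp) (by simp [pow_add])]
    simp [vecPow]
  simp only [tensorPoly, map_sum, MvPolynomial.eval_monomial, prod_multiIndex, tensorEval]

lemma coeff_tensorPoly {u : Tensor n m} (hu : u ∈ SymTensor n m) (I : Fin m → Fin n) :
    (tensorPoly u).coeff (multiIndex I) =
      (Finset.univ.filter fun J : Fin m → Fin n => multiIndex J = multiIndex I).card * u I := by
  simp only [tensorPoly, MvPolynomial.coeff_sum, MvPolynomial.coeff_monomial]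
  rw [← Finset.sum_filter, ← nsmul_eq_mul]
  exact Finset.sum_eq_card_nsmul fun J hJ => eq_of_multiIndex_eq hu (Finset.mem_filter.1 hJ).2

lemma eq_zero_of_tensorEval_eq_zero {u : Tensor n m} (hu : u ∈ SymTensor n m)
    (h : ∀ η, tensorEval u η = 0) : u = 0 := by
  have hP : tensorPoly u = 0 := by
    refine MvPolynomial.funext_set (fun _ => Set.range ((↑) : ℝ → ℂ))
      (fun _ => Set.infinite_range_of_injective Complex.ofReal_injective) fun z hz => ?_
    choose η hη using fun j => hz j (Set.mem_univ j)
    obtain rfl : (fun j => (η j : ℂ)) = z := funext hη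
    simpa [h] using eval_tensorPoly u (WithLp.toLp 2 η)
  ext I
  have hI := coeff_tensorPoly hu I
  rw [hP, MvPolynomial.coeff_zero, eq_comm, mul_eq_zero, Nat.cast_eq_zero] at hI
  exact hI.resolve_left (Finset.card_ne_zero_of_mem (a := I) (by simp))

lemma eq_of_tensorEval_eq {u v : Tensor n m} (hu : u ∈ SymTensor n m) (hv : v ∈ SymTensor n m)
    (h : ∀ η, tensorEval u η = tensorEval v η) : u = v :=
  sub_eq_zero.1 <| eq_zero_of_tensorEval_eq_zero (sub_mem hu hv) fun η => by
    rw [tensorEval_sub, h, sub_self]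

end Tensor

/-! ### Weighted integrals over rays -/

section Ray

variable {E : Type*} [NormedAddCommGroup E]

/-- The unit sphere of a normed space. -/
abbrev Sph (E : Type*) [NormedAddCommGroup E] : Type _ := Metric.sphere (0 : E) 1

/-- Weights `c(ξ, t)` on the rays of direction `ξ`: continuous functions of polynomial growth in
`t`, uniformly in `ξ`. -/
def IsRayWeight (c : Sph E × ℝ → ℂ) : Prop :=
  Continuous c ∧ ∃ (C : ℝ) (N : ℕ), 0 ≤ C ∧ ∀ p, ‖c p‖ ≤ C * (1 + |p.2|) ^ N

namespace IsRayWeight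

variable {c d : Sph E × ℝ → ℂ}

lemma mul (hc : IsRayWeight c) (hd : IsRayWeight d) : IsRayWeight (fun p => c p * d p) := by
  obtain ⟨hc, C, N, hC, c_le⟩ := hc
  obtain ⟨hd, D, M, hD, d_le⟩ := hd
  refine ⟨hc.mul hd, C * D, N + M, by positivity, fun p => ?_⟩
  rw [norm_mul, pow_add, mul_mul_mul_comm]
  exact mul_le_mul (c_le p) (d_le p) (norm_nonneg _) (by positivity)

lemma of_continuous [ProperSpace E] {c : Sph E → ℂ} (hc : Continuous c) :
    IsRayWeight (fun p : Sph E × ℝ => c p.1) := by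
  obtain ⟨C, hC⟩ := isCompact_univ.exists_bound_of_continuousOn hc.continuousOn
  exact ⟨by fun_prop, max C 0, 0, le_max_right _ _,
    fun p => by simpa using Or.inl (hC p.1 (Set.mem_univ _))⟩

lemma neg_pow (a : ℕ) : IsRayWeight (fun p : Sph E × ℝ => (-(p.2 : ℂ)) ^ a) := by
  refine ⟨by fun_prop, 1, a, zero_le_one, fun p => ?_⟩
  rw [norm_pow, norm_neg, Complex.norm_real, Real.norm_eq_abs, one_mul]
  gcongr
  linarith

end IsRayWeight

variable [InnerProductSpace ℝ E]

/-- The weight `⟨x,ξ⟩^a (t + ⟨x,ξ⟩)^b c(ξ,t)`. -/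
def rayWeight (a b : ℕ) (c : Sph E × ℝ → ℂ) (x : E) (p : Sph E × ℝ) : ℂ :=
  ((inner ℝ x (p.1 : E) : ℝ) : ℂ) ^ a * ((p.2 : ℂ) + ((inner ℝ x (p.1 : E) : ℝ) : ℂ)) ^ b * c p

/-- The real-linear functional `x ↦ ⟨x,ξ⟩` with complex values. -/
def innerCLM (ξ : E) : E →L[ℝ] ℂ := Complex.ofRealCLM.comp (innerSL ℝ ξ)

lemma innerCLM_apply (ξ x : E) : innerCLM ξ x = ((inner ℝ x ξ : ℝ) : ℂ) := by
  simp [innerCLM, real_inner_comm]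

lemma norm_innerCLM_le (ξ : Sph E) : ‖innerCLM (ξ : E)‖ ≤ 1 :=
  ContinuousLinearMap.opNorm_le_bound _ zero_le_one fun x => by
    simpa [innerCLM_apply] using abs_real_inner_le_norm x (ξ : E)

@[fun_prop]
lemma continuous_innerCLM : Continuous (innerCLM : E → E →L[ℝ] ℂ) :=
  continuous_const.clm_comp (innerSL ℝ).continuous

namespace IsRayWeight

variable {c : Sph E × ℝ → ℂ}

lemma mul_inner [ProperSpace E] (hc : IsRayWeight c) (v : E) :
    IsRayWeight (fun p : Sph E × ℝ => c p * ((inner ℝ v (p.1 : E) : ℝ) : ℂ)) := by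
  have hv : Continuous fun ξ : Sph E => ((inner ℝ v (ξ : E) : ℝ) : ℂ) := by fun_prop
  exact hc.mul (of_continuous hv)

lemma continuous_rayWeight (hc : IsRayWeight c) (a b : ℕ) (x : E) :
    Continuous (rayWeight a b c x) := by
  have := hc.1
  unfold rayWeight
  fun_prop

lemma exists_rayWeight_bound (hc : IsRayWeight c) (a b : ℕ) {R : ℝ} (hR : 0 ≤ R) :
    ∃ (C : ℝ) (N : ℕ), 0 ≤ C ∧ ∀ x : E, ‖x‖ ≤ R → ∀ p,
      ‖rayWeight a b c x p‖ ≤ C * (1 + |p.2|) ^ N := by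
  obtain ⟨-, C, N, hC, c_le⟩ := hc
  refine ⟨R ^ a * (1 + R) ^ b * C, b + N, by positivity, fun x hx p => ?_⟩
  have abs_inner_le : |inner ℝ x (p.1 : E)| ≤ R :=
    (abs_real_inner_le_norm _ _).trans (by simpa using hx)
  have norm_add_le : ‖(p.2 : ℂ) + ((inner ℝ x (p.1 : E) : ℝ) : ℂ)‖ ≤ (1 + R) * (1 + |p.2|) := by
    rw [← Complex.ofReal_add, Complex.norm_real, Real.norm_eq_abs]
    refine (abs_add_le _ _).trans ?_
    nlinarith [abs_nonneg p.2]
  rw [rayWeight, norm_mul, norm_mul, norm_pow, norm_pow, Complex.norm_real, Real.norm_eq_abs]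
  calc _ ≤ R ^ a * ((1 + R) * (1 + |p.2|)) ^ b * (C * (1 + |p.2|) ^ N) := by
        gcongr
        exact c_le p
    _ = _ := by rw [mul_pow, pow_add]; ring

end IsRayWeight

lemma exists_schwartz_ray_bound {F : Type*} [NormedAddCommGroup F] [NormedSpace ℝ F]
    (ψ : 𝓢(E, F)) (N : ℕ) {R : ℝ} (hR : 0 ≤ R) :
    ∃ C : ℝ, ∀ x : E, ‖x‖ ≤ R → ∀ p : Sph E × ℝ,
      (1 + |p.2|) ^ N * ‖ψ (x + p.2 • (p.1 : E))‖ ≤ C := by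
  let C := 2 ^ N * ((Finset.Iic (N, 0)).sup fun m => SchwartzMap.seminorm ℝ m.1 m.2) ψ
  have decay : ∀ y, (1 + ‖y‖) ^ N * ‖ψ y‖ ≤ C := fun y => by
    simpa using SchwartzMap.one_add_le_sup_seminorm_apply (𝕜 := ℝ) (m := (N, 0)) le_rfl le_rfl ψ y
  refine ⟨(1 + R) ^ N * C, fun x hx ⟨ξ, t⟩ => ?_⟩
  have one_add_abs_le : 1 + |t| ≤ (1 + R) * (1 + ‖x + t • (ξ : E)‖) := by
    have abs_le : |t| ≤ ‖x + t • (ξ : E)‖ + ‖x‖ := by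
      simpa [norm_smul] using norm_sub_le (x + t • (ξ : E)) x
    nlinarith [norm_nonneg (x + t • (ξ : E))]
  calc (1 + |t|) ^ N * ‖ψ (x + t • (ξ : E))‖
      ≤ ((1 + R) * (1 + ‖x + t • (ξ : E)‖)) ^ N * ‖ψ (x + t • (ξ : E))‖ := by gcongr
    _ = (1 + R) ^ N * ((1 + ‖x + t • (ξ : E)‖) ^ N * ‖ψ (x + t • (ξ : E))‖) := by
        rw [mul_pow, mul_assoc]
    _ ≤ (1 + R) ^ N * C := by gcongr; exact decay _

lemma IsRayWeight.exists_ray_bound {F : Type*} [NormedAddCommGroup F] [NormedSpace ℝ F]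
    {c : Sph E × ℝ → ℂ} (hc : IsRayWeight c) (a b : ℕ) (ψ : 𝓢(E, F)) {R : ℝ} (hR : 0 ≤ R) :
    ∃ C : ℝ, ∀ x : E, ‖x‖ ≤ R → ∀ p : Sph E × ℝ,
      ‖rayWeight a b c x p‖ * ‖ψ (x + p.2 • (p.1 : E))‖ ≤ C * ((1 + |p.2|) ^ 2)⁻¹ := by
  obtain ⟨C, N, hC, weight_le⟩ := hc.exists_rayWeight_bound a b hR
  obtain ⟨D, decay⟩ := exists_schwartz_ray_bound ψ (N + 2) hR
  refine ⟨C * D, fun x hx p => ?_⟩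
  rw [← div_eq_mul_inv, le_div_iff₀ (by positivity)]
  calc _ ≤ C * (1 + |p.2|) ^ N * ‖ψ (x + p.2 • (p.1 : E))‖ * (1 + |p.2|) ^ 2 := by
        gcongr; exact weight_le x hx p
    _ = C * ((1 + |p.2|) ^ (N + 2) * ‖ψ (x + p.2 • (p.1 : E))‖) := by ring
    _ ≤ C * D := by gcongr; exact decay x hx p

/-- The derivative in `x` of the integrand of `rayIntegral`. -/
def rayIntegrandDeriv (a b : ℕ) (c : Sph E × ℝ → ℂ) (ψ : 𝓢(E, ℂ)) (x : E) (p : Sph E × ℝ) :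
    E →L[ℝ] ℂ :=
  ((a * rayWeight (a - 1) b c x p + b * rayWeight a (b - 1) c x p) *
      ψ (x + p.2 • (p.1 : E))) • innerCLM (p.1 : E) +
    rayWeight a b c x p • SchwartzMap.fderivCLM ℝ E ℂ ψ (x + p.2 • (p.1 : E))

lemma hasFDerivAt_rayIntegrand (a b : ℕ) (c : Sph E × ℝ → ℂ) (ψ : 𝓢(E, ℂ)) (x : E)
    (p : Sph E × ℝ) :
    HasFDerivAt (fun y => rayWeight a b c y p * ψ (y + p.2 • (p.1 : E)))
      (rayIntegrandDeriv a b c ψ x p) x := by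
  have inner_deriv : HasFDerivAt (fun y : E => ((inner ℝ y (p.1 : E) : ℝ) : ℂ))
      (innerCLM (p.1 : E)) x := by
    simpa only [← innerCLM_apply] using (innerCLM (p.1 : E)).hasFDerivAt
  have weight_deriv := ((inner_deriv.pow a).mul ((inner_deriv.const_add (p.2 : ℂ)).pow b)).mul_const
    (c p)
  have schwartz_deriv : HasFDerivAt (fun y => ψ (y + p.2 • (p.1 : E)))
      (fderiv ℝ ψ (x + p.2 • (p.1 : E))) x :=
    (ψ.hasFDerivAt _).comp x ((hasFDerivAt_id x).add_const _)
  convert! weight_deriv.mul schwartz_deriv using 1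
  ext v
  simp only [rayIntegrandDeriv, rayWeight, Pi.mul_apply, _root_.add_apply, _root_.smul_apply,
    smul_eq_mul, nsmul_eq_mul, SchwartzMap.fderivCLM_apply]
  ring

lemma IsRayWeight.exists_rayIntegrandDeriv_bound {c : Sph E × ℝ → ℂ} (hc : IsRayWeight c)
    (a b : ℕ) (ψ : 𝓢(E, ℂ)) {R : ℝ} (hR : 0 ≤ R) :
    ∃ C : ℝ, ∀ x : E, ‖x‖ ≤ R → ∀ p,
      ‖rayIntegrandDeriv a b c ψ x p‖ ≤ C * ((1 + |p.2|) ^ 2)⁻¹ := by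
  obtain ⟨C₁, bound₁⟩ := hc.exists_ray_bound (a - 1) b ψ hR
  obtain ⟨C₂, bound₂⟩ := hc.exists_ray_bound a (b - 1) ψ hR
  obtain ⟨C₃, bound₃⟩ := hc.exists_ray_bound a b (SchwartzMap.fderivCLM ℝ E ℂ ψ) hR
  refine ⟨a * C₁ + b * C₂ + C₃, fun x hx p => ?_⟩
  have coeff_le : ‖(a * rayWeight (a - 1) b c x p + b * rayWeight a (b - 1) c x p : ℂ)‖ ≤
      a * ‖rayWeight (a - 1) b c x p‖ + b * ‖rayWeight a (b - 1) c x p‖ :=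
    (norm_add_le _ _).trans (by simp)
  calc ‖rayIntegrandDeriv a b c ψ x p‖
      ≤ (a * ‖rayWeight (a - 1) b c x p‖ + b * ‖rayWeight a (b - 1) c x p‖) *
          ‖ψ (x + p.2 • (p.1 : E))‖ * 1 + ‖rayWeight a b c x p‖ *
          ‖SchwartzMap.fderivCLM ℝ E ℂ ψ (x + p.2 • (p.1 : E))‖ := by
        refine (norm_add_le _ _).trans ?_
        rw [norm_smul, norm_smul, norm_mul]
        gcongr
        exact norm_innerCLM_le p.1
    _ = a * (‖rayWeight (a - 1) b c x p‖ * ‖ψ (x + p.2 • (p.1 : E))‖) +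
          b * (‖rayWeight a (b - 1) c x p‖ * ‖ψ (x + p.2 • (p.1 : E))‖) +
          ‖rayWeight a b c x p‖ * ‖SchwartzMap.fderivCLM ℝ E ℂ ψ (x + p.2 • (p.1 : E))‖ := by
        ring
    _ ≤ a * (C₁ * ((1 + |p.2|) ^ 2)⁻¹) + b * (C₂ * ((1 + |p.2|) ^ 2)⁻¹) +
          C₃ * ((1 + |p.2|) ^ 2)⁻¹ := by
        grw [bound₁ x hx p, bound₂ x hx p, bound₃ x hx p]
    _ = (a * C₁ + b * C₂ + C₃) * ((1 + |p.2|) ^ 2)⁻¹ := by ring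

lemma hasDerivAt_rayWeight (a b : ℕ) (c : Sph E → ℂ) (x : E) (ξ : Sph E) (t : ℝ) :
    HasDerivAt (fun t : ℝ => rayWeight a b (fun p => c p.1) x (ξ, t))
      (b * rayWeight a (b - 1) (fun p => c p.1) x (ξ, t)) t := by
  have add_deriv : HasDerivAt (fun t : ℝ => (t : ℂ) + ((inner ℝ x (ξ : E) : ℝ) : ℂ)) 1 t :=
    Complex.ofRealCLM.hasDerivAt.add_const _
  convert! ((add_deriv.pow b).const_mul (((inner ℝ x (ξ : E) : ℝ) : ℂ) ^ a)).mul_const (c ξ) using 1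
  simp only [rayWeight]
  ring

lemma hasDerivAt_schwartz_ray (ψ : 𝓢(E, ℂ)) (x v : E) (t : ℝ) :
    HasDerivAt (fun t : ℝ => ψ (x + t • v)) (fderiv ℝ ψ (x + t • v) v) t := by
  have ray_deriv : HasDerivAt (fun t : ℝ => x + t • v) v t := by
    simpa using ((hasDerivAt_id t).smul_const v).const_add x
  exact (ψ.hasFDerivAt _).comp_hasDerivAt t ray_deriv

variable [FiniteDimensional ℝ E] [MeasurableSpace E] [BorelSpace E]

/-- The measure `dξ dt` on the product of the unit sphere and the line. -/
def rayMeasure (E : Type*) [NormedAddCommGroup E] [InnerProductSpace ℝ E] [FiniteDimensional ℝ E]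
    [MeasurableSpace E] [BorelSpace E] : Measure (Sph E × ℝ) :=
  (volume : Measure E).toSphere.prod volume

lemma integrable_rayMeasure_decay :
    Integrable (fun p : Sph E × ℝ => ((1 + |p.2|) ^ 2)⁻¹) (rayMeasure E) := by
  have decay : Integrable (fun t : ℝ => ((1 + |t|) ^ 2)⁻¹) := by
    refine (integrable_one_add_norm (E := ℝ) (μ := volume) (r := 2) (by simp)).congr
      (Filter.Eventually.of_forall fun t => ?_)
    simp only [Real.norm_eq_abs]
    rw [Real.rpow_neg (by positivity)]
    norm_cast
  exact decay.comp_snd _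

/-- The integral `∫∫ ⟨x,ξ⟩^a (t + ⟨x,ξ⟩)^b c(ξ,t) ψ(x + tξ) dt dξ`. -/
def rayIntegral (a b : ℕ) (c : Sph E × ℝ → ℂ) (ψ : 𝓢(E, ℂ)) (x : E) : ℂ :=
  ∫ p, rayWeight a b c x p * ψ (x + p.2 • (p.1 : E)) ∂(rayMeasure E)

variable {c : Sph E × ℝ → ℂ}

lemma IsRayWeight.integrable (hc : IsRayWeight c) (a b : ℕ) (ψ : 𝓢(E, ℂ)) (x : E) :
    Integrable (fun p => rayWeight a b c x p * ψ (x + p.2 • (p.1 : E))) (rayMeasure E) := by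
  obtain ⟨C, bound⟩ := hc.exists_ray_bound a b ψ (norm_nonneg x)
  refine (integrable_rayMeasure_decay.const_mul C).mono' ?_
    (Filter.Eventually.of_forall fun p => by rw [norm_mul]; exact bound x le_rfl p)
  have := hc.continuous_rayWeight a b x
  have := ψ.continuous
  exact Continuous.aestronglyMeasurable (by fun_prop)

lemma sum_mul_rayIntegral {ι : Type*} (s : Finset ι) (a b : ℕ) {c : ι → Sph E × ℝ → ℂ}
    (hc : ∀ i ∈ s, IsRayWeight (c i)) (z : ι → ℂ) (ψ : 𝓢(E, ℂ)) (x : E) :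
    ∑ i ∈ s, z i * rayIntegral a b (c i) ψ x =
      rayIntegral a b (fun p => ∑ i ∈ s, z i * c i p) ψ x := by
  simp only [rayIntegral, ← integral_const_mul]
  rw [← integral_finsetSum s fun i hi => ((hc i hi).integrable a b ψ x).const_mul (z i)]
  congr 1 with p
  simp only [rayWeight, Finset.mul_sum, Finset.sum_mul]
  exact Finset.sum_congr rfl fun i _ => by ring

lemma sum_rayIntegral {ι : Type*} (s : Finset ι) (a b : ℕ) {c : ι → Sph E × ℝ → ℂ}
    (hc : ∀ i ∈ s, IsRayWeight (c i)) (ψ : 𝓢(E, ℂ)) (x : E) :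
    ∑ i ∈ s, rayIntegral a b (c i) ψ x = rayIntegral a b (fun p => ∑ i ∈ s, c i p) ψ x := by
  simpa using sum_mul_rayIntegral s a b hc 1 ψ x

lemma IsRayWeight.aestronglyMeasurable_rayIntegrandDeriv (hc : IsRayWeight c) (a b : ℕ)
    (ψ : 𝓢(E, ℂ)) (x : E) :
    AEStronglyMeasurable (rayIntegrandDeriv a b c ψ x) (rayMeasure E) := by
  have := hc.continuous_rayWeight (a - 1) b x
  have := hc.continuous_rayWeight a (b - 1) x
  have := hc.continuous_rayWeight a b x
  have := ψ.continuous
  have := (SchwartzMap.fderivCLM ℝ E ℂ ψ).continuous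
  have : Continuous (rayIntegrandDeriv a b c ψ x) := by
    unfold rayIntegrandDeriv
    fun_prop
  exact this.aestronglyMeasurable

lemma IsRayWeight.integrable_rayIntegrandDeriv (hc : IsRayWeight c) (a b : ℕ) (ψ : 𝓢(E, ℂ))
    (x : E) : Integrable (rayIntegrandDeriv a b c ψ x) (rayMeasure E) := by
  obtain ⟨C, bound⟩ := hc.exists_rayIntegrandDeriv_bound a b ψ (norm_nonneg x)
  exact (integrable_rayMeasure_decay.const_mul C).mono'
    (hc.aestronglyMeasurable_rayIntegrandDeriv a b ψ x)
    (Filter.Eventually.of_forall fun p => bound x le_rfl p)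

lemma hasFDerivAt_rayIntegral (a b : ℕ) (hc : IsRayWeight c) (ψ : 𝓢(E, ℂ)) (x : E) :
    HasFDerivAt (rayIntegral a b c ψ) (∫ p, rayIntegrandDeriv a b c ψ x p ∂(rayMeasure E)) x := by
  obtain ⟨C, bound⟩ := hc.exists_rayIntegrandDeriv_bound a b ψ (R := ‖x‖ + 1) (by positivity)
  have norm_le_of_mem_ball {y : E} (hy : y ∈ Metric.ball x 1) : ‖y‖ ≤ ‖x‖ + 1 := by
    have := norm_sub_norm_le y x
    rw [Metric.mem_ball, dist_eq_norm] at hy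
    linarith
  exact hasFDerivAt_integral_of_dominated_of_fderiv_le (Metric.ball_mem_nhds x one_pos)
    (Filter.Eventually.of_forall fun y => (hc.integrable a b ψ y).aestronglyMeasurable)
    (hc.integrable a b ψ x) (hc.aestronglyMeasurable_rayIntegrandDeriv a b ψ x)
    (Filter.Eventually.of_forall fun p y hy => bound y (norm_le_of_mem_ball hy) p)
    (integrable_rayMeasure_decay.const_mul C)
    (Filter.Eventually.of_forall fun p y _ => hasFDerivAt_rayIntegrand a b c ψ y p)

open LineDeriv in
lemma fderiv_rayIntegral (a b : ℕ) (hc : IsRayWeight c) (ψ : 𝓢(E, ℂ)) (x v : E) :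
    fderiv ℝ (rayIntegral a b c ψ) x v =
      a * rayIntegral (a - 1) b (fun p => c p * ((inner ℝ v (p.1 : E) : ℝ) : ℂ)) ψ x +
      b * rayIntegral a (b - 1) (fun p => c p * ((inner ℝ v (p.1 : E) : ℝ) : ℂ)) ψ x +
      rayIntegral a b c (∂_{v} ψ) x := by
  have hcv := hc.mul_inner v
  have int₁ := (hcv.integrable (a - 1) b ψ x).const_mul (a : ℂ)
  have int₂ := (hcv.integrable a (b - 1) ψ x).const_mul (b : ℂ)
  have int₃ := hc.integrable a b (∂_{v} ψ) x
  rw [(hasFDerivAt_rayIntegral a b hc ψ x).fderiv,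
    ContinuousLinearMap.integral_apply (hc.integrable_rayIntegrandDeriv a b ψ x)]
  simp only [rayIntegral, ← integral_const_mul]
  rw [← integral_add int₁ int₂]
  refine Eq.trans ?_ (integral_add (int₁.add int₂) int₃)
  refine integral_congr_ae (Filter.Eventually.of_forall fun p => ?_)
  simp only [rayIntegrandDeriv, _root_.add_apply, _root_.smul_apply, innerCLM_apply, smul_eq_mul,
    SchwartzMap.fderivCLM_apply, SchwartzMap.lineDerivOp_apply_eq_fderiv, rayWeight]
  ring

lemma contDiff_rayIntegral (a b : ℕ) (hc : IsRayWeight c) (ψ : 𝓢(E, ℂ)) :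
    ContDiff ℝ ∞ (rayIntegral a b c ψ) := by
  rw [contDiff_infty]
  intro k
  induction k generalizing a b c ψ with
  | zero =>
    rw [Nat.cast_zero, contDiff_zero]
    exact continuous_iff_continuousAt.2 fun x =>
      (hasFDerivAt_rayIntegral a b hc ψ x).continuousAt
  | succ k ih =>
    rw [Nat.cast_succ, contDiff_succ_iff_fderiv_apply]
    refine ⟨fun x => (hasFDerivAt_rayIntegral a b hc ψ x).differentiableAt, by simp, fun v => ?_⟩
    simp only [fderiv_rayIntegral a b hc ψ _ v]
    exact ((contDiff_const.mul (ih _ _ (hc.mul_inner v) _)).add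
      (contDiff_const.mul (ih _ _ (hc.mul_inner v) _))).add (ih _ _ hc _)

lemma integral_rayWeight_mul_fderiv (a b : ℕ) {c : Sph E → ℂ} (hc : Continuous c) (ψ : 𝓢(E, ℂ))
    (x : E) (hψ : Integrable (fun p : Sph E × ℝ => rayWeight a b (fun p => c p.1) x p *
      fderiv ℝ ψ (x + p.2 • (p.1 : E)) p.1) (rayMeasure E)) :
    ∫ p, rayWeight a b (fun p => c p.1) x p * fderiv ℝ ψ (x + p.2 • (p.1 : E)) p.1
        ∂(rayMeasure E) =
      -(b * rayIntegral a (b - 1) (fun p => c p.1) ψ x) := by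
  have hw := IsRayWeight.of_continuous hc
  have int_deriv := (hw.integrable a (b - 1) ψ x).const_mul (b : ℂ)
  have int_prod := hw.integrable a b ψ x
  rw [rayIntegral, ← integral_const_mul]
  unfold rayMeasure at *
  rw [integral_prod _ hψ, integral_prod _ int_deriv, ← integral_neg]
  refine integral_congr_ae ?_
  filter_upwards [hψ.prod_right_ae, int_deriv.prod_right_ae, int_prod.prod_right_ae]
    with ξ hψξ int_deriv_ξ int_prod_ξ
  simp only [← mul_assoc] at int_deriv_ξ ⊢
  exact integral_mul_deriv_eq_deriv_mul_of_integrable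
    (fun t _ => hasDerivAt_rayWeight a b c x ξ t)
    (fun t _ => hasDerivAt_schwartz_ray ψ x (ξ : E) t) hψξ int_deriv_ξ int_prod_ξ

end Ray

/-! ### Moment fields and the normal operators -/

section StandardBasis

variable {n : ℕ}

lemma basisVec_apply (i j : Fin n) : basisVec i j = if j = i then 1 else 0 := by
  simp [basisVec]

lemma inner_basisVec_left (j : Fin n) (ξ : Rn n) : inner ℝ (basisVec j) ξ = ξ j := by
  simp [basisVec, EuclideanSpace.inner_single_left]

lemma sum_smul_basisVec (ξ : Rn n) : ∑ j, ξ j • basisVec j = ξ := by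
  ext i
  simp [basisVec_apply]

lemma sum_mul_self_of_sphere (ξ : Sph (Rn n)) :
    ∑ j, ((ξ : Rn n) j : ℂ) * ((ξ : Rn n) j : ℂ) = 1 := by
  have norm_sq : ‖(ξ : Rn n)‖ ^ 2 = 1 := by simp
  simp only [EuclideanSpace.norm_sq_eq, Real.norm_eq_abs, sq_abs] at norm_sq
  exact_mod_cast (by simpa only [pow_two] using norm_sq)

open LineDeriv in
lemma sum_rayIntegral_lineDeriv (a b : ℕ) {c : Sph (Rn n) → ℂ} (hc : Continuous c)
    (ψ : 𝓢(Rn n, ℂ)) (x : Rn n) :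
    ∑ j, rayIntegral a b (fun p => c p.1 * ((p.1 : Rn n) j : ℂ)) (∂_{basisVec j} ψ) x =
      -(b * rayIntegral a (b - 1) (fun p => c p.1) ψ x) := by
  have hw (j : Fin n) : IsRayWeight (fun p : Sph (Rn n) × ℝ => c p.1 * ((p.1 : Rn n) j : ℂ)) :=
    .of_continuous (c := fun ξ : Sph (Rn n) => c ξ * ((ξ : Rn n) j : ℂ)) (by fun_prop)
  have sum_integrand (p : Sph (Rn n) × ℝ) :
      ∑ j, rayWeight a b (fun p => c p.1 * ((p.1 : Rn n) j : ℂ)) x p *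
        (∂_{basisVec j} ψ) (x + p.2 • (p.1 : Rn n)) =
      rayWeight a b (fun p => c p.1) x p * fderiv ℝ ψ (x + p.2 • (p.1 : Rn n)) p.1 := by
    conv_rhs => enter [2, 2]; rw [← sum_smul_basisVec (p.1 : Rn n)]
    rw [map_sum, Finset.mul_sum]
    refine Finset.sum_congr rfl fun j _ => ?_
    rw [SchwartzMap.lineDerivOp_apply_eq_fderiv, map_smul, Complex.real_smul]
    simp only [rayWeight]
    ring
  have integrable_sum := integrable_finsetSum Finset.univ fun j _ =>
    (hw j).integrable a b (∂_{basisVec j} ψ) x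
  simp only [sum_integrand] at integrable_sum
  rw [← integral_rayWeight_mul_fderiv a b hc ψ x integrable_sum]
  simp only [rayIntegral, ← sum_integrand]
  exact (integral_finsetSum _ fun j _ => (hw j).integrable a b _ x).symm

lemma sum_fderiv_rayIntegral (a b : ℕ) {c : Sph (Rn n) → ℂ} (hc : Continuous c)
    (ψ : 𝓢(Rn n, ℂ)) (x : Rn n) :
    ∑ j, fderiv ℝ (rayIntegral (a + 1) b (fun p => c p.1 * ((p.1 : Rn n) j : ℂ)) ψ) x
      (basisVec j) = (a + 1 : ℕ) * rayIntegral a b (fun p => c p.1) ψ x := by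
  have continuous_mul_coord (j : Fin n) :
      Continuous fun ξ : Sph (Rn n) => c ξ * ((ξ : Rn n) j : ℂ) := by fun_prop
  have sum_coord_sq (a b : ℕ) :
      ∑ j, rayIntegral a b (fun p => c p.1 * ((p.1 : Rn n) j : ℂ) * ((p.1 : Rn n) j : ℂ)) ψ x =
        rayIntegral a b (fun p => c p.1) ψ x := by
    rw [sum_rayIntegral _ _ _ fun j _ => .of_continuous (c := fun ξ : Sph (Rn n) =>
      c ξ * ((ξ : Rn n) j : ℂ) * ((ξ : Rn n) j : ℂ)) (by fun_prop)]
    simp only [mul_assoc, ← Finset.mul_sum, sum_mul_self_of_sphere, mul_one]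
  simp only [fderiv_rayIntegral _ _ (.of_continuous (continuous_mul_coord _)), inner_basisVec_left,
    Finset.sum_add_distrib, ← Finset.mul_sum, sum_coord_sq, sum_rayIntegral_lineDeriv _ _ hc,
    Nat.add_sub_cancel]
  ring

end StandardBasis

section MomentField

variable {n m : ℕ}

/-- The component `f_J` of a symmetric Schwartz tensor field. -/
def schwartzComp (f : 𝓢(Rn n, SymTensor n m)) (J : Fin m → Fin n) : 𝓢(Rn n, ℂ) :=
  SchwartzMap.postcompCLM ((ContinuousLinearMap.proj J : Tensor n m →L[ℂ] ℂ).comp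
    (SymTensor n m).subtypeL) f

@[simp]
lemma schwartzComp_apply (f : 𝓢(Rn n, SymTensor n m)) (J : Fin m → Fin n) (x : Rn n) :
    schwartzComp f J x = toField f x J := rfl

lemma continuous_vecPow_mul_vecPow {r : ℕ} (I : Fin r → Fin n) (J : Fin m → Fin n) :
    Continuous (fun ξ : Sph (Rn n) => vecPow (ξ : Rn n) I * vecPow (ξ : Rn n) J) := by
  fun_prop

lemma isRayWeight_vecPow_mul_vecPow {r : ℕ} (I : Fin r → Fin n) (J : Fin m → Fin n) :
    IsRayWeight (fun p : Sph (Rn n) × ℝ => vecPow (p.1 : Rn n) I * vecPow (p.1 : Rn n) J) :=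
  .of_continuous (continuous_vecPow_mul_vecPow I J)

/-- The tensor field `∫∫ ⟨x,ξ⟩^a (t + ⟨x,ξ⟩)^b ξ_I ⟨f(x + tξ), ξ^m⟩ dt dξ` of rank `r`. -/
def momentField (f : 𝓢(Rn n, SymTensor n m)) (a b r : ℕ) : Field n r := fun x I =>
  ∑ J, rayIntegral a b (fun p => vecPow (p.1 : Rn n) I * vecPow (p.1 : Rn n) J)
    (schwartzComp f J) x

variable (f : 𝓢(Rn n, SymTensor n m)) (a b r : ℕ)

lemma contDiff_momentField : ContDiff ℝ ∞ (momentField f a b r) :=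
  contDiff_pi.2 fun I => ContDiff.sum fun J _ =>
    contDiff_rayIntegral a b (isRayWeight_vecPow_mul_vecPow I J) _

lemma momentField_mem (x : Rn n) : momentField f a b r x ∈ SymTensor n r := fun π I => by
  simp only [momentField, vecPow_mem _ π I]

lemma normalOp_eq_momentField (k : ℕ) : normalOp k (toField f) = momentField f k k m := by
  funext x I
  have hw (J : Fin m → Fin n) := (isRayWeight_vecPow_mul_vecPow I J).integrable k k
    (schwartzComp f J) x
  have hsum := integrable_finsetSum Finset.univ fun J _ => hw J
  simp only [momentField, rayIntegral]
  rw [← integral_finsetSum _ fun J _ => hw J]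
  unfold rayMeasure at *
  rw [integral_prod _ hsum]
  refine integral_congr_ae (Filter.Eventually.of_forall fun ξ => ?_)
  simp only [rayTransform]
  rw [← integral_add_right_eq_self _ (inner ℝ x (ξ : Rn n)), ← integral_const_mul]
  refine integral_congr_ae (Filter.Eventually.of_forall fun t => ?_)
  have shift : x - inner ℝ x (ξ : Rn n) • (ξ : Rn n) + (t + inner ℝ x (ξ : Rn n)) • (ξ : Rn n) =
      x + t • (ξ : Rn n) := by rw [add_smul]; abel
  simp only [shift, Finset.mul_sum, rayWeight, schwartzComp_apply, Complex.ofReal_add]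
  exact Finset.sum_congr rfl fun J _ => by ring

lemma isSmoothSym_normalOp (k : ℕ) : IsSmoothSym (normalOp k (toField f)) := by
  rw [normalOp_eq_momentField]
  exact ⟨contDiff_momentField f k k m, momentField_mem f k k m⟩

lemma contract_momentField {s : ℕ} (u : Tensor n s) (x : Rn n) (I : Fin r → Fin n) :
    contract u (momentField f a b (r + s) x) I =
      ∑ J, rayIntegral a b (fun p => tensorEval u (p.1 : Rn n) *
        (vecPow (p.1 : Rn n) I * vecPow (p.1 : Rn n) J)) (schwartzComp f J) x := by
  simp only [contract, momentField, Finset.sum_mul]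
  rw [Finset.sum_comm]
  refine Finset.sum_congr rfl fun J _ => ?_
  simp only [mul_comm _ (u _)]
  rw [sum_mul_rayIntegral _ _ _ fun K _ => isRayWeight_vecPow_mul_vecPow _ J]
  congr with p
  simp only [vecPow_append, tensorEval, Finset.sum_mul]
  exact Finset.sum_congr rfl fun K _ => by ring

lemma opJx_momentField : opJx (momentField f a b (r + 1)) = momentField f (a + 1) b r := by
  funext x I
  rw [opJx, contract_momentField]
  refine Finset.sum_congr rfl fun J _ => integral_congr_ae (Filter.Eventually.of_forall fun p => ?_)
  simp only [rayWeight, tensorEval_vecTensor]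
  ring

lemma opJ_momentField : opJ (momentField f a b (r + 2)) = momentField f a b r := by
  funext x I
  rw [opJ, contract_momentField]
  simp only [tensorEval_kronecker, norm_eq_of_mem_sphere, one_pow, Complex.ofReal_one, one_mul]
  rfl

lemma divergence_momentField :
    divergence (momentField f (a + 1) b (r + 1)) = ((a + 1 : ℕ) : ℂ) • momentField f a b r := by
  funext x I
  have vecPow_snoc_mul (p : Sph (Rn n) × ℝ) (j : Fin n) (J : Fin m → Fin n) :
      vecPow (p.1 : Rn n) (Fin.snoc I j : Fin (r + 1) → Fin n) * vecPow (p.1 : Rn n) J =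
        vecPow (p.1 : Rn n) I * vecPow (p.1 : Rn n) J * ((p.1 : Rn n) j : ℂ) := by
    rw [vecPow_snoc]
    ring
  have differentiable (j : Fin n) (J : Fin m → Fin n) :=
    (hasFDerivAt_rayIntegral (a + 1) b (isRayWeight_vecPow_mul_vecPow (Fin.snoc I j) J)
      (schwartzComp f J) x).differentiableAt
  simp only [vecPow_snoc_mul] at differentiable
  simp only [divergence, pderiv, momentField, vecPow_snoc_mul, Pi.smul_apply, smul_eq_mul,
    Finset.mul_sum, fderiv_fun_sum fun J (_ : J ∈ Finset.univ) => differentiable _ J,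
    _root_.sum_apply]
  rw [Finset.sum_comm]
  exact Finset.sum_congr rfl fun J _ =>
    sum_fderiv_rayIntegral a b (continuous_vecPow_mul_vecPow I J) _ x

end MomentField

/-! ### The operators `D_{m,n}^k` on the normal operators -/

section FieldOperators

variable {n m : ℕ}

lemma contDiff_pderiv (j : Fin n) {g : Field n m} (hg : ContDiff ℝ ∞ g) :
    ContDiff ℝ ∞ (pderiv j g) :=
  contDiff_pi.2 fun I => ((contDiff_pi.1 hg I).fderiv_right (m := ∞) (by simp)).clm_apply
    contDiff_const

lemma contDiff_divergence {g : Field n (m + 1)} (hg : ContDiff ℝ ∞ g) :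
    ContDiff ℝ ∞ (divergence g) :=
  contDiff_pi.2 fun _ => ContDiff.sum fun j _ => contDiff_pi.1 (contDiff_pderiv j hg) _

lemma contDiff_innerDeriv {g : Field n m} (hg : ContDiff ℝ ∞ g) : ContDiff ℝ ∞ (innerDeriv g) :=
  contDiff_pi.2 fun _ => contDiff_const.mul (ContDiff.sum fun _ _ =>
    contDiff_pi.1 (contDiff_pderiv _ hg) _)

lemma contDiff_innerDerivPow {g : Field n m} (hg : ContDiff ℝ ∞ g) :
    (r : ℕ) → ContDiff ℝ ∞ (innerDerivPow r g)
  | 0 => hg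
  | r + 1 => contDiff_innerDeriv (contDiff_innerDerivPow hg r)

lemma contDiff_opI {g : Field n m} (hg : ContDiff ℝ ∞ g) : ContDiff ℝ ∞ (opI g) :=
  contDiff_pi.2 fun _ => contDiff_const.mul (ContDiff.sum fun _ _ =>
    (contDiff_pi.1 hg _).mul contDiff_const)

lemma contDiff_opIPow {g : Field n m} (hg : ContDiff ℝ ∞ g) :
    (r : ℕ) → ContDiff ℝ ∞ (opIPow r g)
  | 0 => hg
  | r + 1 => contDiff_opI (contDiff_opIPow hg r)

lemma divergence_smul (c : ℂ) {g : Field n (m + 1)} (hg : ContDiff ℝ ∞ g) :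
    divergence (c • g) = c • divergence g := by
  funext x I
  simp only [divergence, pderiv, Pi.smul_apply, smul_eq_mul, Finset.mul_sum]
  refine Finset.sum_congr rfl fun j _ => ?_
  rw [fderiv_const_mul ((contDiff_pi.1 hg _).differentiable (by simp) x)]
  simp

lemma divergencePow_smul (c : ℂ) :
    (k : ℕ) → {g : Field n (m + k)} → ContDiff ℝ ∞ g →
      divergencePow k (c • g) = c • divergencePow k g
  | 0, _, _ => rfl
  | k + 1, g, hg => by
    change divergencePow k (divergence (c • g)) = c • divergencePow k (divergence g)
    rw [divergence_smul c hg, divergencePow_smul c k (contDiff_divergence hg)]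

lemma opJxPow_smul (c : ℂ) :
    (k : ℕ) → (g : Field n (m + k)) → opJxPow k (c • g) = c • opJxPow k g
  | 0, _ => rfl
  | k + 1, g => by
    have opJx_smul : opJx (c • g) = c • opJx g :=
      funext fun x => contract_smul (vecTensor x) c (g x)
    change opJxPow k (opJx (c • g)) = c • opJxPow k (opJx g)
    rw [opJx_smul, opJxPow_smul c k]

lemma opJPow_smul (c : ℂ) :
    (k : ℕ) → (g : Field n (m + 2 * k)) → opJPow k (c • g) = c • opJPow k g
  | 0, _ => rfl
  | k + 1, g => by
    have opJ_smul : opJ (m := m + 2 * k) (c • g) = c • opJ (m := m + 2 * k) g :=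
      funext fun x => contract_smul (kronecker n) c (g x)
    change opJPow k (opJ (c • g)) = c • opJPow k (opJ g)
    rw [opJ_smul, opJPow_smul c k]

variable (f : 𝓢(Rn n, SymTensor n m)) (a b r : ℕ)

lemma divergencePow_momentField (k : ℕ) :
    divergencePow k (momentField f k b (r + k)) = (k ! : ℂ) • momentField f 0 b r := by
  induction k with
  | zero => simp [divergencePow]
  | succ k ih =>
    change divergencePow k (divergence (momentField f (k + 1) b (r + k + 1))) = _
    rw [divergence_momentField, divergencePow_smul _ _ (contDiff_momentField f _ _ _), ih,
      smul_smul, Nat.factorial_succ, Nat.cast_mul]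

lemma opJxPow_momentField (k : ℕ) :
    opJxPow k (momentField f a b (r + k)) = momentField f (a + k) b r := by
  induction k generalizing a with
  | zero => rfl
  | succ k ih =>
    change opJxPow k (opJx (momentField f a b (r + k + 1))) = _
    rw [opJx_momentField, ih, Nat.add_right_comm, Nat.add_assoc]

lemma opJPow_momentField (k : ℕ) :
    opJPow k (momentField f a b (r + 2 * k)) = momentField f a b r := by
  induction k with
  | zero => rfl
  | succ k ih =>
    change opJPow k (opJ (momentField f a b (r + 2 * k + 2))) = _
    rw [opJ_momentField, ih]

lemma castRank_self {s : ℕ} (g : Field n s) : castRank s g = g := by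
  funext x I
  simp only [castRank, dif_pos]
  rfl

lemma castRank_momentField {r s : ℕ} (h : r = s) :
    castRank s (momentField f a b r) = momentField f a b s := by
  subst h
  exact castRank_self _

lemma opJPow_opJxPow_divergencePow_normalOp {k l q s : ℕ} (h : s + 2 * q + l + k = m) :
    opJPow q (opJxPow l (divergencePow k (castRank (s + 2 * q + l + k)
      (normalOp k (toField f))))) = (k ! : ℂ) • momentField f l k s := by
  rw [normalOp_eq_momentField, castRank_momentField f k k h.symm, divergencePow_momentField,
    opJxPow_smul, opJPow_smul, opJxPow_momentField, opJPow_momentField, zero_add]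

end FieldOperators

section DirectionalDerivative

/-- The derivative in the direction `η`. -/
def dirDeriv {E : Type*} [NormedAddCommGroup E] [NormedSpace ℝ E] (η : E) (h : E → ℂ) : E → ℂ :=
  fun x => fderiv ℝ h x η

open LineDeriv in
/-- The derivative in the direction `η` of a Schwartz function. -/
abbrev schwartzDeriv {E : Type*} [NormedAddCommGroup E] [NormedSpace ℝ E] (η : E)
    (χ : 𝓢(E, ℂ)) : 𝓢(E, ℂ) := ∂_{η} χ

lemma contDiff_dirDeriv {E : Type*} [NormedAddCommGroup E] [NormedSpace ℝ E] (η : E) {h : E → ℂ}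
    (hh : ContDiff ℝ ∞ h) : ContDiff ℝ ∞ (dirDeriv η h) :=
  (hh.fderiv_right (m := ∞) (by simp)).clm_apply contDiff_const

lemma dirDeriv_iterate_sum {E : Type*} [NormedAddCommGroup E] [NormedSpace ℝ E] {ι : Type*}
    (s : Finset ι) (η : E) (r : ℕ) (c : ι → ℂ) {h : ι → E → ℂ}
    (hh : ∀ i ∈ s, ContDiff ℝ ∞ (h i)) :
    (dirDeriv η)^[r] (fun x => ∑ i ∈ s, c i * h i x) =
      fun x => ∑ i ∈ s, c i * (dirDeriv η)^[r] (h i) x := by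
  induction r generalizing h with
  | zero => simp
  | succ r ih =>
    simp only [Function.iterate_succ, Function.comp_apply]
    rw [← ih fun i hi => contDiff_dirDeriv η (hh i hi)]
    congr 1
    funext x
    have differentiable : ∀ i ∈ s, DifferentiableAt ℝ (h i) x := fun i hi =>
      (hh i hi).differentiable (by simp) x
    rw [dirDeriv, fderiv_fun_sum fun i hi => (differentiable i hi).const_mul (c i)]
    simp only [_root_.sum_apply, dirDeriv]
    refine Finset.sum_congr rfl fun i hi => ?_
    rw [fderiv_const_mul (differentiable i hi)]
    simp

lemma dirDeriv_iterate_const_mul {E : Type*} [NormedAddCommGroup E] [NormedSpace ℝ E] (η : E)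
    (r : ℕ) (c : ℂ) {h : E → ℂ} (hh : ContDiff ℝ ∞ h) :
    (dirDeriv η)^[r] (fun x => c * h x) = fun x => c * (dirDeriv η)^[r] h x := by
  simpa using dirDeriv_iterate_sum (Finset.univ : Finset Unit) η r (fun _ => c)
    (h := fun _ => h) (fun _ _ => hh)

variable {E : Type*} [NormedAddCommGroup E] [InnerProductSpace ℝ E] [FiniteDimensional ℝ E]
  [MeasurableSpace E] [BorelSpace E] {c : Sph E × ℝ → ℂ}

lemma dirDeriv_iterate_rayIntegral (η : E) (r : ℕ) (hc : IsRayWeight c) (ψ : 𝓢(E, ℂ)) :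
    (dirDeriv η)^[r] (rayIntegral 0 0 c ψ) = rayIntegral 0 0 c ((schwartzDeriv η)^[r] ψ) := by
  induction r generalizing ψ with
  | zero => rfl
  | succ r ih =>
    simp only [Function.iterate_succ, Function.comp_apply]
    rw [← ih]
    congr 1
    funext x
    rw [dirDeriv, fderiv_rayIntegral 0 0 hc]
    simp

/-- The sum is the binomial expansion of `(-t)^a = (⟨x,ξ⟩ - (t + ⟨x,ξ⟩))^a` under the integral. -/
lemma sum_rayIntegral_binomial (a : ℕ) (hc : IsRayWeight c) (ψ : 𝓢(E, ℂ)) (x : E) :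
    ∑ k ∈ Finset.range (a + 1), ((-1) ^ k / ((k ! : ℂ) * ((a - k)! : ℂ))) *
      rayIntegral (a - k) k c ψ x =
    (a ! : ℂ)⁻¹ * rayIntegral 0 0 (fun p => (-(p.2 : ℂ)) ^ a * c p) ψ x := by
  simp only [rayIntegral, ← integral_const_mul]
  rw [← integral_finsetSum _ fun k _ => (hc.integrable (a - k) k ψ x).const_mul _]
  refine integral_congr_ae (Filter.Eventually.of_forall fun p => ?_)
  have neg_eq : -(p.2 : ℂ) = -((p.2 : ℂ) + ((inner ℝ x (p.1 : E) : ℝ) : ℂ)) +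
    ((inner ℝ x (p.1 : E) : ℝ) : ℂ) := by ring
  simp only [rayWeight, pow_zero, one_mul]
  rw [neg_eq, add_pow]
  simp only [Finset.mul_sum, Finset.sum_mul]
  refine Finset.sum_congr rfl fun k hk => ?_
  rw [Nat.cast_choose ℂ (Nat.lt_succ_iff.1 (Finset.mem_range.1 hk)),
    neg_pow ((p.2 : ℂ) + ((inner ℝ x (p.1 : E) : ℝ) : ℂ))]
  have factorial_ne_zero : (a ! : ℂ) ≠ 0 := by exact_mod_cast a.factorial_ne_zero
  field_simp

lemma sum_dirDeriv_rayIntegral_binomial (η : E) (a : ℕ) (hc : IsRayWeight c) (ψ : 𝓢(E, ℂ))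
    (x : E) :
    ∑ k ∈ Finset.range (a + 1), ((-1) ^ k / ((k ! : ℂ) * ((a - k)! : ℂ))) *
      (dirDeriv η)^[a] (rayIntegral (a - k) k c ψ) x =
    (a ! : ℂ)⁻¹ *
      rayIntegral 0 0 (fun p => (-(p.2 : ℂ)) ^ a * c p) ((schwartzDeriv η)^[a] ψ) x := by
  have hw := (IsRayWeight.neg_pow a).mul hc
  rw [← congrFun (dirDeriv_iterate_sum _ η a _ fun k _ => contDiff_rayIntegral (a - k) k hc ψ) x]
  simp only [sum_rayIntegral_binomial a hc]
  rw [dirDeriv_iterate_const_mul _ _ _ (contDiff_rayIntegral _ _ hw _),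
    dirDeriv_iterate_rayIntegral _ _ hw]

end DirectionalDerivative

section TensorEvalOperators

variable {n m : ℕ}

lemma tensorEval_castRank {a b : ℕ} (h : a = b) (g : Field n a) (x η : Rn n) :
    tensorEval (castRank b g x) η = tensorEval (g x) η := by
  subst h
  rw [castRank_self]

lemma tensorEval_innerDeriv {g : Field n m} (hg : ContDiff ℝ ∞ g) (x η : Rn n) :
    tensorEval (innerDeriv g x) η = dirDeriv η (fun y => tensorEval (g y) η) x := by
  have differentiable : ∀ I, DifferentiableAt ℝ (fun y => g y I) x := fun I =>
    (contDiff_pi.1 hg I).differentiable (by simp) x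
  unfold innerDeriv
  rw [tensorEval_symmetrize, dirDeriv]
  simp only [tensorEval]
  rw [fderiv_fun_sum fun I _ => (differentiable I).mul_const _,
    ← (Fin.snocEquiv fun _ => Fin n).sum_comp, Fintype.sum_prod_type, Finset.sum_comm]
  simp only [_root_.sum_apply]
  refine Finset.sum_congr rfl fun I _ => ?_
  rw [fderiv_mul_const (differentiable I)]
  conv_rhs => rw [← sum_smul_basisVec η]
  rw [map_sum]
  refine Finset.sum_congr rfl fun j _ => ?_
  simp only [Fin.snocEquiv, Equiv.coe_fn_mk, Fin.snoc_last, Fin.init_snoc, map_smul, vecPow_snoc,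
    sum_smul_basisVec, pderiv, FunLike.coe_smul, Pi.smul_apply, smul_eq_mul, Complex.real_smul]
  ring

lemma tensorEval_innerDerivPow {g : Field n m} (hg : ContDiff ℝ ∞ g) (η : Rn n) (r : ℕ) :
    (fun x => tensorEval (innerDerivPow r g x) η) =
      (dirDeriv η)^[r] (fun y => tensorEval (g y) η) := by
  induction r with
  | zero => rfl
  | succ r ih =>
    rw [Function.iterate_succ_apply', ← ih]
    funext x
    exact tensorEval_innerDeriv (contDiff_innerDerivPow hg r) x η

lemma tensorEval_opI (g : Field n m) (x η : Rn n) :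
    tensorEval (opI g x) η = ((‖η‖ ^ 2 : ℝ) : ℂ) * tensorEval (g x) η := by
  rw [opI, symMul, tensorEval_symmetrize, tensorEval_tensorProd, mul_comm, tensorEval_kronecker]

lemma tensorEval_opIPow (g : Field n m) (x η : Rn n) (r : ℕ) :
    tensorEval (opIPow r g x) η = ((‖η‖ ^ 2 : ℝ) : ℂ) ^ r * tensorEval (g x) η := by
  induction r with
  | zero => simp [opIPow]
  | succ r ih =>
    rw [pow_succ', mul_assoc, ← ih]
    exact tensorEval_opI _ x η

/-- The weight `⟨ξ,η⟩^b ξ_J`, by which `ξ^b ⊗ ξ^m` is integrated after pairing the first factor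
with `η^b`. -/
def evalWeight (η : Rn n) (b : ℕ) (J : Fin m → Fin n) (ξ : Rn n) : ℂ :=
  ((inner ℝ ξ η : ℝ) : ℂ) ^ b * vecPow ξ J

@[fun_prop]
lemma continuous_evalWeight (η : Rn n) (b : ℕ) (J : Fin m → Fin n) :
    Continuous (evalWeight η b J) := by
  unfold evalWeight
  fun_prop

lemma isRayWeight_evalWeight (η : Rn n) (b : ℕ) (J : Fin m → Fin n) :
    IsRayWeight (fun p : Sph (Rn n) × ℝ => evalWeight η b J p.1) :=
  .of_continuous (c := fun ξ : Sph (Rn n) => evalWeight η b J ξ) (by fun_prop)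

variable (f : 𝓢(Rn n, SymTensor n m))

lemma tensorEval_momentField (a b r : ℕ) (x η : Rn n) :
    tensorEval (momentField f a b r x) η =
      ∑ J, rayIntegral a b (fun p => evalWeight η r J p.1) (schwartzComp f J) x := by
  simp only [tensorEval, momentField, Finset.sum_mul]
  rw [Finset.sum_comm]
  refine Finset.sum_congr rfl fun J _ => ?_
  simp only [mul_comm _ (vecPow η _)]
  rw [sum_mul_rayIntegral _ _ _ fun K _ => isRayWeight_vecPow_mul_vecPow K J]
  congr with p
  rw [evalWeight, ← tensorEval_vecPow, tensorEval, Finset.sum_mul]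
  exact Finset.sum_congr rfl fun K _ => by ring

lemma tensorEval_termD_normalOp {k p q : ℕ} (hkp : k + q ≤ p) (hpm : p + q ≤ m) (x η : Rn n) :
    tensorEval (termD k p q (normalOp k (toField f)) x) η =
      (k ! : ℂ) * ((‖η‖ ^ 2 : ℝ) : ℂ) ^ q * ∑ J, (dirDeriv η)^[p - q]
        (rayIntegral (p - k - q) k (fun p' => evalWeight η (m - p - q) J p'.1)
          (schwartzComp f J)) x := by
  have smooth : ContDiff ℝ ∞ ((k ! : ℂ) • momentField f (p - k - q) k (m - p - q)) :=
    contDiff_const.smul (contDiff_momentField f _ _ _)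
  have tensorEval_field : (fun y => tensorEval (opIPow q
      ((k ! : ℂ) • momentField f (p - k - q) k (m - p - q)) y) η) =
      fun y => ∑ J, ((k ! : ℂ) * ((‖η‖ ^ 2 : ℝ) : ℂ) ^ q) * rayIntegral (p - k - q) k
        (fun p' => evalWeight η (m - p - q) J p'.1) (schwartzComp f J) y := by
    funext y
    rw [tensorEval_opIPow, ← Finset.mul_sum, ← tensorEval_momentField, Pi.smul_apply,
      tensorEval_smul, mul_left_comm, mul_assoc]
  rw [termD, tensorEval_castRank (by omega), opJPow_opJxPow_divergencePow_normalOp f (by omega),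
    congrFun (tensorEval_innerDerivPow (contDiff_opIPow smooth q) η (p - q)) x, tensorEval_field,
    dirDeriv_iterate_sum _ _ _ _ fun J _ =>
      contDiff_rayIntegral _ _ (isRayWeight_evalWeight η _ J) _, Finset.mul_sum]

/-- Substituting `a = p - q` separates the summation over `k` from the other two. -/
lemma sum_opD_index (m : ℕ) (X : ℕ → ℕ → ℕ → ℂ) :
    ∑ k ∈ Finset.range (m + 1), ∑ p ∈ Finset.Icc k m,
      ∑ q ∈ Finset.range (min p (min (m - p) (p - k)) + 1), X k p q =
    ∑ a ∈ Finset.range (m + 1), ∑ q ∈ Finset.range ((m - a) / 2 + 1),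
      ∑ k ∈ Finset.range (a + 1), X k (a + q) q := by
  simp only [Finset.sum_sigma']
  refine Finset.sum_nbij' (fun z => ⟨z.2.1 - z.2.2, z.2.2, z.1⟩)
    (fun z => ⟨z.2.2, z.1 + z.2.1, z.2.1⟩) ?_ ?_ ?_ ?_ ?_
  · rintro ⟨k, p, q⟩ h
    simp only [Finset.mem_sigma, Finset.mem_range, Finset.mem_Icc] at h ⊢
    omega
  · rintro ⟨a, q, k⟩ h
    simp only [Finset.mem_sigma, Finset.mem_range, Finset.mem_Icc] at h ⊢
    omega
  · rintro ⟨k, p, q⟩ h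
    simp only [Finset.mem_sigma, Finset.mem_range, Finset.mem_Icc] at h
    have : p - q + q = p := by omega
    simp only [this]
  · rintro ⟨a, q, k⟩ -
    simp
  · rintro ⟨k, p, q⟩ h
    simp only [Finset.mem_sigma, Finset.mem_range, Finset.mem_Icc] at h
    have : p - q + q = p := by omega
    simp only [this]

/-- The factor `(-1)^k (k!)² c_{m,n}^k`, which does not depend on `k`. -/
def coeffC₀ (m n : ℕ) : ℝ :=
  (2 : ℝ) ^ ((m : ℤ) - 2) * Real.Gamma ((2 * (m : ℝ) + n - 1) / 2) /
    (Real.pi ^ (((n : ℝ) + 1) / 2) * ((n + 2 * m - 3)‼ : ℕ))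

/-- The field `∑_k D_{m,n}^k N_m^k f`. -/
def sumField : Field n m := fun x I =>
  ∑ k ∈ Finset.range (m + 1), opD m n k (normalOp k (toField f)) x I

lemma tensorEval_opD (k : ℕ) (g : Field n m) (x η : Rn n) :
    tensorEval (opD m n k g x) η = ∑ p ∈ Finset.Icc k m,
      ∑ q ∈ Finset.range (min p (min (m - p) (p - k)) + 1), (coeffC m n k : ℂ) *
        (((n + 2 * m - 2 * p - 3)‼ : ℕ) : ℂ) * ((-1 : ℂ) ^ q /
        (2 ^ q * (q ! : ℂ) * ((m - p - q)! : ℂ) * ((p - k - q)! : ℂ))) *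
        tensorEval (termD k p q g x) η := by
  simp only [tensorEval, opD, Finset.sum_mul, Finset.mul_sum]
  rw [Finset.sum_comm]
  refine Finset.sum_congr rfl fun p _ => ?_
  rw [Finset.sum_comm]
  exact Finset.sum_congr rfl fun q _ => Finset.sum_congr rfl fun I _ => by ring

lemma coeffC_mul_tensorEval_termD {a q k : ℕ} (hk : k ≤ a) (hq : a + 2 * q ≤ m) (x η : Rn n) :
    (coeffC m n k : ℂ) * (((n + 2 * m - 2 * (a + q) - 3)‼ : ℕ) : ℂ) * ((-1 : ℂ) ^ q /
        (2 ^ q * (q ! : ℂ) * ((m - (a + q) - q)! : ℂ) * ((a + q - k - q)! : ℂ))) *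
        tensorEval (termD k (a + q) q (normalOp k (toField f)) x) η =
      ((coeffC₀ m n : ℂ) * ((((n + 2 * (m - a - q) - 3)‼ : ℕ) : ℂ) * ((-1) ^ q /
          (2 ^ q * (q ! : ℂ) * ((m - a - 2 * q)! : ℂ))) * ((‖η‖ ^ 2 : ℝ) : ℂ) ^ q)) *
        ∑ J, (-1) ^ k / ((k ! : ℂ) * ((a - k)! : ℂ)) * (dirDeriv η)^[a] (rayIntegral (a - k) k
          (fun p => evalWeight η (m - a - 2 * q) J p.1) (schwartzComp f J)) x := by
  rw [tensorEval_termD_normalOp f (by omega) (by omega), ← Finset.mul_sum]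
  have coeffC_eq : (coeffC m n k : ℂ) = (-1) ^ k / (k ! : ℂ) ^ 2 * (coeffC₀ m n : ℂ) := by
    simp [coeffC, coeffC₀]
  rw [show a + q - q = a by omega, show a + q - k - q = a - k by omega,
    show m - (a + q) - q = m - a - 2 * q by omega,
    show n + 2 * m - 2 * (a + q) - 3 = n + 2 * (m - a - q) - 3 by omega, coeffC_eq]
  have factorial_ne_zero : (k ! : ℂ) ≠ 0 := by exact_mod_cast k.factorial_ne_zero
  field_simp

lemma tensorEval_sumField (x η : Rn n) :
    tensorEval (sumField f x) η =
      (coeffC₀ m n : ℂ) * ∑ a ∈ Finset.range (m + 1), ∑ q ∈ Finset.range ((m - a) / 2 + 1),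
        (((n + 2 * (m - a - q) - 3)‼ : ℕ) : ℂ) * ((-1) ^ q /
          (2 ^ q * (q ! : ℂ) * ((m - a - 2 * q)! : ℂ) * (a ! : ℂ))) * ((‖η‖ ^ 2 : ℝ) : ℂ) ^ q *
        ∑ J, rayIntegral 0 0 (fun p => (-(p.2 : ℂ)) ^ a * evalWeight η (m - a - 2 * q) J p.1)
          ((schwartzDeriv η)^[a] (schwartzComp f J)) x := by
  have sumField_eq : sumField f x =
      ∑ k ∈ Finset.range (m + 1), opD m n k (normalOp k (toField f)) x := by
    funext I
    simp only [sumField, Finset.sum_apply]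
  rw [sumField_eq, tensorEval_sum]
  simp only [tensorEval_opD]
  rw [sum_opD_index m (fun k p q => (coeffC m n k : ℂ) *
        (((n + 2 * m - 2 * p - 3)‼ : ℕ) : ℂ) * ((-1 : ℂ) ^ q /
        (2 ^ q * (q ! : ℂ) * ((m - p - q)! : ℂ) * ((p - k - q)! : ℂ))) *
        tensorEval (termD k p q (normalOp k (toField f)) x) η)]
  simp only [Finset.mul_sum (Finset.range _)]
  refine Finset.sum_congr rfl fun a ha => Finset.sum_congr rfl fun q hq => ?_
  rw [Finset.mem_range] at ha hq
  rw [Finset.sum_congr rfl fun k hk => coeffC_mul_tensorEval_termD f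
    (Nat.lt_succ_iff.1 (Finset.mem_range.1 hk)) (by omega) x η, ← Finset.mul_sum, Finset.sum_comm]
  simp only [sum_dirDeriv_rayIntegral_binomial η a (isRayWeight_evalWeight η _ _),
    ← Finset.mul_sum]
  have factorial_ne_zero : (a ! : ℂ) ≠ 0 := by exact_mod_cast a.factorial_ne_zero
  field_simp

end TensorEvalOperators

/-! ### Polar coordinates over full lines -/

section Polar

variable {E : Type*} [NormedAddCommGroup E] [InnerProductSpace ℝ E] [FiniteDimensional ℝ E]
  [MeasurableSpace E] [BorelSpace E]

/-- The measure `|t|^k dt` on the line. -/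
def absPowMeasure (k : ℕ) : Measure ℝ :=
  volume.withDensity fun t => (Real.toNNReal (|t| ^ k) : ENNReal)

instance (k : ℕ) : SFinite (absPowMeasure k) := by unfold absPowMeasure; infer_instance

lemma measurePreserving_coe_volumeIoiPow (k : ℕ) :
    MeasurePreserving (Subtype.val : Set.Ioi (0 : ℝ) → ℝ) (Measure.volumeIoiPow k)
      ((absPowMeasure k).restrict (Set.Ioi 0)) := by
  refine ⟨measurable_subtype_coe, Measure.ext fun s hs => ?_⟩
  rw [Measure.map_apply measurable_subtype_coe hs, Measure.volumeIoiPow, absPowMeasure,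
    restrict_withDensity measurableSet_Ioi, withDensity_apply _ (measurable_subtype_coe hs),
    withDensity_apply _ hs]
  refine Eq.trans ?_ ((measurePreserving_subtype_coe measurableSet_Ioi).setLIntegral_comp_preimage
    hs (by fun_prop))
  simp only [abs_of_pos (Set.mem_Ioi.1 (Subtype.prop _)), ENNReal.ofReal]

lemma measurePreserving_neg_absPowMeasure (k : ℕ) :
    MeasurePreserving Neg.neg (absPowMeasure k) (absPowMeasure k) := by
  refine ⟨measurable_neg, Measure.ext fun s hs => ?_⟩
  rw [Measure.map_apply measurable_neg hs, absPowMeasure, withDensity_apply _ (measurable_neg hs),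
    withDensity_apply _ hs]
  simpa only [abs_neg] using
    (Measure.measurePreserving_neg (volume : Measure ℝ)).setLIntegral_comp_preimage hs
      (f := fun t => (Real.toNNReal (|t| ^ k) : ENNReal)) (by fun_prop)

lemma measurePreserving_polar_Ioi [Nontrivial E] :
    MeasurePreserving (fun p : Sph E × ℝ => p.2 • (p.1 : E))
      ((volume : Measure E).toSphere.prod
        ((absPowMeasure (Module.finrank ℝ E - 1)).restrict (Set.Ioi 0))) volume := by
  have coe_pow := (MeasurePreserving.id (volume : Measure E).toSphere).prod
    (measurePreserving_coe_volumeIoiPow (Module.finrank ℝ E - 1))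
  have coe_compl : MeasurePreserving (Subtype.val : ({0}ᶜ : Set E) → E)
      (Measure.comap Subtype.val volume) volume := by
    simpa only [restrict_compl_singleton] using
      measurePreserving_subtype_coe (μa := (volume : Measure E))
        (measurableSet_singleton 0).compl
  have polar := coe_compl.comp (MeasurePreserving.symm
    (homeomorphUnitSphereProd E).toMeasurableEquiv
    (volume : Measure E).measurePreserving_homeomorphUnitSphereProd)
  refine ⟨by fun_prop, ?_⟩
  rw [← coe_pow.map_eq, Measure.map_map (by fun_prop) coe_pow.measurable]
  exact polar.map_eq

lemma measurePreserving_polar_Iio [Nontrivial E] :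
    MeasurePreserving (fun p : Sph E × ℝ => p.2 • (p.1 : E))
      ((volume : Measure E).toSphere.prod
        ((absPowMeasure (Module.finrank ℝ E - 1)).restrict (Set.Iio 0))) volume := by
  have neg_restrict := (measurePreserving_neg_absPowMeasure
    (Module.finrank ℝ E - 1)).restrict_preimage (measurableSet_Ioi (a := (0 : ℝ)))
  have neg_preimage : Neg.neg ⁻¹' Set.Ioi (0 : ℝ) = Set.Iio 0 := by ext; simp
  rw [neg_preimage] at neg_restrict
  convert! ((Measure.measurePreserving_neg (volume : Measure E)).comp
    measurePreserving_polar_Ioi).comp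
      ((MeasurePreserving.id (volume : Measure E).toSphere).prod neg_restrict) using 1
  ext p
  simp

lemma map_polar_absPowMeasure [Nontrivial E] :
    ((volume : Measure E).toSphere.prod (absPowMeasure (Module.finrank ℝ E - 1))).map
      (fun p : Sph E × ℝ => p.2 • (p.1 : E)) = volume + volume := by
  have split : absPowMeasure (Module.finrank ℝ E - 1) =
      (absPowMeasure (Module.finrank ℝ E - 1)).restrict (Set.Iio 0) +
        (absPowMeasure (Module.finrank ℝ E - 1)).restrict (Set.Ioi 0) := by
    have null_singleton : NullSingletonClass (absPowMeasure (Module.finrank ℝ E - 1)) :=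
      ⟨fun t => withDensity_absolutelyContinuous _ _ (measure_singleton t)⟩
    rw [← Measure.restrict_union Set.Iio_disjoint_Ioi_same measurableSet_Ioi, Set.Iio_union_Ioi,
      restrict_compl_singleton]
  rw [split, Measure.prod_add, Measure.map_add _ _ (by fun_prop),
    measurePreserving_polar_Ioi.map_eq, measurePreserving_polar_Iio.map_eq]

lemma rayMeasure_withDensity (k : ℕ) :
    (rayMeasure E).withDensity (fun p => (Real.toNNReal (|p.2| ^ k) : ENNReal)) =
      (volume : Measure E).toSphere.prod (absPowMeasure k) := by
  rw [rayMeasure, absPowMeasure, prod_withDensity_right (by fun_prop)]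

/-- Every `z ≠ 0` is `tξ` for two pairs `(ξ, t)`, whence the factor `2`. -/
lemma integral_rayMeasure_polar [Nontrivial E] {V : E → ℂ} (hV : AEStronglyMeasurable V)
    (hi : Integrable (fun p : Sph E × ℝ => |p.2| ^ (Module.finrank ℝ E - 1) • V (p.2 • (p.1 : E)))
      (rayMeasure E)) :
    Integrable V ∧
      ∫ p : Sph E × ℝ, |p.2| ^ (Module.finrank ℝ E - 1) • V (p.2 • (p.1 : E)) ∂(rayMeasure E) =
        2 * ∫ z, V z := by
  set k := Module.finrank ℝ E - 1 with hk
  have map_eq := map_polar_absPowMeasure (E := E)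
  rw [← hk, ← rayMeasure_withDensity] at map_eq
  have density_meas : Measurable fun p : Sph E × ℝ => Real.toNNReal (|p.2| ^ k) := by fun_prop
  have density_smul (p : Sph E × ℝ) : Real.toNNReal (|p.2| ^ k) • V (p.2 • (p.1 : E)) =
      |p.2| ^ k • V (p.2 • (p.1 : E)) := by
    rw [NNReal.smul_def, Real.coe_toNNReal _ (by positivity)]
  have polar_meas : AEMeasurable (fun p : Sph E × ℝ => p.2 • (p.1 : E))
    ((rayMeasure E).withDensity fun p => (Real.toNNReal (|p.2| ^ k) : ENNReal)) := by fun_prop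
  have V_meas : AEStronglyMeasurable V (volume + volume) := hV.add_measure hV
  have integrable_two : Integrable V (volume + volume) := by
    rw [← map_eq] at V_meas ⊢
    rw [integrable_map_measure V_meas polar_meas,
      integrable_withDensity_iff_integrable_smul density_meas]
    simpa only [Function.comp_apply, density_smul] using hi
  have integrable_V : Integrable V := (integrable_add_measure.1 integrable_two).1
  refine ⟨integrable_V, ?_⟩
  simp only [← density_smul]
  rw [← integral_withDensity_eq_integral_smul density_meas, two_mul,
    ← integral_add_measure integrable_V integrable_V]
  rw [← map_eq] at V_meas ⊢
  rw [integral_map polar_meas V_meas]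

end Polar

/-! ### Gaussian superpositions -/

section Superposition

lemma integrableOn_rpow_mul_exp {s r : ℝ} (hs : 0 < s) (hr : 0 < r) :
    IntegrableOn (fun l : ℝ => l ^ (s - 1) * Real.exp (-(l * r))) (Set.Ioi 0) := by
  refine (integrableOn_rpow_mul_exp_neg_mul_rpow (s := s - 1) (p := 1) (b := r) (by linarith)
    zero_lt_one hr).congr_fun (fun l _ => ?_) measurableSet_Ioi
  simp only [Real.rpow_one, neg_mul, mul_comm r l]

lemma integral_rpow_mul_exp {s r : ℝ} (hs : 0 < s) (hr : 0 < r) :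
    ∫ l in Set.Ioi (0 : ℝ), l ^ (s - 1) * Real.exp (-(l * r)) = Real.Gamma s * r ^ (-s) := by
  simp only [mul_comm _ r]
  rw [Real.integral_rpow_mul_exp_neg_mul_Ioi hs hr, Real.rpow_neg hr.le,
    Real.div_rpow zero_le_one hr.le, Real.one_rpow, mul_comm, one_div]

variable {Ω : Type*} [MeasurableSpace Ω] {μ : Measure Ω} [SFinite μ] {r : Ω → ℝ} {F : Ω → ℂ} {s : ℝ}

lemma integrable_rpow_mul_exp_prod (hs : 0 < s) (hr : Measurable r) (hr_pos : ∀ᵐ z ∂μ, 0 < r z)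
    (hF : AEStronglyMeasurable F μ) (hi : Integrable (fun z => r z ^ (-s) • F z) μ) :
    Integrable (fun p : ℝ × Ω => ((p.1 ^ (s - 1) * Real.exp (-(p.1 * r p.2)) : ℝ) : ℂ) * F p.2)
      ((volume.restrict (Set.Ioi 0)).prod μ) := by
  have kernel_meas : Measurable fun p : ℝ × Ω =>
      ((p.1 ^ (s - 1) * Real.exp (-(p.1 * r p.2)) : ℝ) : ℂ) := by fun_prop
  have joint_meas : AEStronglyMeasurable (fun p : ℝ × Ω =>
      ((p.1 ^ (s - 1) * Real.exp (-(p.1 * r p.2)) : ℝ) : ℂ) * F p.2)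
      ((volume.restrict (Set.Ioi 0)).prod μ) :=
    kernel_meas.aestronglyMeasurable.mul hF.comp_snd
  rw [integrable_prod_iff' joint_meas]
  constructor
  · filter_upwards [hr_pos] with z hz
    exact (integrableOn_rpow_mul_exp hs hz).ofReal.mul_const (F z)
  · refine (hi.norm.const_mul (Real.Gamma s)).congr ?_
    filter_upwards [hr_pos] with z hz
    have norm_eq : ∀ l ∈ Set.Ioi (0 : ℝ),
        ‖((l ^ (s - 1) * Real.exp (-(l * r z)) : ℝ) : ℂ) * F z‖ =
          l ^ (s - 1) * Real.exp (-(l * r z)) * ‖F z‖ := fun l (hl : 0 < l) => by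
      rw [norm_mul, Complex.norm_real, Real.norm_of_nonneg (by positivity)]
    rw [setIntegral_congr_fun measurableSet_Ioi norm_eq, integral_mul_const,
      integral_rpow_mul_exp hs hz, norm_smul, Real.norm_of_nonneg (by positivity), mul_assoc]

lemma integral_rpow_mul_integral_exp (hs : 0 < s) (hr : Measurable r)
    (hr_pos : ∀ᵐ z ∂μ, 0 < r z) (hF : AEStronglyMeasurable F μ)
    (hi : Integrable (fun z => r z ^ (-s) • F z) μ) :
    IntegrableOn (fun l : ℝ => ((l ^ (s - 1) : ℝ) : ℂ) *
      ∫ z, ((Real.exp (-(l * r z)) : ℝ) : ℂ) * F z ∂μ) (Set.Ioi 0) ∧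
    ∫ l in Set.Ioi (0 : ℝ), ((l ^ (s - 1) : ℝ) : ℂ) *
        ∫ z, ((Real.exp (-(l * r z)) : ℝ) : ℂ) * F z ∂μ =
      (Real.Gamma s : ℂ) * ∫ z, r z ^ (-s) • F z ∂μ := by
  have joint := integrable_rpow_mul_exp_prod hs hr hr_pos hF hi
  have slice (l : ℝ) : ∫ z, ((l ^ (s - 1) * Real.exp (-(l * r z)) : ℝ) : ℂ) * F z ∂μ =
      ((l ^ (s - 1) : ℝ) : ℂ) * ∫ z, ((Real.exp (-(l * r z)) : ℝ) : ℂ) * F z ∂μ := by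
    simp only [← integral_const_mul, Complex.ofReal_mul, mul_assoc]
  simp only [← slice]
  refine ⟨joint.integral_prod_left, ?_⟩
  rw [integral_integral_swap joint, ← integral_const_mul]
  refine integral_congr_ae ?_
  filter_upwards [hr_pos] with z hz
  rw [integral_mul_const, integral_complex_ofReal, integral_rpow_mul_exp hs hz, Complex.real_smul]
  push_cast
  ring

end Superposition

/-! ### Hermite-type polynomials -/

section Hermite

/-- The monomial `X^b (-Y)^q / (b! q!)` with `b + 2q = r`, and `0` if there is no such `b`. -/
def hermiteTerm (r q : ℕ) (X Y : ℂ) : ℂ :=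
  if 2 * q ≤ r then (-1) ^ q * X ^ (r - 2 * q) * Y ^ q / ((q ! : ℂ) * ((r - 2 * q)! : ℂ)) else 0

/-- The polynomial `∑_{b+2q=r} X^b (-Y)^q / (b! q!)`, the coefficient of `τ^r` in `e^{Xτ - Yτ²}`. -/
def hermiteSum (r : ℕ) (X Y : ℂ) : ℂ :=
  ∑ q ∈ Finset.range (r / 2 + 1), hermiteTerm r q X Y

lemma hermiteTerm_add (b q : ℕ) (X Y : ℂ) :
    hermiteTerm (2 * q + b) q X Y = (-1) ^ q * X ^ b * Y ^ q / ((q ! : ℂ) * (b ! : ℂ)) := by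
  simp [hermiteTerm]

lemma hermiteTerm_of_lt {r q : ℕ} (h : r < 2 * q) (X Y : ℂ) : hermiteTerm r q X Y = 0 :=
  if_neg h.not_ge

lemma hermiteSum_eq_sum_range {r N : ℕ} (hN : r / 2 + 1 ≤ N) (X Y : ℂ) :
    hermiteSum r X Y = ∑ q ∈ Finset.range N, hermiteTerm r q X Y := by
  refine Finset.sum_subset (Finset.range_mono hN) fun q _ hq => hermiteTerm_of_lt ?_ X Y
  rw [Finset.mem_range] at hq
  omega

lemma hermiteSum_zero (X Y : ℂ) : hermiteSum 0 X Y = 1 := by simp [hermiteSum, hermiteTerm]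

lemma hermiteSum_one (X Y : ℂ) : hermiteSum 1 X Y = X := by simp [hermiteSum, hermiteTerm]

lemma sub_mul_hermiteTerm_succ (r q : ℕ) (X Y : ℂ) :
    (r + 1 - 2 * q) * hermiteTerm (r + 1) q X Y = X * hermiteTerm r q X Y := by
  rcases lt_trichotomy (2 * q) (r + 1) with h | h | h
  · obtain ⟨b, rfl⟩ := Nat.exists_eq_add_of_le (Nat.lt_succ_iff.1 h)
    rw [add_assoc, hermiteTerm_add, hermiteTerm_add, Nat.factorial_succ]
    push_cast
    field_simp
    ring
  · have cast_eq : (r : ℂ) + 1 = 2 * q := by exact_mod_cast h.symm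
    rw [cast_eq, sub_self, zero_mul, hermiteTerm_of_lt (by omega), mul_zero]
  · rw [hermiteTerm_of_lt h, hermiteTerm_of_lt (by omega), mul_zero, mul_zero]

lemma succ_mul_hermiteTerm_succ (r q : ℕ) (X Y : ℂ) :
    (q + 1) * hermiteTerm (r + 2) (q + 1) X Y = -(Y * hermiteTerm r q X Y) := by
  rcases le_or_gt (2 * q) r with h | h
  · obtain ⟨b, rfl⟩ := Nat.exists_eq_add_of_le h
    rw [show 2 * q + b + 2 = 2 * (q + 1) + b by ring, hermiteTerm_add, hermiteTerm_add,
      Nat.factorial_succ]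
    push_cast
    field_simp
    ring
  · rw [hermiteTerm_of_lt h, hermiteTerm_of_lt (by omega), mul_zero, mul_zero, neg_zero]

lemma hermiteSum_succ_succ (r : ℕ) (X Y : ℂ) :
    (r + 2) * hermiteSum (r + 2) X Y = X * hermiteSum (r + 1) X Y - 2 * Y * hermiteSum r X Y := by
  have first : ∑ q ∈ Finset.range (r + 3), (r + 2 - 2 * q) * hermiteTerm (r + 2) q X Y =
      X * hermiteSum (r + 1) X Y := by
    rw [hermiteSum_eq_sum_range (N := r + 3) (by omega), Finset.mul_sum]
    refine Finset.sum_congr rfl fun q _ => ?_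
    rw [← sub_mul_hermiteTerm_succ]
    push_cast
    ring
  have second : ∑ q ∈ Finset.range (r + 3), q * hermiteTerm (r + 2) q X Y =
      -(Y * hermiteSum r X Y) := by
    rw [Finset.sum_range_succ', hermiteSum_eq_sum_range (N := r + 2) (by omega), Finset.mul_sum,
      ← Finset.sum_neg_distrib]
    simp only [Nat.cast_zero, zero_mul, add_zero, Nat.cast_succ, succ_mul_hermiteTerm_succ]
  rw [hermiteSum_eq_sum_range (N := r + 3) (by omega), ← first,
    show ∀ a : ℂ, a - 2 * Y * hermiteSum r X Y = a + 2 * -(Y * hermiteSum r X Y) by intro; ring,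
    ← second, Finset.mul_sum, Finset.mul_sum, ← Finset.sum_add_distrib]
  exact Finset.sum_congr rfl fun q _ => by ring

lemma hasDerivAt_hermiteTerm (r q : ℕ) (X Y : ℂ) :
    HasDerivAt (fun X => hermiteTerm (r + 1) q X Y) (hermiteTerm r q X Y) X := by
  rcases lt_trichotomy (2 * q) (r + 1) with h | h | h
  · obtain ⟨b, rfl⟩ := Nat.exists_eq_add_of_le (Nat.lt_succ_iff.1 h)
    simp only [add_assoc, hermiteTerm_add]
    convert! (((hasDerivAt_pow (b + 1) X).const_mul ((-1) ^ q)).mul_const (Y ^ q)).div_const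
      ((q ! : ℂ) * ((b + 1)! : ℂ)) using 1
    rw [Nat.factorial_succ]
    push_cast
    field_simp
  · have monomial (X : ℂ) := hermiteTerm_add 0 q X Y
    simp only [add_zero, pow_zero, h] at monomial
    rw [hermiteTerm_of_lt (by omega)]
    simp only [monomial]
    exact hasDerivAt_const _ _
  · simp only [hermiteTerm_of_lt h, hermiteTerm_of_lt (show r < 2 * q by omega)]
    exact hasDerivAt_const _ _

lemma hasDerivAt_hermiteSum (r : ℕ) (X Y : ℂ) :
    HasDerivAt (fun X => hermiteSum (r + 1) X Y) (hermiteSum r X Y) X := by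
  simp only [hermiteSum_eq_sum_range (N := r + 2) (show (r + 1) / 2 + 1 ≤ r + 2 by omega),
    hermiteSum_eq_sum_range (N := r + 2) (show r / 2 + 1 ≤ r + 2 by omega)]
  exact HasDerivAt.fun_sum fun q _ => hasDerivAt_hermiteTerm r q X Y

end Hermite

/-! ### Integration by parts against Gaussians -/

section Gauss

variable {E : Type*} [NormedAddCommGroup E]

/-- The Gaussian `e^{-λ|z|²}` as a complex function. -/
def gauss (l : ℝ) (z : E) : ℂ := ((Real.exp (-(l * ‖z‖ ^ 2)) : ℝ) : ℂ)

@[fun_prop]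
lemma continuous_gauss (l : ℝ) : Continuous (gauss l : E → ℂ) := by
  unfold gauss; fun_prop

lemma norm_gauss_le {l : ℝ} (hl : 0 ≤ l) (z : E) : ‖gauss l z‖ ≤ 1 := by
  rw [gauss, Complex.norm_real, Real.norm_eq_abs, Real.abs_exp, Real.exp_le_one_iff]
  exact neg_nonpos.2 (by positivity)

variable [InnerProductSpace ℝ E]

/-- The polynomial `K_r(z)` with `K_r G = (-D_η)^r G / r!` for the Gaussian `G = e^{-λ|z|²}`. -/
def hermiteField (l : ℝ) (η : E) (r : ℕ) (z : E) : ℂ :=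
  hermiteSum r (2 * l * ((inner ℝ z η : ℝ) : ℂ)) (l * ((‖η‖ ^ 2 : ℝ) : ℂ))

lemma hermiteField_zero (l : ℝ) (η z : E) : hermiteField l η 0 z = 1 := hermiteSum_zero _ _

lemma hasTemperateGrowth_inner (η : E) :
    (fun z : E => ((inner ℝ z η : ℝ) : ℂ)).HasTemperateGrowth := by
  simpa only [← innerCLM_apply] using (innerCLM η).hasTemperateGrowth

lemma hasTemperateGrowth_inner_prod {ι : Type*} (s : Finset ι) (v : ι → E) :
    (fun z : E => ∏ i ∈ s, ((inner ℝ z (v i) : ℝ) : ℂ)).HasTemperateGrowth := by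
  classical
  induction s using Finset.induction_on with
  | empty => simp only [Finset.prod_empty]; fun_prop
  | insert i s hi ih =>
    simp only [Finset.prod_insert hi]
    exact (hasTemperateGrowth_inner (v i)).mul ih

lemma hasTemperateGrowth_hermiteField (l : ℝ) (η : E) (r : ℕ) :
    (hermiteField l η r).HasTemperateGrowth := by
  have := hasTemperateGrowth_inner η
  unfold hermiteField hermiteSum
  refine Function.HasTemperateGrowth.sum fun q _ => ?_
  unfold hermiteTerm
  split_ifs
  · simp only [div_eq_mul_inv]
    fun_prop
  · fun_prop

lemma hasLineDerivAt_inner (v z η : E) :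
    HasLineDerivAt ℝ (fun z : E => ((inner ℝ z v : ℝ) : ℂ)) ((inner ℝ η v : ℝ) : ℂ) z η := by
  simp only [← innerCLM_apply]
  exact (innerCLM v).hasFDerivAt.hasLineDerivAt η

lemma hasLineDerivAt_inner_prod {ι : Type*} [DecidableEq ι] (s : Finset ι) (v : ι → E) (z η : E) :
    HasLineDerivAt ℝ (fun z : E => ∏ i ∈ s, ((inner ℝ z (v i) : ℝ) : ℂ))
      (∑ i ∈ s, ((inner ℝ η (v i) : ℝ) : ℂ) *
        ∏ j ∈ s.erase i, ((inner ℝ z (v j) : ℝ) : ℂ)) z η := by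
  have prod_deriv := HasDerivAt.fun_finsetProd fun i (_ : i ∈ s) => hasLineDerivAt_inner (v i) z η
  unfold HasLineDerivAt
  convert! prod_deriv using 1
  refine Finset.sum_congr rfl fun i _ => ?_
  simp only [zero_smul, add_zero, smul_eq_mul, mul_comm]

lemma hasLineDerivAt_gauss (l : ℝ) (η z : E) :
    HasLineDerivAt ℝ (gauss l) (-(2 * l * ((inner ℝ z η : ℝ) : ℂ)) * gauss l z) z η := by
  have exponent_deriv : HasLineDerivAt ℝ (fun z : E => -(l * ‖z‖ ^ 2)) (-(l * (2 * inner ℝ z η)))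
      z η := by
    simpa using ((hasStrictFDerivAt_norm_sq z).hasFDerivAt.const_mul l).fun_neg.hasLineDerivAt η
  have exp_deriv := (HasDerivAt.exp exponent_deriv).ofReal_comp
  unfold HasLineDerivAt
  convert! exp_deriv using 1
  simp only [gauss, zero_smul, add_zero]
  push_cast
  ring

lemma hasLineDerivAt_hermiteField_succ (l : ℝ) (η : E) (r : ℕ) (z : E) :
    HasLineDerivAt ℝ (hermiteField l η (r + 1))
      (hermiteField l η r z * (2 * l * ((‖η‖ ^ 2 : ℝ) : ℂ))) z η := by
  have inner_deriv : HasDerivAt (fun t : ℝ => 2 * (l : ℂ) * ((inner ℝ (z + t • η) η : ℝ) : ℂ))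
      (2 * l * ((‖η‖ ^ 2 : ℝ) : ℂ)) 0 := by
    rw [← real_inner_self_eq_norm_sq]
    exact (hasLineDerivAt_inner η z η).const_mul _
  have sum_deriv := hasDerivAt_hermiteSum r (2 * l * ((inner ℝ (z + (0 : ℝ) • η) η : ℝ) : ℂ))
    (l * ((‖η‖ ^ 2 : ℝ) : ℂ))
  have comp_deriv := sum_deriv.comp (0 : ℝ) inner_deriv
  simp only [zero_smul, add_zero] at comp_deriv
  exact comp_deriv

lemma hasLineDerivAt_gauss_mul_hermiteField (l : ℝ) (η : E) (r : ℕ) (z : E) :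
    HasLineDerivAt ℝ (fun z => gauss l z * hermiteField l η r z)
      (-((r + 1) * (gauss l z * hermiteField l η (r + 1) z))) z η := by
  cases r with
  | zero =>
    simp only [hermiteField, hermiteSum_zero, mul_one, zero_add, hermiteSum_one, Nat.cast_zero,
      one_mul]
    convert! hasLineDerivAt_gauss l η z using 1
    ring
  | succ r =>
    have recurrence := hermiteSum_succ_succ r (2 * l * ((inner ℝ z η : ℝ) : ℂ))
      (l * ((‖η‖ ^ 2 : ℝ) : ℂ))
    unfold HasLineDerivAt
    convert! HasDerivAt.mul (hasLineDerivAt_gauss l η z)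
      (hasLineDerivAt_hermiteField_succ l η r z) using 1
    simp only [zero_smul, add_zero, hermiteField]
    push_cast at recurrence ⊢
    linear_combination (-gauss l z) * recurrence

lemma hasLineDerivAt_mul_schwartz {p : E → ℂ} {p' : ℂ} {z η : E}
    (hp : HasLineDerivAt ℝ p p' z η) (ψ : 𝓢(E, ℂ)) :
    HasLineDerivAt ℝ (fun z => p z * ψ z) (p' * ψ z + p z * schwartzDeriv η ψ z) z η := by
  have schwartz_deriv : HasLineDerivAt ℝ ψ (schwartzDeriv η ψ z) z η := by
    rw [SchwartzMap.lineDerivOp_apply_eq_fderiv]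
    exact (ψ.hasFDerivAt z).hasLineDerivAt η
  have mul_deriv := HasDerivAt.mul hp schwartz_deriv
  simp only [zero_smul, add_zero] at mul_deriv
  exact mul_deriv

variable [FiniteDimensional ℝ E] [MeasurableSpace E] [BorelSpace E]

lemma integrable_gauss_mul {l : ℝ} (hl : 0 ≤ l) {p : E → ℂ} (hp : p.HasTemperateGrowth)
    (ψ : 𝓢(E, ℂ)) : Integrable (fun z => gauss l z * p z * ψ z) := by
  refine ((SchwartzMap.smulLeftCLM ℂ p ψ).integrable.bdd_mul (c := 1)
    (continuous_gauss l).aestronglyMeasurable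
    (Filter.Eventually.of_forall (norm_gauss_le hl))).congr
    (Filter.Eventually.of_forall fun z => ?_)
  simp only [SchwartzMap.smulLeftCLM_apply_apply hp, smul_eq_mul, mul_assoc]

lemma integral_gauss_mul_hermiteField_succ {l : ℝ} (hl : 0 ≤ l) (η : E) (r : ℕ) {p p' : E → ℂ}
    (hp : p.HasTemperateGrowth) (hp' : p'.HasTemperateGrowth)
    (hpp' : ∀ z, HasLineDerivAt ℝ p (p' z) z η) (ψ : 𝓢(E, ℂ)) :
    (r + 1) * ∫ z, gauss l z * (hermiteField l η (r + 1) z * p z) * ψ z =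
      (∫ z, gauss l z * (hermiteField l η r z * p' z) * ψ z) +
      ∫ z, gauss l z * (hermiteField l η r z * p z) * schwartzDeriv η ψ z := by
  have int_succ := integrable_gauss_mul hl ((hasTemperateGrowth_hermiteField l η (r + 1)).mul hp) ψ
  have growth := hasTemperateGrowth_hermiteField l η r
  have int_deriv := integrable_gauss_mul hl (growth.mul hp') ψ
  have int_schwartz := integrable_gauss_mul hl (growth.mul hp) (schwartzDeriv η ψ)
  have int_mul := integrable_gauss_mul hl (growth.mul hp) ψ
  simp only [Pi.mul_apply] at int_succ int_deriv int_schwartz int_mul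
  have by_parts := integral_bilinear_hasLineDerivAt_right_eq_neg_left_of_integrable
    (B := ContinuousLinearMap.mul ℝ ℂ) (μ := (volume : Measure E)) (v := η)
    (f := fun z => gauss l z * hermiteField l η r z)
    (f' := fun z => -((r + 1) * (gauss l z * hermiteField l η (r + 1) z)))
    (g := fun z => p z * ψ z) (g' := fun z => p' z * ψ z + p z * schwartzDeriv η ψ z)
    (by convert! int_succ.const_mul (-((r : ℂ) + 1)) using 2; simp; ring)
    (by convert! int_deriv.add int_schwartz using 2; simp; ring)
    (by convert! int_mul using 2; simp; ring)
    (fun z _ => hasLineDerivAt_gauss_mul_hermiteField l η r z)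
    (fun z _ => hasLineDerivAt_mul_schwartz (hpp' z) ψ)
  simp only [ContinuousLinearMap.mul_apply'] at by_parts
  calc _ = -∫ z, -((r + 1) * (gauss l z * hermiteField l η (r + 1) z)) * (p z * ψ z) := by
        rw [← integral_const_mul, ← integral_neg]
        congr 1 with z
        ring
    _ = _ := by
        rw [← by_parts, ← integral_add int_deriv int_schwartz]
        congr 1 with z
        ring

lemma sum_alternating_of_recurrence {e e' : ℕ → ℕ → ℂ}
    (h : ∀ r a, (r + 1) * e (r + 1) a = e' r a + e r (a + 1)) (m : ℕ) :
    (m + 1) * ∑ a ∈ Finset.range (m + 2), (-1) ^ a / (a ! : ℂ) * e (m + 1 - a) a =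
      ∑ a ∈ Finset.range (m + 1), (-1) ^ a / (a ! : ℂ) * e' (m - a) a := by
  have split : ((m : ℂ) + 1) *
        ∑ a ∈ Finset.range (m + 2), (-1) ^ a / (a ! : ℂ) * e (m + 1 - a) a =
      ∑ a ∈ Finset.range (m + 2), (-1) ^ a / (a ! : ℂ) * ((m + 1 - a : ℕ) * e (m + 1 - a) a) +
      ∑ a ∈ Finset.range (m + 2), (-1) ^ a / (a ! : ℂ) * (a * e (m + 1 - a) a) := by
    rw [← Finset.sum_add_distrib, Finset.mul_sum]
    refine Finset.sum_congr rfl fun a ha => ?_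
    rw [Nat.cast_sub (Nat.lt_succ_iff.1 (Finset.mem_range.1 ha))]
    push_cast
    ring
  rw [split, Finset.sum_range_succ, Finset.sum_range_succ' _ (m + 1)]
  simp only [Nat.sub_self, Nat.cast_zero, zero_mul, mul_zero, add_zero]
  rw [← Finset.sum_add_distrib]
  refine Finset.sum_congr rfl fun a ha => ?_
  rw [Nat.succ_sub (Nat.lt_succ_iff.1 (Finset.mem_range.1 ha)), Nat.add_sub_add_right,
    Nat.cast_succ, h, Nat.factorial_succ]
  push_cast
  field_simp
  ring

/-- The sum `∑_{a+r=m} (-1)^a/a! ∫ K_r G p D_η^a ψ`. -/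
def gaussSum (l : ℝ) (η : E) (ψ : 𝓢(E, ℂ)) (m : ℕ) (p : E → ℂ) : ℂ :=
  ∑ a ∈ Finset.range (m + 1), (-1) ^ a / (a ! : ℂ) *
    ∫ z, gauss l z * (hermiteField l η (m - a) z * p z) * (schwartzDeriv η)^[a] ψ z

lemma gaussSum_succ {l : ℝ} (hl : 0 ≤ l) (η : E) (ψ : 𝓢(E, ℂ)) (m : ℕ) {p p' : E → ℂ}
    (hp : p.HasTemperateGrowth) (hp' : p'.HasTemperateGrowth)
    (hpp' : ∀ z, HasLineDerivAt ℝ p (p' z) z η) :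
    (m + 1) * gaussSum l η ψ (m + 1) p = gaussSum l η ψ m p' := by
  refine sum_alternating_of_recurrence
    (e := fun r a => ∫ z, gauss l z * (hermiteField l η r z * p z) * (schwartzDeriv η)^[a] ψ z)
    (e' := fun r a => ∫ z, gauss l z * (hermiteField l η r z * p' z) * (schwartzDeriv η)^[a] ψ z)
    (fun r a => ?_) m
  rw [Function.iterate_succ_apply']
  exact integral_gauss_mul_hermiteField_succ hl η r hp hp' hpp' _

lemma gaussSum_sum {ι : Type*} (s : Finset ι) {l : ℝ} (hl : 0 ≤ l) (η : E) (ψ : 𝓢(E, ℂ)) (m : ℕ)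
    (c : ι → ℂ) {p : ι → E → ℂ} (hp : ∀ i, (p i).HasTemperateGrowth) :
    gaussSum l η ψ m (fun z => ∑ i ∈ s, c i * p i z) = ∑ i ∈ s, c i * gaussSum l η ψ m (p i) := by
  simp only [gaussSum, Finset.mul_sum]
  rw [Finset.sum_comm]
  refine Finset.sum_congr rfl fun a _ => ?_
  have integrable_term : ∀ i ∈ s, Integrable (fun z =>
      c i * (gauss l z * (hermiteField l η (m - a) z * p i z) * (schwartzDeriv η)^[a] ψ z)) :=
    fun i _ => (integrable_gauss_mul hl ((hasTemperateGrowth_hermiteField l η (m - a)).mul (hp i))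
      ((schwartzDeriv η)^[a] ψ)).const_mul (c i)
  simp only [mul_left_comm (c _) ((-1) ^ a / (a ! : ℂ)), ← Finset.mul_sum]
  congr 1
  simp only [← integral_const_mul]
  rw [← integral_finsetSum _ integrable_term]
  congr 1 with z
  simp only [Finset.mul_sum, Finset.sum_mul]
  exact Finset.sum_congr rfl fun i _ => by ring

lemma gaussSum_inner_prod {ι : Type*} (s : Finset ι) (v : ι → E) {l : ℝ} (hl : 0 ≤ l) (η : E)
    (ψ : 𝓢(E, ℂ)) :
    gaussSum l η ψ s.card (fun z => ∏ i ∈ s, ((inner ℝ z (v i) : ℝ) : ℂ)) =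
      (∏ i ∈ s, ((inner ℝ η (v i) : ℝ) : ℂ)) * ∫ z, gauss l z * ψ z := by
  classical
  induction card_eq : s.card generalizing s with
  | zero =>
    rw [Finset.card_eq_zero] at card_eq
    simp [card_eq, gaussSum, hermiteField_zero]
  | succ m ih =>
    have growth (t : Finset ι) := hasTemperateGrowth_inner_prod t v
    have lower_degree : ∀ i ∈ s, ((inner ℝ η (v i) : ℝ) : ℂ) * gaussSum l η ψ m
        (fun z => ∏ j ∈ s.erase i, ((inner ℝ z (v j) : ℝ) : ℂ)) =
        (∏ i ∈ s, ((inner ℝ η (v i) : ℝ) : ℂ)) * ∫ z, gauss l z * ψ z := fun i hi => by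
      rw [ih (s.erase i) (by rw [Finset.card_erase_of_mem hi, card_eq]; rfl), ← mul_assoc,
        Finset.mul_prod_erase s (fun i => ((inner ℝ η (v i) : ℝ) : ℂ)) hi]
    have succ_eq := gaussSum_succ hl η ψ m (growth s) (Function.HasTemperateGrowth.sum fun i _ =>
      (Function.HasTemperateGrowth.const _).mul (growth (s.erase i)))
      fun z => hasLineDerivAt_inner_prod s v z η
    refine mul_left_cancel₀ (Nat.cast_add_one_ne_zero m) (succ_eq.trans ?_)
    refine (gaussSum_sum s hl η ψ m _ fun i => growth (s.erase i)).trans ?_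
    rw [Finset.sum_congr rfl lower_degree, Finset.sum_const, card_eq, nsmul_eq_mul, Nat.cast_succ]

end Gauss

/-! ### The sum of the `D_{m,n}^k N_m^k f` as a Riesz potential -/

section RieszPotential

/-- The exponent `(n - 1) / 2`; a double factorial `(n + 2j - 3)‼` is a multiple of
`2 ^ j Γ(halfDim n + j)`. -/
def halfDim (n : ℕ) : ℝ := ((n : ℝ) - 1) / 2

lemma halfDim_pos {n : ℕ} (hn : 2 ≤ n) : 0 < halfDim n := by
  have two_le : (2 : ℝ) ≤ n := by exact_mod_cast hn
  unfold halfDim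
  linarith

lemma doubleFactorial_shift_succ {n : ℕ} (hn : 2 ≤ n) (j : ℕ) :
    (n + 2 * (j + 1) - 3)‼ = (n + 2 * j - 1) * (n + 2 * j - 3)‼ := by
  rcases Nat.lt_or_ge (n + 2 * j) 3 with h | h
  · obtain ⟨rfl, rfl⟩ : n = 2 ∧ j = 0 := by omega
    decide
  · obtain ⟨c, hc⟩ := Nat.exists_eq_add_of_le' h
    rw [show n + 2 * (j + 1) - 3 = c + 2 by omega, show n + 2 * j - 3 = c by omega,
      show n + 2 * j - 1 = c + 2 by omega, Nat.doubleFactorial_add_two]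

lemma doubleFactorial_eq_Gamma {n : ℕ} (hn : 2 ≤ n) (j : ℕ) :
    (((n + 2 * j - 3)‼ : ℕ) : ℝ) =
      ((n - 3)‼ : ℕ) / Real.Gamma (halfDim n) * 2 ^ j * Real.Gamma (halfDim n + j) := by
  have pos := halfDim_pos hn
  have Gamma_ne_zero := (Real.Gamma_pos_of_pos pos).ne'
  induction j with
  | zero =>
    simp only [mul_zero, add_zero, pow_zero, mul_one, Nat.cast_zero]
    field_simp
  | succ j ih =>
    have Gamma_succ : Real.Gamma (halfDim n + (j + 1 : ℕ)) =
        (halfDim n + j) * Real.Gamma (halfDim n + j) := by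
      rw [Nat.cast_succ, ← add_assoc, Real.Gamma_add_one (by positivity)]
    rw [doubleFactorial_shift_succ hn, Gamma_succ, Nat.cast_mul, ih, Nat.cast_sub (by omega),
      halfDim]
    push_cast
    ring

lemma coeffC₀_eq {n : ℕ} (hn : 2 ≤ n) (m : ℕ) :
    2 * coeffC₀ m n * (((n - 3)‼ : ℕ) / Real.Gamma (halfDim n)) =
      (2 * Real.pi ^ (((n : ℝ) + 1) / 2))⁻¹ := by
  have pos := halfDim_pos hn
  have factorial_ne_zero : (((n - 3)‼ : ℕ) : ℝ) ≠ 0 := by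
    exact_mod_cast (Nat.doubleFactorial_pos _).ne'
  have Gamma_ne_zero := (Real.Gamma_pos_of_pos pos).ne'
  have Gamma_add_ne_zero : Real.Gamma (halfDim n + m) ≠ 0 :=
    (Real.Gamma_pos_of_pos (by positivity)).ne'
  have two_zpow : (2 : ℝ) ^ ((m : ℤ) - 2) = 2 ^ m / 4 := by
    rw [zpow_sub₀ two_ne_zero, zpow_natCast]
    norm_num
  rw [coeffC₀, doubleFactorial_eq_Gamma hn, two_zpow,
    show (2 * (m : ℝ) + n - 1) / 2 = halfDim n + m by unfold halfDim; ring]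
  field_simp
  norm_num

variable {n m : ℕ}

lemma nontrivial_Rn (hn : 2 ≤ n) : Nontrivial (Rn n) :=
  Module.nontrivial_of_finrank_pos (R := ℝ) (by rw [finrank_euclideanSpace_fin]; omega)

lemma rayMeasure_ae_ne_zero : ∀ᵐ p ∂(rayMeasure (Rn n)), p.2 ≠ 0 := by
  have null : rayMeasure (Rn n) (Set.univ ×ˢ {(0 : ℝ)}) = 0 := by
    rw [rayMeasure, Measure.prod_prod, Real.volume_singleton, mul_zero]
  filter_upwards [measure_eq_zero_iff_ae_notMem.1 null] with p notMem h
  exact notMem ⟨Set.mem_univ _, h⟩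

lemma ae_norm_sq_pos [Nontrivial (Rn n)] : ∀ᵐ z : Rn n, 0 < ‖z‖ ^ 2 := by
  filter_upwards [Measure.ae_ne volume (0 : Rn n)] with z hz
  positivity

lemma abs_pow_mul_rpow (hn : 1 ≤ n) (j : ℕ) {t : ℝ} (ht : t ≠ 0) :
    |t| ^ (n - 1) * (t ^ 2) ^ (-(halfDim n + j)) = ((t ^ 2) ^ j)⁻¹ := by
  have sq_pos : 0 < t ^ 2 := by positivity
  have abs_pow : |t| ^ (n - 1) = (t ^ 2) ^ (halfDim n) := by
    rw [← sq_abs, ← Real.rpow_natCast |t| 2, ← Real.rpow_mul (abs_nonneg t), ← Real.rpow_natCast,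
      Nat.cast_sub hn, halfDim]
    congr 1
    push_cast
    ring
  rw [abs_pow, ← Real.rpow_add sq_pos, ← Real.rpow_natCast (t ^ 2) j, ← Real.rpow_neg sq_pos.le]
  congr 1
  ring

lemma evalWeight_smul (η : Rn n) (b : ℕ) (J : Fin m → Fin n) (t : ℝ) (z : Rn n) :
    evalWeight η b J (t • z) = (t : ℂ) ^ (b + m) * evalWeight η b J z := by
  rw [evalWeight, evalWeight, vecPow_smul, real_inner_smul_left]
  push_cast
  ring

/-- The function `‖z‖^{-2s} ⟨z,η⟩^b z_J ψ(z + x)` with `s = (n - 1) / 2 + j`, a Riesz kernel in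
polar coordinates. -/
def rieszIntegrand (j b : ℕ) (η : Rn n) (J : Fin m → Fin n) (ψ : 𝓢(Rn n, ℂ)) (x z : Rn n) : ℂ :=
  (‖z‖ ^ 2) ^ (-(halfDim n + j)) • (evalWeight η b J z * ψ (z + x))

lemma measurable_evalWeight_mul_shift (b : ℕ) (η : Rn n) (J : Fin m → Fin n) (ψ : 𝓢(Rn n, ℂ))
    (x : Rn n) : Measurable fun z => evalWeight η b J z * ψ (z + x) :=
  ((continuous_evalWeight η b J).mul (ψ.continuous.comp (by fun_prop))).measurable

lemma measurable_rieszIntegrand (j b : ℕ) (η : Rn n) (J : Fin m → Fin n) (ψ : 𝓢(Rn n, ℂ))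
    (x : Rn n) : Measurable (rieszIntegrand j b η J ψ x) :=
  (by fun_prop : Measurable fun z : Rn n => (‖z‖ ^ 2) ^ (-(halfDim n + j))).smul
    (measurable_evalWeight_mul_shift b η J ψ x)

lemma abs_pow_smul_rieszIntegrand (hn : 2 ≤ n) {a b q : ℕ} (h : a + b + 2 * q = m) (η : Rn n)
    (J : Fin m → Fin n) (ψ : 𝓢(Rn n, ℂ)) (x : Rn n) (ξ : Sph (Rn n)) {t : ℝ} (ht : t ≠ 0) :
    |t| ^ (n - 1) • rieszIntegrand (b + q) b η J ψ x (t • (ξ : Rn n)) =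
      (-1) ^ a * (rayWeight 0 0 (fun p => (-(p.2 : ℂ)) ^ a * evalWeight η b J p.1) x (ξ, t) *
        ψ (x + t • (ξ : Rn n))) := by
  have norm_sq : ‖t • (ξ : Rn n)‖ ^ 2 = t ^ 2 := by
    rw [norm_smul, mul_pow, norm_eq_of_mem_sphere, Real.norm_eq_abs, sq_abs, one_pow, mul_one]
  have pow_split : (t : ℂ) ^ (b + m) = ((t : ℂ) ^ 2) ^ (b + q) * (t : ℂ) ^ a := by
    rw [← pow_mul, ← pow_add]
    congr 1
    omega
  have t_ne_zero : (t : ℂ) ≠ 0 := by exact_mod_cast ht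
  have sign_sq : ((-1 : ℂ) ^ a) * (-1) ^ a = 1 := by rw [← mul_pow]; simp
  rw [rieszIntegrand, norm_sq, evalWeight_smul, smul_smul, abs_pow_mul_rpow (by omega) _ ht,
    Complex.real_smul, pow_split, rayWeight, neg_pow, add_comm x]
  push_cast
  field_simp
  linear_combination (-(t : ℂ) ^ a * evalWeight η b J ξ * ψ (t • (ξ : Rn n) + x)) * sign_sq

lemma rayIntegral_eq_integral_rieszIntegrand (hn : 2 ≤ n) {a b q : ℕ} (h : a + b + 2 * q = m)
    (η : Rn n) (J : Fin m → Fin n) (ψ : 𝓢(Rn n, ℂ)) (x : Rn n) :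
    Integrable (rieszIntegrand (b + q) b η J ψ x) ∧
    (-1) ^ a * rayIntegral 0 0 (fun p => (-(p.2 : ℂ)) ^ a * evalWeight η b J p.1) ψ x =
      2 * ∫ z, rieszIntegrand (b + q) b η J ψ x z := by
  have := nontrivial_Rn hn
  have polar_eq : (fun p : Sph (Rn n) × ℝ => (-1) ^ a * (rayWeight 0 0
      (fun p => (-(p.2 : ℂ)) ^ a * evalWeight η b J p.1) x p * ψ (x + p.2 • (p.1 : Rn n))))
      =ᵐ[rayMeasure (Rn n)] fun p => |p.2| ^ (Module.finrank ℝ (Rn n) - 1) •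
        rieszIntegrand (b + q) b η J ψ x (p.2 • (p.1 : Rn n)) := by
    rw [finrank_euclideanSpace_fin]
    filter_upwards [rayMeasure_ae_ne_zero] with p hp
    exact (abs_pow_smul_rieszIntegrand hn h η J ψ x p.1 hp).symm
  have ray_integrable :=
    ((IsRayWeight.neg_pow a).mul (isRayWeight_evalWeight η b J)).integrable 0 0 ψ x
  obtain ⟨integrable, integral_eq⟩ := integral_rayMeasure_polar
    (measurable_rieszIntegrand (b + q) b η J ψ x).aestronglyMeasurable
    ((ray_integrable.const_mul _).congr polar_eq)
  exact ⟨integrable, by rw [rayIntegral, ← integral_const_mul, integral_congr_ae polar_eq,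
    integral_eq]⟩

/-- The Gaussian moment `∫ e^{-λ|z|²} ⟨z,η⟩^b z_J ψ(z + x) dz`. -/
def gaussMoment (l : ℝ) (b : ℕ) (η : Rn n) (J : Fin m → Fin n) (ψ : 𝓢(Rn n, ℂ)) (x : Rn n) : ℂ :=
  ∫ z, gauss l z * (evalWeight η b J z * ψ (z + x))

lemma Gamma_mul_rayIntegral (hn : 2 ≤ n) {a b q : ℕ} (h : a + b + 2 * q = m) (η : Rn n)
    (J : Fin m → Fin n) (ψ : 𝓢(Rn n, ℂ)) (x : Rn n) :
    IntegrableOn (fun l : ℝ => ((l ^ (halfDim n + (b + q : ℕ) - 1) : ℝ) : ℂ) *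
      gaussMoment l b η J ψ x) (Set.Ioi 0) ∧
    (Real.Gamma (halfDim n + (b + q : ℕ)) : ℂ) *
        rayIntegral 0 0 (fun p => (-(p.2 : ℂ)) ^ a * evalWeight η b J p.1) ψ x =
      2 * (-1) ^ a * ∫ l in Set.Ioi (0 : ℝ), ((l ^ (halfDim n + (b + q : ℕ) - 1) : ℝ) : ℂ) *
        gaussMoment l b η J ψ x := by
  have := nontrivial_Rn hn
  have pos := halfDim_pos hn
  obtain ⟨integrable, polar⟩ := rayIntegral_eq_integral_rieszIntegrand hn h η J ψ x
  obtain ⟨superposition_integrable, superposition⟩ := integral_rpow_mul_integral_exp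
    (r := fun z : Rn n => ‖z‖ ^ 2) (F := fun z => evalWeight η b J z * ψ (z + x))
    (s := halfDim n + (b + q : ℕ)) (by positivity) (by fun_prop) ae_norm_sq_pos
    (measurable_evalWeight_mul_shift b η J ψ x).aestronglyMeasurable integrable
  refine ⟨superposition_integrable, ?_⟩
  have sign_sq : ((-1 : ℂ) ^ a) * (-1) ^ a = 1 := by rw [← mul_pow]; simp
  calc _ = Real.Gamma (halfDim n + (b + q : ℕ)) * ((-1) ^ a * ((-1) ^ a *
        rayIntegral 0 0 (fun p => (-(p.2 : ℂ)) ^ a * evalWeight η b J p.1) ψ x)) := by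
        rw [← mul_assoc ((-1) ^ a), sign_sq, one_mul]
    _ = 2 * (-1) ^ a * (Real.Gamma (halfDim n + (b + q : ℕ)) *
        ∫ z, rieszIntegrand (b + q) b η J ψ x z) := by
        rw [polar]
        ring
    _ = _ := by
        rw [← show _ = _ * ∫ z, rieszIntegrand (b + q) b η J ψ x z from superposition]
        rfl

/-- The translate `z ↦ ψ(z + x)`. -/
def schwartzShift (x : Rn n) (ψ : 𝓢(Rn n, ℂ)) : 𝓢(Rn n, ℂ) :=
  SchwartzMap.compSubConstCLM ℂ (-x) ψ

lemma schwartzShift_apply (x : Rn n) (ψ : 𝓢(Rn n, ℂ)) (z : Rn n) :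
    schwartzShift x ψ z = ψ (z + x) := by
  rw [schwartzShift, SchwartzMap.compSubConstCLM_apply, sub_neg_eq_add]

lemma schwartzDeriv_iterate_shift (η x : Rn n) (ψ : 𝓢(Rn n, ℂ)) (a : ℕ) :
    (schwartzDeriv η)^[a] (schwartzShift x ψ) = schwartzShift x ((schwartzDeriv η)^[a] ψ) := by
  have commute : Function.Commute (schwartzDeriv η) (schwartzShift x) := fun ψ => by
    ext z
    rw [schwartzShift_apply, SchwartzMap.lineDerivOp_apply_eq_fderiv,
      SchwartzMap.lineDerivOp_apply_eq_fderiv, funext (schwartzShift_apply x ψ),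
      fderiv_comp_add_right]
  exact commute.iterate_left a ψ

lemma vecPow_eq_inner_prod (z : Rn n) (J : Fin m → Fin n) :
    vecPow z J = ∏ i, ((inner ℝ z (basisVec (J i)) : ℝ) : ℂ) := by
  simp only [vecPow, ← inner_basisVec_left, real_inner_comm]

lemma hasTemperateGrowth_evalWeight (η : Rn n) (b : ℕ) (J : Fin m → Fin n) :
    (evalWeight η b J).HasTemperateGrowth := by
  unfold evalWeight
  simp only [vecPow_eq_inner_prod]
  exact ((hasTemperateGrowth_inner η).pow b).mul (hasTemperateGrowth_inner_prod _ _)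

/-- The coefficient of `λ^{b+q} ⟨z,η⟩^b` in the expansion of `(-1)^a K_{b+2q} / a!`. -/
def gaussCoeff (a b q : ℕ) (η : Rn n) : ℂ :=
  (-1) ^ a * (-1) ^ q * 2 ^ b * ((‖η‖ ^ 2 : ℝ) : ℂ) ^ q / ((q ! : ℂ) * (b ! : ℂ) * (a ! : ℂ))

lemma hermiteTerm_mul_vecPow {r q : ℕ} (hq : q ∈ Finset.range (r / 2 + 1)) (a : ℕ) (l : ℝ)
    (η z : Rn n) (J : Fin m → Fin n) :
    (-1) ^ a / (a ! : ℂ) * (hermiteTerm r q (2 * l * ((inner ℝ z η : ℝ) : ℂ))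
        (l * ((‖η‖ ^ 2 : ℝ) : ℂ)) * vecPow z J) =
      gaussCoeff a (r - 2 * q) q η * (l : ℂ) ^ (r - 2 * q + q) * evalWeight η (r - 2 * q) J z := by
  obtain ⟨b, rfl⟩ : ∃ b, r = 2 * q + b := Nat.exists_eq_add_of_le (by
    rw [Finset.mem_range] at hq
    omega)
  rw [hermiteTerm_add, Nat.add_sub_cancel_left, gaussCoeff, evalWeight, mul_pow, mul_pow, mul_pow,
    pow_add]
  field_simp

lemma gaussSum_vecPow_expand {l : ℝ} (hl : 0 ≤ l) (η : Rn n) (ψ : 𝓢(Rn n, ℂ))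
    (J : Fin m → Fin n) (x : Rn n) :
    gaussSum l η (schwartzShift x ψ) m (fun z => vecPow z J) =
      ∑ a ∈ Finset.range (m + 1), ∑ q ∈ Finset.range ((m - a) / 2 + 1),
        gaussCoeff a (m - a - 2 * q) q η * (l : ℂ) ^ (m - a - 2 * q + q) *
          gaussMoment l (m - a - 2 * q) η J ((schwartzDeriv η)^[a] ψ) x := by
  unfold gaussSum
  refine Finset.sum_congr rfl fun a _ => ?_
  have moment_integrable (q : ℕ) := integrable_gauss_mul hl
    (hasTemperateGrowth_evalWeight η (m - a - 2 * q) J)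
    ((schwartzDeriv η)^[a] (schwartzShift x ψ))
  simp only [schwartzDeriv_iterate_shift, schwartzShift_apply, mul_assoc (gauss l _)]
    at moment_integrable ⊢
  simp only [gaussMoment, ← integral_const_mul]
  rw [← integral_finsetSum _ fun q _ => (moment_integrable q).const_mul _]
  congr 1 with z
  have expand : (-1) ^ a / (a ! : ℂ) * (hermiteField l η (m - a) z * vecPow z J) =
      ∑ q ∈ Finset.range ((m - a) / 2 + 1), gaussCoeff a (m - a - 2 * q) q η *
        (l : ℂ) ^ (m - a - 2 * q + q) * evalWeight η (m - a - 2 * q) J z := by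
    rw [hermiteField, hermiteSum, Finset.sum_mul, Finset.mul_sum]
    exact Finset.sum_congr rfl fun q hq => hermiteTerm_mul_vecPow hq a l η z J
  calc _ = gauss l z * ((-1) ^ a / (a ! : ℂ) * (hermiteField l η (m - a) z * vecPow z J)) *
        (schwartzDeriv η)^[a] ψ (z + x) := by ring
    _ = _ := by
        rw [expand, Finset.mul_sum, Finset.sum_mul]
        exact Finset.sum_congr rfl fun q _ => by ring

lemma gaussSum_vecPow {l : ℝ} (hl : 0 ≤ l) (η : Rn n) (ψ : 𝓢(Rn n, ℂ)) (J : Fin m → Fin n) :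
    gaussSum l η ψ m (fun z => vecPow z J) = vecPow η J * ∫ z, gauss l z * ψ z := by
  simpa only [← vecPow_eq_inner_prod, Finset.card_univ, Fintype.card_fin] using
    gaussSum_inner_prod Finset.univ (fun i => basisVec (J i)) hl η ψ

/-- The superposition `∫_0^∞ λ^{(n-3)/2} ∫ e^{-λ|z|²} ψ(z + x) dz dλ`, a multiple of the Riesz
potential `(-Δ)^{-1/2} ψ`. -/
def gaussPotential (ψ : 𝓢(Rn n, ℂ)) (x : Rn n) : ℂ :=
  ∫ l in Set.Ioi (0 : ℝ), ((l ^ (halfDim n - 1) : ℝ) : ℂ) * ∫ z, gauss l z * ψ (z + x)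

/-- The part of the integrand of `vecPow η J * gaussPotential ψ x` with indices `(a, b, q)`. -/
def potentialTerm (a b q : ℕ) (η : Rn n) (J : Fin m → Fin n) (ψ : 𝓢(Rn n, ℂ)) (x : Rn n) (l : ℝ) :
    ℂ :=
  ((l ^ (halfDim n - 1) : ℝ) : ℂ) *
    (gaussCoeff a b q η * (l : ℂ) ^ (b + q) * gaussMoment l b η J ((schwartzDeriv η)^[a] ψ) x)

lemma potentialTerm_eq (a b q : ℕ) (η : Rn n) (J : Fin m → Fin n) (ψ : 𝓢(Rn n, ℂ)) (x : Rn n)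
    {l : ℝ} (hl : 0 < l) :
    potentialTerm a b q η J ψ x l = gaussCoeff a b q η *
      (((l ^ (halfDim n + (b + q : ℕ) - 1) : ℝ) : ℂ) *
        gaussMoment l b η J ((schwartzDeriv η)^[a] ψ) x) := by
  have rpow_split : ((l ^ (halfDim n + (b + q : ℕ) - 1) : ℝ) : ℂ) =
      ((l ^ (halfDim n - 1) : ℝ) : ℂ) * (l : ℂ) ^ (b + q) := by
    rw [add_sub_right_comm, Real.rpow_add hl, Real.rpow_natCast]
    push_cast
    ring
  rw [potentialTerm, rpow_split]
  ring

lemma integrableOn_potentialTerm (hn : 2 ≤ n) {a b q : ℕ} (h : a + b + 2 * q = m) (η : Rn n)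
    (J : Fin m → Fin n) (ψ : 𝓢(Rn n, ℂ)) (x : Rn n) :
    IntegrableOn (potentialTerm a b q η J ψ x) (Set.Ioi 0) :=
  IntegrableOn.congr_fun
    ((Gamma_mul_rayIntegral hn h η J ((schwartzDeriv η)^[a] ψ) x).1.const_mul _)
    (fun _ hl => (potentialTerm_eq a b q η J ψ x hl).symm) measurableSet_Ioi

lemma doubleFactorial_mul_rayIntegral (hn : 2 ≤ n) {a b q : ℕ} (h : a + b + 2 * q = m) (η : Rn n)
    (J : Fin m → Fin n) (ψ : 𝓢(Rn n, ℂ)) (x : Rn n) :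
    (((n + 2 * (b + q) - 3)‼ : ℕ) : ℂ) * ((-1) ^ q /
        (2 ^ q * (q ! : ℂ) * (b ! : ℂ) * (a ! : ℂ))) * ((‖η‖ ^ 2 : ℝ) : ℂ) ^ q *
      rayIntegral 0 0 (fun p => (-(p.2 : ℂ)) ^ a * evalWeight η b J p.1)
        ((schwartzDeriv η)^[a] ψ) x =
    2 * ((((n - 3)‼ : ℕ) / Real.Gamma (halfDim n) : ℝ) : ℂ) *
      ∫ l in Set.Ioi (0 : ℝ), potentialTerm a b q η J ψ x l := by
  have double_factorial : (((n + 2 * (b + q) - 3)‼ : ℕ) : ℂ) =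
      ((((n - 3)‼ : ℕ) / Real.Gamma (halfDim n) : ℝ) : ℂ) * 2 ^ (b + q) *
        (Real.Gamma (halfDim n + (b + q : ℕ)) : ℂ) := by
    exact_mod_cast congrArg (fun r : ℝ => (r : ℂ)) (doubleFactorial_eq_Gamma hn (b + q))
  have superposition := (Gamma_mul_rayIntegral hn h η J ((schwartzDeriv η)^[a] ψ) x).2
  rw [setIntegral_congr_fun measurableSet_Ioi fun l hl => potentialTerm_eq a b q η J ψ x hl,
    integral_const_mul, double_factorial, gaussCoeff]
  set κ := ((((n - 3)‼ : ℕ) / Real.Gamma (halfDim n) : ℝ) : ℂ)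
  calc _ = κ * 2 ^ (b + q) * ((-1) ^ q / (2 ^ q * (q ! : ℂ) * (b ! : ℂ) * (a ! : ℂ))) *
        ((‖η‖ ^ 2 : ℝ) : ℂ) ^ q * (Real.Gamma (halfDim n + (b + q : ℕ)) * rayIntegral 0 0
          (fun p => (-(p.2 : ℂ)) ^ a * evalWeight η b J p.1) ((schwartzDeriv η)^[a] ψ) x) := by
        ring
    _ = _ := by
        rw [superposition, pow_add]
        field_simp

lemma sum_rayIntegral_eq_gaussPotential (hn : 2 ≤ n) (J : Fin m → Fin n) (η : Rn n)
    (ψ : 𝓢(Rn n, ℂ)) (x : Rn n) :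
    ∑ a ∈ Finset.range (m + 1), ∑ q ∈ Finset.range ((m - a) / 2 + 1),
        (((n + 2 * (m - a - q) - 3)‼ : ℕ) : ℂ) * ((-1) ^ q /
          (2 ^ q * (q ! : ℂ) * ((m - a - 2 * q)! : ℂ) * (a ! : ℂ))) * ((‖η‖ ^ 2 : ℝ) : ℂ) ^ q *
        rayIntegral 0 0 (fun p => (-(p.2 : ℂ)) ^ a * evalWeight η (m - a - 2 * q) J p.1)
          ((schwartzDeriv η)^[a] ψ) x =
    2 * ((((n - 3)‼ : ℕ) / Real.Gamma (halfDim n) : ℝ) : ℂ) *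
      (vecPow η J * gaussPotential ψ x) := by
  have degree : ∀ a ∈ Finset.range (m + 1), ∀ q ∈ Finset.range ((m - a) / 2 + 1),
      a + (m - a - 2 * q) + 2 * q = m ∧ m - a - q = m - a - 2 * q + q := fun a ha q hq => by
    rw [Finset.mem_range] at ha hq
    omega
  have term_integrable : ∀ a ∈ Finset.range (m + 1), ∀ q ∈ Finset.range ((m - a) / 2 + 1),
      Integrable (potentialTerm a (m - a - 2 * q) q η J ψ x) (volume.restrict (Set.Ioi 0)) :=
    fun a ha q hq => integrableOn_potentialTerm hn (degree a ha q hq).1 η J ψ x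
  rw [Finset.sum_congr rfl fun a ha => Finset.sum_congr rfl fun q hq => by
    rw [(degree a ha q hq).2, doubleFactorial_mul_rayIntegral hn (degree a ha q hq).1 η J ψ x]]
  simp only [← Finset.mul_sum]
  congr 1
  rw [Finset.sum_congr rfl fun a ha => (integral_finsetSum _ (term_integrable a ha)).symm,
    ← integral_finsetSum _ fun a ha => integrable_finsetSum _ (term_integrable a ha),
    gaussPotential, ← integral_const_mul]
  refine setIntegral_congr_fun measurableSet_Ioi fun l (hl : 0 < l) => ?_
  have hermite_sum := gaussSum_vecPow hl.le η (schwartzShift x ψ) J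
  rw [gaussSum_vecPow_expand hl.le] at hermite_sum
  simp only [schwartzShift_apply] at hermite_sum
  rw [mul_left_comm, ← hermite_sum]
  simp only [potentialTerm, Finset.mul_sum]

lemma tensorEval_sumField_eq_gaussPotential (hn : 2 ≤ n) (f : 𝓢(Rn n, SymTensor n m))
    (x η : Rn n) :
    tensorEval (sumField f x) η = (((2 * Real.pi ^ (((n : ℝ) + 1) / 2))⁻¹ : ℝ) : ℂ) *
      ∑ J, gaussPotential (schwartzComp f J) x * vecPow η J := by
  rw [tensorEval_sumField, ← coeffC₀_eq hn m]
  simp only [Finset.mul_sum]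
  rw [Finset.sum_congr rfl fun a _ => Finset.sum_comm, Finset.sum_comm]
  refine Finset.sum_congr rfl fun J _ => ?_
  simp only [← Finset.mul_sum]
  rw [sum_rayIntegral_eq_gaussPotential hn J η (schwartzComp f J) x]
  push_cast
  ring

end RieszPotential

/-! ### The Riesz potential as a Fourier multiplier -/

section PlaneWave

variable {E : Type*} [NormedAddCommGroup E] [InnerProductSpace ℝ E]

/-- The character `e^{i⟨x,y⟩}`, the kernel of the inverse Fourier transform. -/
def planeWave (x y : E) : ℂ := Complex.exp (Complex.I * ((inner ℝ x y : ℝ) : ℂ))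

lemma planeWave_comm (x y : E) : planeWave x y = planeWave y x := by
  rw [planeWave, real_inner_comm, planeWave]

lemma planeWave_add_left (x x' y : E) :
    planeWave (x + x') y = planeWave x y * planeWave x' y := by
  rw [planeWave, planeWave, planeWave, ← Complex.exp_add, inner_add_left, Complex.ofReal_add,
    mul_add]

lemma norm_planeWave (x y : E) : ‖planeWave x y‖ = 1 := by
  rw [planeWave, mul_comm, Complex.norm_exp_ofReal_mul_I]

@[fun_prop]
lemma continuous_planeWave : Continuous fun p : E × E => planeWave p.1 p.2 := by
  unfold planeWave; fun_prop

variable [MeasurableSpace E] [BorelSpace E] {μ : Measure E} {a b : E → ℂ}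

lemma integrable_planeWave_mul (ha : Integrable a μ) (x : E) :
    Integrable (fun y => planeWave x y * a y) μ :=
  ha.bdd_mul (c := 1) (Continuous.aestronglyMeasurable (by fun_prop))
    (Filter.Eventually.of_forall fun y => (norm_planeWave x y).le)

lemma integral_mul_integral_planeWave [SecondCountableTopology E] [SFinite μ] (ha : Integrable a μ)
    (hb : Integrable b μ) :
    ∫ x, a x * ∫ y, planeWave x y * b y ∂μ ∂μ = ∫ y, b y * ∫ x, planeWave y x * a x ∂μ ∂μ := by
  have joint : Integrable (Function.uncurry fun x y => a x * (planeWave x y * b y)) (μ.prod μ) := by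
    refine ((ha.mul_prod hb).bdd_mul (c := 1) (f := fun p : E × E => planeWave p.1 p.2)
      (Continuous.aestronglyMeasurable (by fun_prop))
      (Filter.Eventually.of_forall fun p => (norm_planeWave p.1 p.2).le)).congr ?_
    exact Filter.Eventually.of_forall fun p => mul_left_comm _ _ _
  simp only [← integral_const_mul]
  rw [integral_integral_swap joint]
  simp only [planeWave_comm, mul_left_comm, mul_comm]

end PlaneWave

section Fourier

variable {n : ℕ}

lemma fourierTInv_eq (h : Rn n → ℂ) (x : Rn n) :
    fourierTInv h x =
      (((2 * Real.pi) ^ (-(n : ℝ) / 2) : ℝ) : ℂ) * ∫ y, planeWave x y * h y := rfl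

lemma fourierT_eq_fourier (χ : Rn n → ℂ) (y : Rn n) :
    fourierT χ y = (((2 * Real.pi) ^ (-(n : ℝ) / 2) : ℝ) : ℂ) *
      FourierTransform.fourier χ ((2 * Real.pi)⁻¹ • y) := by
  have pi_ne_zero : (Real.pi : ℂ) ≠ 0 := by exact_mod_cast Real.pi_ne_zero
  rw [fourierT, Real.fourier_eq']
  congr 2
  ext x
  rw [smul_eq_mul, real_inner_smul_right, real_inner_comm]
  congr 2
  push_cast
  field_simp

/-- The Fourier transform `fourierT` of a Schwartz function, as a Schwartz function. -/
def schwartzFourier (χ : 𝓢(Rn n, ℂ)) : 𝓢(Rn n, ℂ) :=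
  (((2 * Real.pi) ^ (-(n : ℝ) / 2) : ℝ) : ℂ) •
    SchwartzMap.compCLMOfContinuousLinearEquiv ℂ
      (ContinuousLinearEquiv.smulLeft (Units.mk0 (2 * Real.pi)⁻¹ (by positivity)) :
        Rn n ≃L[ℝ] Rn n) (FourierTransform.fourier χ)

lemma coe_schwartzFourier (χ : 𝓢(Rn n, ℂ)) : ⇑(schwartzFourier χ) = fourierT χ :=
  funext fun y => (fourierT_eq_fourier χ y).symm

lemma integrable_fourierT (χ : 𝓢(Rn n, ℂ)) : Integrable (fourierT χ) :=
  coe_schwartzFourier χ ▸ (schwartzFourier χ).integrable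

lemma fourierTInv_fourierT (χ : 𝓢(Rn n, ℂ)) (x : Rn n) :
    fourierTInv (fourierT χ) x = χ x := by
  have two_pi_pos : (0 : ℝ) < 2 * Real.pi := by positivity
  have inversion := congrFun (χ.continuous.fourierInv_fourier_eq χ.integrable
    (FourierTransform.fourier χ).integrable) x
  have rescale := Measure.integral_comp_inv_smul (volume : Measure (Rn n)) (fun v : Rn n =>
    Complex.exp (((2 * Real.pi * inner ℝ v x : ℝ) : ℂ) * Complex.I) •
      FourierTransform.fourier (χ : Rn n → ℂ) v) (2 * Real.pi)
  rw [finrank_euclideanSpace_fin, abs_of_pos (by positivity)] at rescale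
  have integrand_eq (y : Rn n) : Complex.exp (Complex.I * ((inner ℝ x y : ℝ) : ℂ)) * fourierT χ y =
      (((2 * Real.pi) ^ (-(n : ℝ) / 2) : ℝ) : ℂ) *
      (Complex.exp (((2 * Real.pi * inner ℝ ((2 * Real.pi)⁻¹ • y) x : ℝ) : ℂ) * Complex.I) •
      FourierTransform.fourier (χ : Rn n → ℂ) ((2 * Real.pi)⁻¹ • y)) := by
    rw [fourierT_eq_fourier, real_inner_smul_left, mul_inv_cancel_left₀ two_pi_pos.ne',
      real_inner_comm, smul_eq_mul, mul_comm Complex.I]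
    ring
  rw [← inversion, Real.fourierInv_eq', fourierTInv]
  simp only [integrand_eq]
  rw [integral_const_mul, rescale, Complex.real_smul, ← mul_assoc, ← mul_assoc,
    ← Complex.ofReal_mul, ← Complex.ofReal_mul, ← Real.rpow_natCast, ← Real.rpow_add two_pi_pos,
    ← Real.rpow_add two_pi_pos, show -(n : ℝ) / 2 + -(n : ℝ) / 2 + n = 0 by ring, Real.rpow_zero,
    Complex.ofReal_one, one_mul]

lemma norm_fourierTInv_le (h : Rn n → ℂ) (x : Rn n) :
    ‖fourierTInv h x‖ ≤ (2 * Real.pi) ^ (-(n : ℝ) / 2) * ∫ y, ‖h y‖ := by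
  rw [fourierTInv_eq, norm_mul, Complex.norm_real, Real.norm_eq_abs, abs_of_pos (by positivity)]
  gcongr
  refine (norm_integral_le_integral_norm _).trans_eq ?_
  simp only [norm_mul, norm_planeWave, one_mul]

lemma continuous_fourierTInv {h : Rn n → ℂ} (hh : Integrable h) : Continuous (fourierTInv h) := by
  refine continuous_const.mul (continuous_of_dominated (bound := fun y => ‖h y‖)
    (fun x => (integrable_planeWave_mul hh x).aestronglyMeasurable)
    (fun x => Filter.Eventually.of_forall fun y => ?_) hh.norm
    (Filter.Eventually.of_forall fun y => by fun_prop))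
  rw [← planeWave, norm_mul, norm_planeWave, one_mul]

lemma isTempered_of_bounded {u : Rn n → ℂ} (hu : Continuous u) {C : ℝ} (hC : ∀ x, ‖u x‖ ≤ C) :
    IsTempered u := by
  have decay : Integrable (fun x : Rn n => ((1 + ‖x‖) ^ (n + 1))⁻¹) := by
    have := integrable_one_add_norm (E := Rn n) (μ := volume) (r := n + 1) (by simp)
    refine this.congr (Filter.Eventually.of_forall fun x => ?_)
    beta_reduce
    rw [Real.rpow_neg (by positivity)]
    norm_cast
  refine ⟨n + 1, (decay.mul_const C).mono'
    (decay.aestronglyMeasurable.smul hu.aestronglyMeasurable)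
    (Filter.Eventually.of_forall fun x => ?_)⟩
  rw [norm_smul, Real.norm_eq_abs, abs_of_nonneg (by positivity)]
  gcongr
  exact hC x

lemma hasFourier_fourierTInv {h : Rn n → ℂ} (hh : Integrable h) : HasFourier (fourierTInv h) h := by
  refine ⟨isTempered_of_bounded (continuous_fourierTInv hh) (norm_fourierTInv_le h),
    ⟨0, by simpa using hh⟩, fun χ => ?_⟩
  simp only [fourierTInv_eq, mul_comm _ (fourierT χ _), mul_left_comm (fourierT χ _)]
  rw [integral_const_mul, integral_mul_integral_planeWave (integrable_fourierT χ) hh,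
    ← integral_const_mul]
  refine integral_congr_ae (Filter.Eventually.of_forall fun y => ?_)
  beta_reduce
  rw [mul_left_comm, ← fourierTInv_eq, fourierTInv_fourierT]

lemma integrable_norm_inv_mul (hn : 2 ≤ n) (χ : 𝓢(Rn n, ℂ)) :
    Integrable (fun y => ((‖y‖⁻¹ : ℝ) : ℂ) * χ y) := by
  have := nontrivial_Rn hn
  have weight : IsRayWeight (fun p : Sph (Rn n) × ℝ => ((|p.2| ^ (n - 2) : ℝ) : ℂ)) := by
    refine ⟨by fun_prop, 1, n - 2, zero_le_one, fun p => ?_⟩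
    rw [Complex.norm_real, Real.norm_eq_abs, abs_of_nonneg (by positivity), one_mul]
    gcongr
    exact le_add_of_nonneg_left zero_le_one
  refine (integral_rayMeasure_polar (by fun_prop) ?_).1
  refine (weight.integrable 0 0 χ 0).congr ?_
  filter_upwards [rayMeasure_ae_ne_zero] with p hp
  have abs_ne_zero : |p.2| ≠ 0 := abs_ne_zero.2 hp
  simp only [rayWeight, pow_zero, one_mul, zero_add, finrank_euclideanSpace_fin,
    show n - 1 = n - 2 + 1 by omega, pow_succ, norm_smul, Real.norm_eq_abs,
    norm_eq_of_mem_sphere, mul_one, Complex.real_smul]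
  rw [← mul_assoc, ← Complex.ofReal_mul, mul_assoc, mul_inv_cancel₀ abs_ne_zero, mul_one]

lemma integrable_norm_inv_mul_fourierT (hn : 2 ≤ n) (ψ : 𝓢(Rn n, ℂ)) :
    Integrable (fun y => ((‖y‖⁻¹ : ℝ) : ℂ) * fourierT ψ y) :=
  coe_schwartzFourier ψ ▸ integrable_norm_inv_mul hn (schwartzFourier ψ)

lemma hasSqrtNegLaplacian_fourierTInv_norm_inv (hn : 2 ≤ n) (ψ : 𝓢(Rn n, ℂ)) :
    HasSqrtNegLaplacian (fourierTInv (fun y => ((‖y‖⁻¹ : ℝ) : ℂ) * fourierT ψ y)) ψ := by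
  have := nontrivial_Rn hn
  have cancel : (fun y : Rn n => (‖y‖ : ℂ) * (((‖y‖⁻¹ : ℝ) : ℂ) * fourierT ψ y)) =ᵐ[volume]
      fourierT ψ := by
    filter_upwards [Measure.ae_ne volume (0 : Rn n)] with y hy
    rw [← mul_assoc, ← Complex.ofReal_mul, mul_inv_cancel₀ (norm_ne_zero_iff.2 hy),
      Complex.ofReal_one, one_mul]
  refine ⟨_, hasFourier_fourierTInv (integrable_norm_inv_mul_fourierT hn ψ),
    (integrable_fourierT ψ).congr cancel.symm, fun x => ?_⟩
  rw [← fourierTInv_fourierT ψ x, fourierTInv, fourierTInv]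
  congr 1
  refine integral_congr_ae ?_
  filter_upwards [cancel] with y hy
  rw [hy]

end Fourier

section GaussPotential

variable {n m : ℕ}

lemma integral_planeWave_mul_gauss {l : ℝ} (hl : 0 < l) (y : Rn n) :
    ∫ z, planeWave y z * gauss l z =
      (((Real.pi / l) ^ ((n : ℝ) / 2) : ℝ) : ℂ) * gauss (4 * l)⁻¹ y := by
  have gaussian := GaussianFourier.integral_cexp_neg_mul_sq_norm_add_of_euclideanSpace (ι := Fin n)
    (b := l) (by simpa) Complex.I y
  rw [Fintype.card_fin] at gaussian
  rw [Complex.ofReal_cpow (by positivity)]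
  convert gaussian using 1
  · congr 1
    ext z
    rw [planeWave, gauss, Complex.ofReal_exp, ← Complex.exp_add]
    congr 1
    push_cast
    ring
  · rw [gauss, Complex.ofReal_exp, Complex.I_sq]
    push_cast
    congr 2
    field_simp

lemma integral_gauss_mul_shift {l : ℝ} (hl : 0 < l) (ψ : 𝓢(Rn n, ℂ)) (x : Rn n) :
    ∫ z, gauss l z * ψ (z + x) = (((2 * Real.pi) ^ (-(n : ℝ) / 2) : ℝ) : ℂ) *
      ((((Real.pi / l) ^ ((n : ℝ) / 2) : ℝ) : ℂ) *
        ∫ y, gauss (4 * l)⁻¹ y * (planeWave x y * fourierT ψ y)) := by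
  have integrable_gauss : Integrable (gauss l : Rn n → ℂ) := by
    refine (GaussianFourier.integrable_cexp_neg_mul_sq_norm_add (V := Rn n) (b := l) (by simpa)
      0 0).congr (Filter.Eventually.of_forall fun z => ?_)
    simp [gauss]
  simp only [← fourierTInv_fourierT ψ, fourierTInv_eq, planeWave_add_left, mul_assoc,
    mul_left_comm (gauss l _)]
  rw [integral_const_mul, integral_mul_integral_planeWave integrable_gauss
    (integrable_planeWave_mul (integrable_fourierT ψ) x)]
  simp only [integral_planeWave_mul_gauss hl, ← integral_const_mul]
  refine integral_congr_ae (Filter.Eventually.of_forall fun y => ?_)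
  ring

lemma integral_rpow_smul_comp_mul_inv {F : Type*} [NormedAddCommGroup F] [NormedSpace ℝ F]
    (K : ℝ → F) (s : ℝ) {c : ℝ} (hc : 0 < c) :
    ∫ l in Set.Ioi (0 : ℝ), l ^ (-s - 1) • K (c * l)⁻¹ =
      c ^ s • ∫ v in Set.Ioi (0 : ℝ), v ^ (s - 1) • K v := by
  have invert := integral_comp_rpow_Ioi (fun u : ℝ => u ^ (s - 1) • K (u / c)) (p := -1)
    (by norm_num)
  have rescale := integral_comp_mul_left_Ioi' (fun u : ℝ => u ^ (s - 1) • K (u / c)) 0 hc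
  rw [mul_zero, ← invert] at rescale
  have inverted : ∫ l in Set.Ioi (0 : ℝ),
      (|(-1 : ℝ)| * l ^ (-1 - 1 : ℝ)) • ((l ^ (-1 : ℝ)) ^ (s - 1) • K (l ^ (-1 : ℝ) / c)) =
        ∫ l in Set.Ioi (0 : ℝ), l ^ (-s - 1) • K (c * l)⁻¹ := by
    refine setIntegral_congr_fun measurableSet_Ioi fun l (hl : 0 < l) => ?_
    rw [abs_neg, abs_one, one_mul, smul_smul, ← Real.rpow_mul hl.le, ← Real.rpow_add hl,
      Real.rpow_neg_one, mul_inv, inv_mul_eq_div]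
    ring_nf
  have rescaled : ∫ v in Set.Ioi (0 : ℝ), (c * v) ^ (s - 1) • K (c * v / c) =
      c ^ (s - 1) • ∫ v in Set.Ioi (0 : ℝ), v ^ (s - 1) • K v := by
    rw [← integral_smul]
    refine setIntegral_congr_fun measurableSet_Ioi fun v (hv : 0 < v) => ?_
    rw [Real.mul_rpow hc.le hv.le, mul_div_cancel_left₀ _ hc.ne', smul_smul]
  rw [← inverted, ← rescale, rescaled, smul_smul, mul_comm, ← Real.rpow_add_one hc.ne',
    sub_add_cancel]

lemma rpow_mul_pi_div_rpow {l : ℝ} (hl : 0 < l) :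
    l ^ (halfDim n - 1) * (Real.pi / l) ^ ((n : ℝ) / 2) =
      Real.pi ^ ((n : ℝ) / 2) * l ^ (-(1 / 2) - 1 : ℝ) := by
  rw [Real.div_rpow Real.pi_pos.le hl.le, ← mul_div_assoc, mul_comm, mul_div_assoc,
    ← Real.rpow_sub hl]
  unfold halfDim
  ring_nf

lemma integral_rpow_smul_integral_gauss (hn : 2 ≤ n) (ψ : 𝓢(Rn n, ℂ)) (x : Rn n) :
    ∫ v in Set.Ioi (0 : ℝ), v ^ (1 / 2 - 1 : ℝ) •
        ∫ y, gauss v y * (planeWave x y * fourierT ψ y) =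
      (Real.sqrt Real.pi : ℂ) * ∫ y, planeWave x y * (((‖y‖⁻¹ : ℝ) : ℂ) * fourierT ψ y) := by
  have := nontrivial_Rn hn
  have smul_eq (y : Rn n) : (‖y‖ ^ 2) ^ (-(1 / 2 : ℝ)) • (planeWave x y * fourierT ψ y) =
      planeWave x y * (((‖y‖⁻¹ : ℝ) : ℂ) * fourierT ψ y) := by
    rw [Real.rpow_neg (by positivity), ← Real.sqrt_eq_rpow, Real.sqrt_sq (norm_nonneg y),
      Complex.real_smul, mul_left_comm]
  have superposition := (integral_rpow_mul_integral_exp (s := 1 / 2) (μ := volume)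
    (r := fun y : Rn n => ‖y‖ ^ 2) (F := fun y => planeWave x y * fourierT ψ y) (by norm_num)
    (by fun_prop) ae_norm_sq_pos
    (integrable_planeWave_mul (integrable_fourierT ψ) x).aestronglyMeasurable
    (by simpa only [smul_eq] using
      integrable_planeWave_mul (integrable_norm_inv_mul_fourierT hn ψ) x)).2
  simpa only [smul_eq, Real.Gamma_one_half_eq, Complex.real_smul, gauss] using superposition

lemma gaussPotential_eq (hn : 2 ≤ n) (ψ : 𝓢(Rn n, ℂ)) (x : Rn n) :
    gaussPotential ψ x = ((2 * Real.pi ^ (((n : ℝ) + 1) / 2) : ℝ) : ℂ) *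
      fourierTInv (fun y => ((‖y‖⁻¹ : ℝ) : ℂ) * fourierT ψ y) x := by
  set K : ℝ → ℂ := fun v => ∫ y, gauss v y * (planeWave x y * fourierT ψ y) with hK
  have four_rpow : (4 : ℝ) ^ (1 / 2 : ℝ) = 2 := by
    rw [← Real.sqrt_eq_rpow, show (4 : ℝ) = 2 ^ 2 by norm_num, Real.sqrt_sq zero_le_two]
  have pi_rpow : Real.pi ^ (((n : ℝ) + 1) / 2) = Real.pi ^ ((n : ℝ) / 2) * Real.sqrt Real.pi := by
    rw [Real.sqrt_eq_rpow, ← Real.rpow_add Real.pi_pos]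
    ring_nf
  calc gaussPotential ψ x
      = (((2 * Real.pi) ^ (-(n : ℝ) / 2) * Real.pi ^ ((n : ℝ) / 2) : ℝ) : ℂ) *
          ∫ l in Set.Ioi (0 : ℝ), l ^ (-(1 / 2) - 1 : ℝ) • K (4 * l)⁻¹ := by
        rw [gaussPotential, ← integral_const_mul]
        refine setIntegral_congr_fun measurableSet_Ioi fun l (hl : 0 < l) => ?_
        have powers := congrArg (Complex.ofReal) (rpow_mul_pi_div_rpow (n := n) hl)
        rw [Complex.ofReal_mul, Complex.ofReal_mul] at powers
        rw [integral_gauss_mul_shift hl, Complex.real_smul, Complex.ofReal_mul]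
        linear_combination (((2 * Real.pi) ^ (-(n : ℝ) / 2) : ℝ) : ℂ) * K (4 * l)⁻¹ * powers
    _ = (((2 * Real.pi) ^ (-(n : ℝ) / 2) * Real.pi ^ ((n : ℝ) / 2) : ℝ) : ℂ) *
          (2 * ((Real.sqrt Real.pi : ℂ) *
            ∫ y, planeWave x y * (((‖y‖⁻¹ : ℝ) : ℂ) * fourierT ψ y))) := by
        rw [integral_rpow_smul_comp_mul_inv K _ four_pos, four_rpow, hK,
          integral_rpow_smul_integral_gauss hn, Complex.real_smul, Complex.ofReal_ofNat]
    _ = _ := by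
        rw [fourierTInv_eq, pi_rpow]
        push_cast
        ring

lemma sumField_eq_fourierTInv (hn : 2 ≤ n) (f : 𝓢(Rn n, SymTensor n m))
    (hsym : ∀ x, sumField f x ∈ SymTensor n m) (J : Fin m → Fin n) :
    (fun x => sumField f x J) =
      fourierTInv (fun y => ((‖y‖⁻¹ : ℝ) : ℂ) * fourierT (schwartzComp f J) y) := by
  ext x
  let riesz : Tensor n m := fun J =>
    fourierTInv (fun y => ((‖y‖⁻¹ : ℝ) : ℂ) * fourierT (schwartzComp f J) y) x
  have riesz_mem : riesz ∈ SymTensor n m := fun π J => by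
    have comp_perm : schwartzComp f (J ∘ π) = schwartzComp f J := SchwartzMap.ext fun y =>
      (f y).2 π J
    simp only [riesz, comp_perm]
  refine congrFun (eq_of_tensorEval_eq (hsym x) riesz_mem fun η => ?_) J
  rw [tensorEval_sumField_eq_gaussPotential hn f x η, tensorEval, Finset.mul_sum]
  refine Finset.sum_congr rfl fun J _ => ?_
  rw [gaussPotential_eq hn, ← mul_assoc, ← mul_assoc, ← Complex.ofReal_mul,
    inv_mul_cancel₀ (by positivity), Complex.ofReal_one, one_mul]

lemma hasSqrtNegLaplacian_sumField (hn : 2 ≤ n) (f : 𝓢(Rn n, SymTensor n m))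
    (hsym : ∀ x, sumField f x ∈ SymTensor n m) (J : Fin m → Fin n) :
    HasSqrtNegLaplacian (fun x => sumField f x J) (fun x => toField f x J) := by
  rw [sumField_eq_fourierTInv hn f hsym J]
  exact hasSqrtNegLaplacian_fourierTInv_norm_inv hn (schwartzComp f J)

end GaussPotential

/-! ### Differential operators on tensor fields -/

section DiffOp

variable {n : ℕ}

lemma fderiv_iteratedFDeriv_apply {s : ℕ} {h : Rn n → ℂ} (hh : ContDiff ℝ ∞ h)
    (v : Fin s → Rn n) (x w : Rn n) :
    fderiv ℝ (fun y => iteratedFDeriv ℝ s h y v) x w =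
      iteratedFDeriv ℝ (s + 1) h x (Fin.cons w v) := by
  have differentiable : DifferentiableAt ℝ (iteratedFDeriv ℝ s h) x :=
    hh.differentiable_iteratedFDeriv (by exact_mod_cast WithTop.coe_lt_top s) x
  rw [iteratedFDeriv_succ_apply_left, Fin.cons_zero, Fin.tail_cons,
    fderiv_continuousMultilinear_apply_const_apply differentiable]

lemma contDiff_iteratedFDeriv_apply {s : ℕ} {h : Rn n → ℂ} (hh : ContDiff ℝ ∞ h)
    (v : Fin s → Rn n) : ContDiff ℝ ∞ (fun y => iteratedFDeriv ℝ s h y v) :=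
  (ContinuousMultilinearMap.apply ℝ (fun _ : Fin s => Rn n) ℂ v).contDiff.comp
    (hh.iteratedFDeriv_right (m := ∞) (i := s) (by norm_cast))

/-- Scalar-valued linear differential operators of order at most `r` on tensor fields. Only the
values on smooth fields matter, whence the constructor `congr`. -/
inductive IsScalarDiffOp {n a : ℕ} (r : ℕ) : (Field n a → Rn n → ℂ) → Prop
  | monomial {s : ℕ} (hs : s ≤ r) (α : Fin s → Fin n) (J : Fin a → Fin n) {c : Rn n → ℂ}
      (hc : ContDiff ℝ ∞ c) : IsScalarDiffOp r fun g x =>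
        c x * iteratedFDeriv ℝ s (fun y => g y J) x (fun l => basisVec (α l))
  | zero : IsScalarDiffOp r fun _ _ => 0
  | add {T U : Field n a → Rn n → ℂ} :
      IsScalarDiffOp r T → IsScalarDiffOp r U → IsScalarDiffOp r fun g x => T g x + U g x
  | congr {T U : Field n a → Rn n → ℂ} :
      IsScalarDiffOp r T → (∀ g, ContDiff ℝ ∞ g → U g = T g) → IsScalarDiffOp r U

namespace IsScalarDiffOp

variable {a r : ℕ} {T : Field n a → Rn n → ℂ}

lemma contDiff (hT : IsScalarDiffOp r T) {g : Field n a} (hg : ContDiff ℝ ∞ g) :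
    ContDiff ℝ ∞ (T g) := by
  induction hT with
  | monomial _ _ J hc => exact hc.mul (contDiff_iteratedFDeriv_apply (contDiff_pi.1 hg J) _)
  | zero => exact contDiff_const
  | add _ _ hT hU => exact hT.add hU
  | congr _ eq hT => rw [eq g hg]; exact hT

lemma mono (hT : IsScalarDiffOp r T) {r' : ℕ} (hr : r ≤ r') : IsScalarDiffOp r' T := by
  induction hT with
  | monomial hs α J hc => exact monomial (hs.trans hr) α J hc
  | zero => exact zero
  | add _ _ hT hU => exact hT.add hU
  | congr _ eq hT => exact hT.congr eq

lemma mul (hT : IsScalarDiffOp r T) {d : Rn n → ℂ} (hd : ContDiff ℝ ∞ d) :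
    IsScalarDiffOp r fun g x => d x * T g x := by
  induction hT with
  | monomial hs α J hc =>
    exact (monomial hs α J (hd.mul hc)).congr fun g _ => funext fun x => (mul_assoc _ _ _).symm
  | zero => exact zero.congr fun g _ => funext fun x => mul_zero _
  | add _ _ hT hU => exact (hT.add hU).congr fun g _ => funext fun x => mul_add _ _ _
  | congr _ eq hT => exact hT.congr fun g hg => by rw [eq g hg]

lemma sum {ι : Type*} (s : Finset ι) {T : ι → Field n a → Rn n → ℂ}
    (hT : ∀ i ∈ s, IsScalarDiffOp r (T i)) : IsScalarDiffOp r fun g x => ∑ i ∈ s, T i g x := by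
  classical
  induction s using Finset.induction_on with
  | empty => simpa only [Finset.sum_empty] using zero (r := r)
  | insert i s hi ih =>
    simp only [Finset.sum_insert hi]
    exact (hT i (Finset.mem_insert_self i s)).add
      (ih fun j hj => hT j (Finset.mem_insert_of_mem hj))

lemma fderiv_monomial {s : ℕ} (α : Fin s → Fin n) {c h : Rn n → ℂ} (hc : ContDiff ℝ ∞ c)
    (hh : ContDiff ℝ ∞ h) (x : Rn n) (j : Fin n) :
    fderiv ℝ (fun y => c y * iteratedFDeriv ℝ s h y (fun l => basisVec (α l))) x (basisVec j) =
      fderiv ℝ c x (basisVec j) * iteratedFDeriv ℝ s h x (fun l => basisVec (α l)) +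
        c x * iteratedFDeriv ℝ (s + 1) h x
          (fun l => basisVec ((Fin.cons j α : Fin (s + 1) → Fin n) l)) := by
  have cons_eq : (fun l => basisVec ((Fin.cons j α : Fin (s + 1) → Fin n) l)) =
      (Fin.cons (basisVec j) (fun l => basisVec (α l)) : Fin (s + 1) → Rn n) := by
    funext l
    refine Fin.cases ?_ (fun l => ?_) l <;> simp
  rw [cons_eq, ← fderiv_iteratedFDeriv_apply hh, fderiv_fun_mul (hc.differentiable (by simp) x)
    ((contDiff_iteratedFDeriv_apply hh _).differentiable (by simp) x)]
  simp only [add_apply, smul_apply, smul_eq_mul]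
  ring

lemma fderiv_basisVec (hT : IsScalarDiffOp r T) (j : Fin n) :
    IsScalarDiffOp (r + 1) fun g x => fderiv ℝ (T g) x (basisVec j) := by
  induction hT with
  | monomial hs α J hc =>
    exact ((monomial (hs.trans r.le_succ) α J (contDiff_dirDeriv (basisVec j) hc)).add
      (monomial (Nat.succ_le_succ hs) (Fin.cons j α) J hc)).congr fun g hg =>
        funext fun x => fderiv_monomial α hc (contDiff_pi.1 hg J) x j
  | zero => exact zero.congr fun g _ => funext fun x => by simp
  | add hT hU dT dU =>
    refine (dT.add dU).congr fun g hg => funext fun x => ?_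
    rw [fderiv_fun_add ((hT.contDiff hg).differentiable (by simp) x)
      ((hU.contDiff hg).differentiable (by simp) x), add_apply]
  | congr _ eq dT => exact dT.congr fun g hg => by rw [eq g hg]

lemma exists_coeff (hT : IsScalarDiffOp r T) :
    ∃ c : (s : ℕ) → (Fin s → Fin n) → (Fin a → Fin n) → Rn n → ℂ,
      (∀ s α J, ContDiff ℝ ∞ (c s α J)) ∧ ∀ g, ContDiff ℝ ∞ g → ∀ x,
        T g x = ∑ s ∈ Finset.range (r + 1), ∑ α : Fin s → Fin n, ∑ J : Fin a → Fin n,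
          c s α J x * iteratedFDeriv ℝ s (fun y => g y J) x (fun l => basisVec (α l)) := by
  classical
  induction hT with
  | @monomial s hs α J c hc =>
    refine ⟨fun s' β K x =>
      if (⟨s', β⟩ : Σ s, Fin s → Fin n) = ⟨s, α⟩ ∧ K = J then c x else 0,
      fun s' β K => ?_, fun g _ x => ?_⟩
    · beta_reduce
      split_ifs
      exacts [hc, contDiff_const]
    · rw [Finset.sum_eq_single_of_mem s (Finset.mem_range.2 (Nat.lt_succ_of_le hs))
        fun s' _ hs' => by simp [hs'],
        Finset.sum_eq_single_of_mem α (Finset.mem_univ _) fun β _ hβ => by simp [hβ],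
        Finset.sum_eq_single_of_mem J (Finset.mem_univ _) fun K _ hK => by simp [hK]]
      simp
  | zero => exact ⟨fun _ _ _ _ => 0, fun _ _ _ => contDiff_const, by simp⟩
  | add _ _ hT hU =>
    obtain ⟨c, hc, T_eq⟩ := hT
    obtain ⟨d, hd, U_eq⟩ := hU
    refine ⟨fun s α J x => c s α J x + d s α J x, fun s α J => (hc s α J).add (hd s α J),
      fun g hg x => ?_⟩
    simp only [T_eq g hg, U_eq g hg, add_mul, Finset.sum_add_distrib]
  | congr _ eq hT =>
    obtain ⟨c, hc, T_eq⟩ := hT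
    exact ⟨c, hc, fun g hg x => by rw [eq g hg, T_eq g hg]⟩

end IsScalarDiffOp

/-- Linear differential operators of order at most `r` between tensor fields: every component is
one. -/
def IsFieldDiffOp {a b : ℕ} (r : ℕ) (P : Field n a → Field n b) : Prop :=
  ∀ I, IsScalarDiffOp r fun g x => P g x I

namespace IsFieldDiffOp

variable {a b r : ℕ} {P : Field n a → Field n b}

lemma mono (hP : IsFieldDiffOp r P) {r' : ℕ} (hr : r ≤ r') : IsFieldDiffOp r' P :=
  fun I => (hP I).mono hr

lemma id : IsFieldDiffOp 0 (fun g : Field n a => g) := fun I =>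
  (IsScalarDiffOp.monomial le_rfl Fin.elim0 I (contDiff_const (c := 1))).congr fun g _ => by
    funext x; simp

lemma castRank (hP : IsFieldDiffOp r P) (b' : ℕ) : IsFieldDiffOp r fun g => castRank b' (P g) := by
  intro I
  unfold MomentumRay.castRank
  by_cases h : b = b'
  · simp only [h, dite_true]
    exact hP _
  · simpa only [h, dite_false] using IsScalarDiffOp.zero

lemma innerDeriv (hP : IsFieldDiffOp r P) : IsFieldDiffOp (r + 1) fun g => innerDeriv (P g) :=
  fun _ => (IsScalarDiffOp.sum _ fun _ _ => (hP _).fderiv_basisVec _).mul contDiff_const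

lemma innerDerivPow (hP : IsFieldDiffOp r P) (k : ℕ) :
    IsFieldDiffOp (r + k) fun g => innerDerivPow k (P g) := by
  induction k with
  | zero => exact hP
  | succ k ih => exact ih.innerDeriv

lemma opI (hP : IsFieldDiffOp r P) : IsFieldDiffOp r fun g => opI (P g) := fun _ =>
  (IsScalarDiffOp.sum _ fun _ _ => ((hP _).mul (contDiff_const (c := kronecker n _))).congr
    fun g _ => by funext x; exact mul_comm _ _).mul contDiff_const

lemma opIPow (hP : IsFieldDiffOp r P) (k : ℕ) : IsFieldDiffOp r fun g => opIPow k (P g) := by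
  induction k with
  | zero => exact hP
  | succ k ih => exact ih.opI

lemma divergence {P : Field n a → Field n (b + 1)} (hP : IsFieldDiffOp r P) :
    IsFieldDiffOp (r + 1) fun g => divergence (P g) := fun _ =>
  IsScalarDiffOp.sum _ fun _ _ => (hP _).fderiv_basisVec _

lemma divergencePow {k : ℕ} {P : Field n a → Field n (b + k)} (hP : IsFieldDiffOp r P) :
    IsFieldDiffOp (r + k) fun g => divergencePow k (P g) := by
  induction k generalizing r with
  | zero => exact hP
  | succ k ih =>
    exact (ih (P := fun g => MomentumRay.divergence (P g)) hP.divergence).mono (by omega)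

lemma contract {c : ℕ} {P : Field n a → Field n (b + c)} (hP : IsFieldDiffOp r P)
    {u : Rn n → Tensor n c} (hu : ∀ J, ContDiff ℝ ∞ fun x => u x J) :
    IsFieldDiffOp r fun g x => contract (u x) (P g x) := fun _ =>
  IsScalarDiffOp.sum _ fun J _ => ((hP _).mul (hu J)).congr
    fun g _ => by funext x; exact mul_comm _ _

lemma opJ {P : Field n a → Field n (b + 2)} (hP : IsFieldDiffOp r P) :
    IsFieldDiffOp r fun g => opJ (P g) := hP.contract fun _ => contDiff_const

lemma opJx {P : Field n a → Field n (b + 1)} (hP : IsFieldDiffOp r P) :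
    IsFieldDiffOp r fun g => opJx (P g) := hP.contract fun J =>
  Complex.ofRealCLM.contDiff.comp (EuclideanSpace.proj (𝕜 := ℝ) (J 0)).contDiff

lemma opJPow {k : ℕ} {P : Field n a → Field n (b + 2 * k)} (hP : IsFieldDiffOp r P) :
    IsFieldDiffOp r fun g => opJPow k (P g) := by
  induction k with
  | zero => exact hP
  | succ k ih => exact ih (P := fun g => MomentumRay.opJ (P g)) hP.opJ

lemma opJxPow {k : ℕ} {P : Field n a → Field n (b + k)} (hP : IsFieldDiffOp r P) :
    IsFieldDiffOp r fun g => opJxPow k (P g) := by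
  induction k with
  | zero => exact hP
  | succ k ih => exact ih (P := fun g => MomentumRay.opJx (P g)) hP.opJx

end IsFieldDiffOp

lemma isFieldDiffOp_termD {m k p q : ℕ} (hp : p ≤ m) :
    IsFieldDiffOp (m + k) (termD (n := n) (m := m) k p q) :=
  ((((((IsFieldDiffOp.id.castRank _).divergencePow).opJxPow).opJPow).opIPow q).innerDerivPow
    (p - q)).castRank m |>.mono (by omega)

lemma isFieldDiffOp_opD (m n k : ℕ) : IsFieldDiffOp (m + k) (opD m n k) := fun I =>
  (IsScalarDiffOp.sum _ fun _ hp => (IsScalarDiffOp.sum _ fun _ _ =>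
    (isFieldDiffOp_termD (Finset.mem_Icc.1 hp).2 I).mul contDiff_const).mul contDiff_const).mul
      contDiff_const

end DiffOp

section Symmetry

variable {n a k : ℕ}

lemma exists_perm_append {b : ℕ} (π : Equiv.Perm (Fin a)) (I : Fin a → Fin n)
    (J : Fin b → Fin n) :
    ∃ ρ : Equiv.Perm (Fin (a + b)), Fin.append (I ∘ π) J = Fin.append I J ∘ ρ := by
  refine ⟨finSumFinEquiv.permCongr (Equiv.sumCongr π (Equiv.refl _)), ?_⟩
  funext l
  refine Fin.addCases (fun i => ?_) (fun i => ?_) l <;> simp [Equiv.permCongr_apply]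

lemma contract_mem {b : ℕ} (u : Tensor n b) {v : Tensor n (a + b)}
    (hv : v ∈ SymTensor n (a + b)) : contract u v ∈ SymTensor n a := fun π I => by
  refine Finset.sum_congr rfl fun J _ => ?_
  obtain ⟨ρ, append_eq⟩ := exists_perm_append π I J
  rw [append_eq, hv ρ]

lemma divergence_mem {g : Field n (a + 1)} (hg : ∀ x, g x ∈ SymTensor n (a + 1))
    (x : Rn n) : divergence g x ∈ SymTensor n a := fun π I => by
  refine Finset.sum_congr rfl fun j _ => ?_
  obtain ⟨ρ, append_eq⟩ := exists_perm_append π I (fun _ : Fin 1 => j)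
  simp only [Fin.append_right_eq_snoc] at append_eq
  unfold pderiv
  rw [append_eq]
  simp only [hg _ ρ _]

lemma castRank_mem {b : ℕ} {g : Field n a} (hg : ∀ x, g x ∈ SymTensor n a) (x : Rn n) :
    castRank b g x ∈ SymTensor n b := by
  by_cases h : a = b
  · subst h
    rw [castRank_self]
    exact hg x
  · have castRank_eq_zero : castRank b g x = 0 := by
      funext I
      simp [castRank, h]
    rw [castRank_eq_zero]
    exact Submodule.zero_mem _

lemma divergencePow_mem {g : Field n (a + k)} (hg : ∀ x, g x ∈ SymTensor n (a + k)) :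
    ∀ x, divergencePow k g x ∈ SymTensor n a := by
  induction k with
  | zero => exact hg
  | succ k ih => exact ih (divergence_mem hg)

lemma opJPow_mem {g : Field n (a + 2 * k)} (hg : ∀ x, g x ∈ SymTensor n (a + 2 * k)) :
    ∀ x, opJPow k g x ∈ SymTensor n a := by
  induction k with
  | zero => exact hg
  | succ k ih => exact ih fun x => contract_mem _ (hg x)

lemma opJxPow_mem {g : Field n (a + k)} (hg : ∀ x, g x ∈ SymTensor n (a + k)) :
    ∀ x, opJxPow k g x ∈ SymTensor n a := by
  induction k with
  | zero => exact hg
  | succ k ih => exact ih fun x => contract_mem _ (hg x)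

lemma opIPow_mem {g : Field n a} (hg : ∀ x, g x ∈ SymTensor n a) :
    ∀ x, opIPow k g x ∈ SymTensor n (a + 2 * k) := by
  cases k with
  | zero => exact hg
  | succ k => exact fun x => symmetrize_mem _

lemma innerDerivPow_mem {g : Field n a} (hg : ∀ x, g x ∈ SymTensor n a) :
    ∀ x, innerDerivPow k g x ∈ SymTensor n (a + k) := by
  cases k with
  | zero => exact hg
  | succ k =>
    intro x
    change innerDeriv (innerDerivPow k g) x ∈ SymTensor n (a + k + 1)
    unfold innerDeriv
    exact symmetrize_mem _

variable {m : ℕ}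

lemma termD_mem {g : Field n m} (hg : ∀ x, g x ∈ SymTensor n m) (p q : ℕ) (x : Rn n) :
    termD k p q g x ∈ SymTensor n m :=
  castRank_mem (innerDerivPow_mem (opIPow_mem (opJPow_mem (opJxPow_mem (divergencePow_mem
    (castRank_mem hg)))))) x

lemma opD_mem {g : Field n m} (hg : ∀ x, g x ∈ SymTensor n m) (x : Rn n) :
    opD m n k g x ∈ SymTensor n m := fun π I => by
  simp only [opD, termD_mem hg _ _ x π I]

lemma isSmoothSym_opD {g : Field n m} (hg : IsSmoothSym g) : IsSmoothSym (opD m n k g) :=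
  ⟨contDiff_pi.2 fun I => (isFieldDiffOp_opD m n k I).contDiff hg.1, opD_mem hg.2⟩

lemma isDiffOpOfOrderLE_opD (m n k : ℕ) : IsDiffOpOfOrderLE (opD m n k) (m + k) := by
  choose c hc opD_eq using fun I => (isFieldDiffOp_opD m n k I).exists_coeff
  exact ⟨fun g hg => isSmoothSym_opD hg, fun s α J I => c I s α J, fun s α J I => hc I s α J,
    fun g hg x I => opD_eq I g hg.1 x⟩

lemma sumField_mem (f : 𝓢(Rn n, SymTensor n m)) (x : Rn n) : sumField f x ∈ SymTensor n m :=
  fun π I => Finset.sum_congr rfl fun k _ => opD_mem (isSmoothSym_normalOp f k).2 x π I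

end Symmetry

/-! ### The order of `D_{m,n}^k` is exactly `m + k` -/

section ExactOrder

open Polynomial

variable {n : ℕ}

/-- The tensor field `P(x_i) e_i ⊗ ⋯ ⊗ e_i` for a polynomial `P`, on which `D_{m,n}^k` can be
evaluated explicitly. -/
def polyField (m : ℕ) (i : Fin n) (P : ℂ[X]) : Field n m := fun x I =>
  P.eval (x i : ℂ) * vecPow (basisVec i) I

lemma hasFDerivAt_polynomial_coord (i : Fin n) (P : ℂ[X]) (x : Rn n) :
    HasFDerivAt (fun y : Rn n => P.eval (y i : ℂ))
      (P.derivative.eval (x i : ℂ) • Complex.ofRealCLM.comp (EuclideanSpace.proj (𝕜 := ℝ) i)) x :=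
  (P.hasDerivAt (x i : ℂ)).comp_hasFDerivAt (f := fun y : Rn n => (y i : ℂ)) x
    (Complex.ofRealCLM.comp (EuclideanSpace.proj (𝕜 := ℝ) i)).hasFDerivAt

lemma contDiff_polynomial_coord (i : Fin n) (P : ℂ[X]) :
    ContDiff ℝ ∞ (fun y : Rn n => P.eval (y i : ℂ)) := by
  have contDiff_eval : ContDiff ℝ ∞ (fun z : ℂ => P.eval z) := by
    simpa only [coe_aeval_eq_eval] using (P.contDiff_aeval (𝕜 := ℂ) (n := ∞)).restrict_scalars ℝ
  exact contDiff_eval.comp (Complex.ofRealCLM.comp (EuclideanSpace.proj (𝕜 := ℝ) i)).contDiff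

lemma fderiv_polynomial_coord (i : Fin n) (P : ℂ[X]) (x w : Rn n) :
    fderiv ℝ (fun y : Rn n => P.eval (y i : ℂ)) x w = P.derivative.eval (x i : ℂ) * (w i : ℂ) := by
  rw [(hasFDerivAt_polynomial_coord i P x).fderiv]
  simp

lemma iteratedFDeriv_polynomial_coord {s : ℕ} (i : Fin n) (P : ℂ[X]) (x : Rn n)
    (v : Fin s → Rn n) :
    iteratedFDeriv ℝ s (fun y : Rn n => P.eval (y i : ℂ)) x v =
      (derivative^[s] P).eval (x i : ℂ) * ∏ l, (v l i : ℂ) := by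
  induction s generalizing x with
  | zero => simp
  | succ s ih =>
    rw [← Fin.cons_self_tail v, ← fderiv_iteratedFDeriv_apply (contDiff_polynomial_coord i P)]
    simp only [ih]
    rw [fderiv_mul_const (hasFDerivAt_polynomial_coord i _ x).differentiableAt]
    simp only [_root_.smul_apply, fderiv_polynomial_coord, smul_eq_mul,
      Function.iterate_succ_apply', Fin.prod_univ_succ, Fin.cons_zero, Fin.cons_succ]
    ring

lemma dirDeriv_iterate_polynomial_coord (i : Fin n) (P : ℂ[X]) (r : ℕ) :
    (dirDeriv (basisVec i))^[r] (fun y : Rn n => P.eval (y i : ℂ)) =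
      fun y => (derivative^[r] P).eval (y i : ℂ) := by
  induction r generalizing P with
  | zero => rfl
  | succ r ih =>
    rw [Function.iterate_succ_apply, Function.iterate_succ_apply, ← ih]
    congr 1
    funext y
    simp [dirDeriv, fderiv_polynomial_coord, basisVec_apply]

lemma isSmoothSym_polyField (m : ℕ) (i : Fin n) (P : ℂ[X]) : IsSmoothSym (polyField m i P) :=
  ⟨contDiff_pi.2 fun _ => (contDiff_polynomial_coord i P).mul contDiff_const,
    fun x π I => congrArg (P.eval (x i : ℂ) * ·) (vecPow_mem (basisVec i) π I)⟩

lemma castRank_polyField {a b : ℕ} (h : a = b) (i : Fin n) (P : ℂ[X]) :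
    castRank b (polyField a i P) = polyField b i P := by
  subst h
  exact castRank_self _

lemma divergence_polyField {m : ℕ} (i : Fin n) (P : ℂ[X]) :
    divergence (polyField (m + 1) i P) = polyField m i (derivative P) := by
  funext x I
  simp only [divergence, pderiv, polyField, vecPow_snoc]
  rw [Finset.sum_eq_single_of_mem i (Finset.mem_univ i) fun j _ hj => by simp [basisVec_apply, hj],
    fderiv_mul_const (hasFDerivAt_polynomial_coord i P x).differentiableAt]
  simp [fderiv_polynomial_coord, basisVec_apply, mul_comm]

lemma divergencePow_polyField {m : ℕ} (k : ℕ) (i : Fin n) (P : ℂ[X]) :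
    divergencePow k (polyField (m + k) i P) = polyField m i (derivative^[k] P) := by
  induction k generalizing P with
  | zero => rfl
  | succ k ih =>
    change divergencePow k (divergence (polyField (m + k + 1) i P)) = _
    rw [divergence_polyField, ih, Function.iterate_succ_apply]

lemma contract_polyField {m b : ℕ} (u : Tensor n b) (i : Fin n) (P : ℂ[X]) (x : Rn n) :
    contract u (polyField (m + b) i P x) =
      (P.eval (x i : ℂ) * tensorEval u (basisVec i)) • (vecPow (basisVec i) : Tensor n m) := by
  change contract u (P.eval (x i : ℂ) • vecPow (basisVec i)) = _
  rw [contract_smul, contract_vecPow, smul_smul]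

lemma opJx_polyField {m : ℕ} (i : Fin n) (P : ℂ[X]) :
    opJx (polyField (m + 1) i P) = polyField m i (X * P) := by
  funext x I
  rw [opJx, contract_polyField, tensorEval_vecTensor, real_inner_comm, inner_basisVec_left]
  simp [polyField, mul_comm]

lemma opJxPow_polyField {m : ℕ} (k : ℕ) (i : Fin n) (P : ℂ[X]) :
    opJxPow k (polyField (m + k) i P) = polyField m i (X ^ k * P) := by
  induction k generalizing P with
  | zero => rw [pow_zero, one_mul]; rfl
  | succ k ih =>
    change opJxPow k (opJx (polyField (m + k + 1) i P)) = _
    rw [opJx_polyField, ih, pow_succ, mul_assoc]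

lemma norm_basisVec (i : Fin n) : ‖(basisVec i : Rn n)‖ = 1 := by simp [basisVec]

lemma opJ_polyField {m : ℕ} (i : Fin n) (P : ℂ[X]) :
    opJ (polyField (m + 2) i P) = polyField m i P := by
  funext x I
  rw [opJ, contract_polyField, tensorEval_kronecker, norm_basisVec]
  simp [polyField]

lemma opJPow_polyField {m : ℕ} (k : ℕ) (i : Fin n) (P : ℂ[X]) :
    opJPow k (polyField (m + 2 * k) i P) = polyField m i P := by
  induction k with
  | zero => rfl
  | succ k ih =>
    change opJPow k (opJ (polyField (m + 2 * k + 2) i P)) = _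
    rw [opJ_polyField, ih]

lemma tensorEval_basisVec {m : ℕ} (u : Tensor n m) (i : Fin n) :
    tensorEval u (basisVec i) = u (fun _ => i) := by
  rw [tensorEval, Finset.sum_eq_single_of_mem (fun _ => i) (Finset.mem_univ _)]
  · simp [vecPow, basisVec_apply]
  · intro I _ hI
    obtain ⟨l, hl⟩ := Function.ne_iff.1 hI
    rw [show vecPow (basisVec i) I = 0 from
      Finset.prod_eq_zero (Finset.mem_univ l) (by simp [basisVec_apply, hl]), mul_zero]

lemma termD_polyField {m k p q : ℕ} (hkp : k + q ≤ p) (hpm : p + q ≤ m) (i : Fin n) (P : ℂ[X])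
    (x : Rn n) :
    termD k p q (polyField m i P) x (fun _ => i) =
      (derivative^[p - q] (X ^ (p - k - q) * derivative^[k] P)).eval (x i : ℂ) := by
  set Q := X ^ (p - k - q) * derivative^[k] P
  have smooth := (isSmoothSym_polyField (m - p - q) i Q).1
  have eval_opIPow : (fun y => tensorEval (opIPow q (polyField (m - p - q) i Q) y) (basisVec i)) =
      fun y => Q.eval (y i : ℂ) := by
    funext y
    rw [tensorEval_opIPow, tensorEval_basisVec, norm_basisVec]
    simp [polyField, vecPow, basisVec_apply]
  rw [← tensorEval_basisVec (termD k p q _ x), termD, tensorEval_castRank (by omega),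
    castRank_polyField (by omega), divergencePow_polyField, opJxPow_polyField, opJPow_polyField]
  have eval_innerDerivPow :=
    tensorEval_innerDerivPow (contDiff_opIPow smooth q) (basisVec i) (p - q)
  rw [eval_opIPow, dirDeriv_iterate_polynomial_coord] at eval_innerDerivPow
  exact congrFun eval_innerDerivPow x

lemma eval_iterate_derivative_X_pow_mul (m k a : ℕ) {j : ℕ} (hj : j ≤ m) :
    (derivative^[j] (X ^ a * derivative^[k] ((X - C (1 : ℂ)) ^ (m + k)))).eval 1 =
      if j = m then ((m ! * (m + k).descFactorial k : ℕ) : ℂ) else 0 := by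
  have factor : (X ^ a * derivative^[k] ((X - C (1 : ℂ)) ^ (m + k))).map (algebraMap ℂ ℂ) =
      (X - C (1 : ℂ)) ^ m * (((m + k).descFactorial k : ℂ[X]) * X ^ a) := by
    rw [iterate_derivative_X_sub_pow, Nat.add_sub_cancel, Algebra.algebraMap_self, map_id,
      nsmul_eq_mul]
    ring
  rw [← coe_aeval_eq_eval]
  split_ifs with h
  · subst h
    rw [aeval_iterate_derivative_self _ j (1 : ℂ) factor]
    simp
  · exact aeval_iterate_derivative_of_lt _ m (1 : ℂ) factor (lt_of_le_of_ne hj h)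

/-- At `e_i`, the field `(x_i - 1)^{m+k} e_i ⊗ ⋯ ⊗ e_i` vanishes to order `m + k`, so only the term
`p = m`, `q = 0`, in which all `m + k` derivatives hit that power, survives. -/
lemma opD_polyField {m k : ℕ} (hk : k ≤ m) (i : Fin n) :
    opD m n k (polyField m i ((X - C 1) ^ (m + k))) (basisVec i) (fun _ => i) =
      coeffC m n k * (((n - 3)‼ : ℕ) *
        (((m ! * (m + k).descFactorial k : ℕ) : ℂ) / ((m - k)! : ℕ))) := by
  have termD_eq : ∀ p ∈ Finset.Icc k m, ∀ q ∈ Finset.range (min p (min (m - p) (p - k)) + 1),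
      termD k p q (polyField m i ((X - C 1) ^ (m + k))) (basisVec i) (fun _ => i) =
        if p - q = m then ((m ! * (m + k).descFactorial k : ℕ) : ℂ) else 0 := fun p hp q hq => by
    rw [Finset.mem_Icc] at hp
    rw [Finset.mem_range] at hq
    rw [termD_polyField (by omega) (by omega), basisVec_apply, if_pos rfl, Complex.ofReal_one,
      eval_iterate_derivative_X_pow_mul _ _ _ (by omega)]
  have mem : m ∈ Finset.Icc k m := Finset.mem_Icc.2 ⟨hk, le_rfl⟩
  unfold opD
  rw [Finset.sum_eq_single_of_mem m mem]
  · have range_eq : Finset.range (min m (min (m - m) (m - k)) + 1) = {0} := by simp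
    rw [range_eq, Finset.sum_singleton, termD_eq m mem 0 (by simp), Nat.add_sub_cancel]
    simp [div_eq_inv_mul]
  · intro p hp hpm
    refine mul_eq_zero_of_right _ (Finset.sum_eq_zero fun q hq => ?_)
    rw [Finset.mem_Icc] at hp
    rw [termD_eq p (Finset.mem_Icc.2 hp) q hq, if_neg (by omega), mul_zero]

lemma coeffC_ne_zero {m : ℕ} (hn : 2 ≤ n) (k : ℕ) : coeffC m n k ≠ 0 := by
  have two_le : (2 : ℝ) ≤ n := by exact_mod_cast hn
  have gamma_pos : 0 < Real.Gamma ((2 * (m : ℝ) + n - 1) / 2) :=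
    Real.Gamma_pos_of_pos (by linarith [m.cast_nonneg (α := ℝ)])
  have doubleFactorial_pos : (0 : ℝ) < ((n + 2 * m - 3)‼ : ℕ) := by
    exact_mod_cast Nat.doubleFactorial_pos _
  refine mul_ne_zero (div_ne_zero (pow_ne_zero _ (by norm_num)) (by positivity))
    (div_ne_zero (by positivity) (mul_pos ?_ doubleFactorial_pos).ne')
  positivity

lemma opD_polyField_ne_zero {m k : ℕ} (hn : 2 ≤ n) (hk : k ≤ m) (i : Fin n) :
    opD m n k (polyField m i ((X - C 1) ^ (m + k))) (basisVec i) (fun _ => i) ≠ 0 := by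
  rw [opD_polyField hk]
  refine mul_ne_zero (Complex.ofReal_ne_zero.2 (coeffC_ne_zero hn k)) (mul_ne_zero ?_
    (div_ne_zero ?_ ?_)) <;> rw [Nat.cast_ne_zero]
  · exact (Nat.doubleFactorial_pos _).ne'
  · exact mul_ne_zero m.factorial_ne_zero (Nat.descFactorial_pos.2 (by omega)).ne'
  · exact (m - k).factorial_ne_zero

lemma iteratedFDeriv_polyField_eq_zero {m s N : ℕ} (hs : s < N) (i : Fin n) (J : Fin m → Fin n)
    (v : Fin s → Rn n) :
    iteratedFDeriv ℝ s (fun y => polyField m i ((X - C 1) ^ N) y J) (basisVec i) v = 0 := by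
  have component_eq : (fun y => polyField m i ((X - C 1) ^ N) y J) =
      fun y => (C (vecPow (basisVec i) J) * (X - C 1) ^ N).eval (y i : ℂ) := by
    funext y
    simp [polyField, mul_comm]
  rw [component_eq, iteratedFDeriv_polynomial_coord, iterate_derivative_C_mul,
    iterate_derivative_X_sub_pow, basisVec_apply, if_pos rfl]
  simp [Nat.sub_ne_zero_of_lt hs]

lemma isDiffOpOfOrder_opD {m k : ℕ} (hn : 2 ≤ n) (hk : k ≤ m) :
    IsDiffOpOfOrder (opD m n k) (m + k) := by
  refine ⟨isDiffOpOfOrderLE_opD m n k, fun r hr ⟨_, c, _, opD_eq⟩ => ?_⟩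
  let i : Fin n := ⟨0, by omega⟩
  refine opD_polyField_ne_zero hn hk i ?_
  rw [opD_eq _ (isSmoothSym_polyField m i _)]
  refine Finset.sum_eq_zero fun s hs => Finset.sum_eq_zero fun α _ =>
    Finset.sum_eq_zero fun J _ => ?_
  rw [Finset.mem_range] at hs
  rw [iteratedFDeriv_polyField_eq_zero (by omega), mul_zero]

end ExactOrder

/-! ### The formal adjoint of the ray transform -/

section FormalAdjoint

/-- A unit vector `ξ` identifies `ℝ × ξ^⊥` with `E`, through `(t, x) ↦ x + tξ`. -/
def orthogonalLineEquiv {E : Type*} [NormedAddCommGroup E] [InnerProductSpace ℝ E]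
    [FiniteDimensional ℝ E] [MeasurableSpace E] [BorelSpace E] (ξ : Sph E) :
    ℝ × (Submodule.span ℝ {(ξ : E)})ᗮ ≃ᵐ E :=
  let K := Submodule.span ℝ {(ξ : E)}
  let line := LinearIsometryEquiv.toSpanUnitSingleton (𝕜 := ℝ) (ξ : E) (norm_eq_of_mem_sphere ξ)
  ((MeasurableEquiv.prodCongr line.toHomeomorph.toMeasurableEquiv (MeasurableEquiv.refl Kᗮ)).trans
    (MeasurableEquiv.toLp 2 (K × Kᗮ))).trans
    K.orthogonalDecomposition.symm.toHomeomorph.toMeasurableEquiv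

section

variable {E : Type*} [NormedAddCommGroup E] [InnerProductSpace ℝ E] [FiniteDimensional ℝ E]
  [MeasurableSpace E] [BorelSpace E]

lemma orthogonalLineEquiv_apply (ξ : Sph E) (p : ℝ × (Submodule.span ℝ {(ξ : E)})ᗮ) :
    orthogonalLineEquiv ξ p = (p.2 : E) + p.1 • (ξ : E) := by
  rw [add_comm]
  exact (Submodule.span ℝ {(ξ : E)}).orthogonalDecomposition_symm_apply _

lemma measurePreserving_orthogonalLineEquiv (ξ : Sph E) :
    MeasurePreserving (orthogonalLineEquiv ξ) := by
  let K := Submodule.span ℝ {(ξ : E)}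
  let line := LinearIsometryEquiv.toSpanUnitSingleton (𝕜 := ℝ) (ξ : E) (norm_eq_of_mem_sphere ξ)
  exact K.orthogonalDecomposition.symm.measurePreserving.comp
    ((WithLp.volume_preserving_toLp K Kᗮ).comp
      (line.measurePreserving.prod (MeasurePreserving.id _)))

lemma integral_orthogonal_line {F : Type*} [NormedAddCommGroup F] [NormedSpace ℝ F] (ξ : Sph E)
    {h : E → F} (hh : Integrable h) :
    ∫ x : (Submodule.span ℝ {(ξ : E)})ᗮ, ∫ t : ℝ, h (x + t • (ξ : E)) = ∫ y, h y := by
  have preserving := measurePreserving_orthogonalLineEquiv ξ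
  rw [← preserving.integral_comp', Measure.volume_eq_prod, integral_prod_symm]
  · simp only [orthogonalLineEquiv_apply]
  · exact (preserving.integrable_comp_emb (orthogonalLineEquiv ξ).measurableEmbedding).2 hh

end

/-- The integrand which both `L²`-products in the duality between `I_m^k` and its adjoint
integrate over `(ξ, y)` and sum over `I`. -/
def adjointKernel {n m : ℕ} (k : ℕ) (f : 𝓢(Rn n, SymTensor n m)) (χ : 𝓢(Rn n × Rn n, ℂ))
    (I : Fin m → Fin n) (ξ y : Rn n) : ℂ :=
  ((inner ℝ y ξ : ℝ) : ℂ) ^ k * vecPow ξ I * conj (χ (y - (inner ℝ y ξ : ℝ) • ξ, ξ)) *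
    schwartzComp f I y

variable {n m : ℕ} (k : ℕ) (f : 𝓢(Rn n, SymTensor n m)) (χ : 𝓢(Rn n × Rn n, ℂ))
  (I : Fin m → Fin n)

lemma continuous_adjointKernel :
    Continuous (fun p : Rn n × Rn n => adjointKernel k f χ I p.1 p.2) := by
  have continuous_pow : Continuous fun p : Rn n × Rn n => ((inner ℝ p.2 p.1 : ℝ) : ℂ) ^ k := by
    fun_prop
  have continuous_conj : Continuous fun p : Rn n × Rn n =>
      conj (χ (p.2 - (inner ℝ p.2 p.1 : ℝ) • p.1, p.1)) :=
    Complex.continuous_conj.comp (χ.continuous.comp (by fun_prop))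
  exact ((continuous_pow.mul ((continuous_vecPow I).comp continuous_fst)).mul
    continuous_conj).mul ((schwartzComp f I).continuous.comp continuous_snd)

lemma exists_adjointKernel_bound :
    ∃ B : Rn n → ℝ, Integrable B ∧
      ∀ (ξ : Sph (Rn n)) y, ‖adjointKernel k f χ I ξ y‖ ≤ B y := by
  refine ⟨fun y => SchwartzMap.seminorm ℝ 0 0 χ * (‖y‖ ^ k * ‖schwartzComp f I y‖),
    ((schwartzComp f I).integrable_pow_mul volume k).const_mul _, fun ξ y => ?_⟩
  have norm_ξ : ‖(ξ : Rn n)‖ = 1 := norm_eq_of_mem_sphere ξ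
  have norm_inner_le : ‖((inner ℝ y (ξ : Rn n) : ℝ) : ℂ)‖ ≤ ‖y‖ := by
    rw [Complex.norm_real]
    simpa only [norm_ξ, mul_one] using norm_inner_le_norm (𝕜 := ℝ) y (ξ : Rn n)
  have norm_vecPow_le_one : ‖vecPow (ξ : Rn n) I‖ ≤ 1 := by
    simpa only [norm_ξ, one_pow] using norm_vecPow_le (ξ : Rn n) I
  rw [adjointKernel, norm_mul, norm_mul, norm_mul, norm_pow, RCLike.norm_conj]
  calc _ ≤ ‖y‖ ^ k * 1 * SchwartzMap.seminorm ℝ 0 0 χ * ‖schwartzComp f I y‖ := by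
        gcongr
        exact SchwartzMap.norm_le_seminorm ℝ χ _
    _ = _ := by ring

lemma integrable_adjointKernel :
    Integrable (fun p : Sph (Rn n) × Rn n => adjointKernel k f χ I p.1 p.2)
      ((volume : Measure (Rn n)).toSphere.prod volume) := by
  obtain ⟨B, hB, norm_le⟩ := exists_adjointKernel_bound k f χ I
  refine (hB.comp_snd (volume : Measure (Rn n)).toSphere).mono' ?_
    (Filter.Eventually.of_forall fun p => norm_le p.1 p.2)
  exact ((continuous_adjointKernel k f χ I).comp (by fun_prop :
    Continuous fun p : Sph (Rn n) × Rn n => ((p.1 : Rn n), p.2))).aestronglyMeasurable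

lemma integrable_adjointKernel_right (ξ : Sph (Rn n)) : Integrable (adjointKernel k f χ I ξ) := by
  obtain ⟨B, hB, norm_le⟩ := exists_adjointKernel_bound k f χ I
  exact hB.mono' ((continuous_adjointKernel k f χ I).comp
    (Continuous.prodMk_right (ξ : Rn n))).aestronglyMeasurable
    (Filter.Eventually.of_forall fun y => norm_le ξ y)

lemma integrable_adjointKernel_left (y : Rn n) :
    Integrable (fun ξ : Sph (Rn n) => adjointKernel k f χ I ξ y)
      (volume : Measure (Rn n)).toSphere := by
  obtain ⟨B, -, norm_le⟩ := exists_adjointKernel_bound k f χ I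
  refine (integrable_const (B y)).mono' ?_ (Filter.Eventually.of_forall fun ξ => norm_le ξ y)
  exact ((continuous_adjointKernel k f χ I).comp
    ((Continuous.prodMk_left y).comp continuous_subtype_val)).aestronglyMeasurable

lemma rayTransform_mul_conj (ξ : Sph (Rn n)) (x : (Submodule.span ℝ {(ξ : Rn n)})ᗮ) :
    rayTransform k (toField f) x ξ * conj (χ ((x : Rn n), (ξ : Rn n))) =
      ∫ t : ℝ, ∑ I, adjointKernel k f χ I ξ (x + t • (ξ : Rn n)) := by
  have inner_x : inner ℝ (x : Rn n) (ξ : Rn n) = 0 :=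
    (Submodule.mem_orthogonal' _ _).1 x.2 _ (Submodule.mem_span_singleton_self _)
  have inner_line (t : ℝ) : inner ℝ ((x : Rn n) + t • (ξ : Rn n)) (ξ : Rn n) = t := by
    rw [inner_add_left, inner_x, real_inner_smul_left, real_inner_self_eq_norm_sq,
      norm_eq_of_mem_sphere]
    ring
  rw [rayTransform, ← integral_mul_const]
  refine integral_congr_ae (Filter.Eventually.of_forall fun t => ?_)
  simp only [adjointKernel, inner_line, add_sub_cancel_right, schwartzComp_apply, Finset.mul_sum,
    Finset.sum_mul]
  exact Finset.sum_congr rfl fun I _ => by ring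

lemma mul_conj_rayAdjoint (y : Rn n) :
    toField f y I * conj (rayAdjoint m k (fun x ξ => χ (x, ξ)) y I) =
      ∫ ξ : Sph (Rn n), adjointKernel k f χ I ξ y ∂(volume : Measure (Rn n)).toSphere := by
  rw [rayAdjoint, ← integral_conj, ← integral_const_mul]
  refine integral_congr_ae (Filter.Eventually.of_forall fun ξ => ?_)
  simp only [adjointKernel, vecPow, map_mul, map_pow, map_prod, Complex.conj_ofReal,
    schwartzComp_apply]
  ring

lemma isFormalAdjoint_rayAdjoint (n m k : ℕ) : IsFormalAdjoint n m k := fun f χ => by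
  have unfold_lines (ξ : Sph (Rn n)) : ∫ x : (Submodule.span ℝ {(ξ : Rn n)})ᗮ, ∫ t : ℝ,
      ∑ I, adjointKernel k f χ I ξ (x + t • (ξ : Rn n)) = ∫ y, ∑ I, adjointKernel k f χ I ξ y :=
    integral_orthogonal_line ξ
      (integrable_finsetSum _ fun I _ => integrable_adjointKernel_right k f χ I ξ)
  unfold l2TangentSphere l2Field
  simp only [mul_conj_rayAdjoint, rayTransform_mul_conj, unfold_lines]
  rw [integral_integral_swap]
  · exact integral_congr_ae (Filter.Eventually.of_forall fun y =>
      integral_finsetSum _ fun I _ => integrable_adjointKernel_left k f χ I y)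
  · exact integrable_finsetSum _ fun I _ => integrable_adjointKernel k f χ I

end FormalAdjoint

end MomentumRay

end

theorem theorem3p1 (m n : ℕ) (hn : 2 ≤ n) :
    (∀ k ≤ m, IsFormalAdjoint n m k) ∧
    (∀ k ≤ m, IsDiffOpOfOrder (opD m n k) (m + k)) ∧
    ∀ f : 𝓢(Rn n, SymTensor n m),
      (∀ k ≤ m, IsSmoothSym (normalOp k (toField f))) ∧
      ∀ I : Fin m → Fin n,
        HasSqrtNegLaplacian
          (fun x => ∑ k ∈ Finset.range (m + 1), opD m n k (normalOp k (toField f)) x I)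
          (fun x => toField f x I) := by
  refine ⟨fun k _ => isFormalAdjoint_rayAdjoint n m k, fun k hk => isDiffOpOfOrder_opD hn hk,
    fun f => ⟨fun k _ => isSmoothSym_normalOp f k, fun I => ?_⟩⟩
  exact hasSqrtNegLaplacian_sumField hn f (sumField_mem f) I
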